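/- Let $\Delta_T$ be the Laplacian of the triangular lattice, written in the lattice coordinates $n=(n_1,n_2)\in\mathbb Z^2$ with respect to the basis $v_1=(1,0)$, $v_2=(\tfrac12,\tfrac{\sqrt3}{2})$: on $\ell^2(\mathbb Z^2)$, $$\Delta_Tf(n)=\tfrac16\big(f(n_1+1,n_2)+f(n_1-1,n_2)+f(n_1,n_2+1)+f(n_1,n_2-1)+f(n_1+1,n_2-1)+f(n_1-1,n_2+1)\big).$$ Let $\mathcal F:\ell^2(\mathbb Z^2)\to L^2([-\pi,\pi]^2)$, $\mathcal Ff(x)=\frac1{2\pi}\sum_n f(n)e^{-i\langle n,x\rangle}$, be the (unitary) Fourier transform, $\Delta_{\mathcal F}:=\mathcal F\Delta_T\mathcal F^{-1}$, and $F(x)=\frac13(\cos x_1+\cos x_2+\cos(x_1-x_2))$. With $U_jf(n)=f(n-e_j)$, $U_j^*f(n)=f(n+e_j)$ and $Q_jf(n)=n_jf(n)$, let $A$ be the closure in $\ell^2(\mathbb Z^2)$ of the operator defined on the rapidly decreasing functions by $$\frac i6\Big(\big(\tfrac{U_1^*-U_1}2+\tfrac{U_1^*U_2-U_1U_2^*}2\big)Q_1+\big(\tfrac{U_2^*-U_2}2+\tfrac{U_1U_2^*-U_1^*U_2}2\big)Q_2\Big)+\mathrm{adj},$$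 where adj is the formal adjoint, and let $\widehat A$ be the closure in $L^2([-\pi,\pi]^2)$ of $\varphi\mapsto\frac i2(\nabla F\cdot\nabla\varphi+\nabla\cdot(\varphi\nabla F))$ on smooth functions $\varphi$ that are $2\pi$-periodic in each variable. For a bounded self-adjoint operator $H$ and a self-adjoint operator $B$, write $H\in\mathcal C^1(B)$ if $t\mapsto e^{itB}He^{-itB}f$ is of class $C^1$ on $\mathbb R$ for every vector $f$. Write $[H,iB]_\circ$ for the bounded operator extending the form $(f,g)\mapsto i(\langle Hf,Bg\rangle-\langle Bf,Hg\rangle)$ on $\mathcal D(B)\times\mathcal D(B)$, where the scalar product is antilinear in its first entry. Write $E_{\mathcal I}(H)$ for the spectral projection of $H$ above $\mathcal I$. **Proposition.** The operators $A$ and $\widehat A$ are self-adjoint, $\Delta_{\mathcal F}\in\mathcal C^1(\widehat A)$ and $\Delta_T\in\mathcal C^1(A)$. The bounded operators $[\Delta_{\mathcal F},i\widehat A]_\circ$ and $[\Delta_T,iA]_\circ$ exist, and $[\Delta_{\mathcal F},i\widehat A]_\circ$ is the operator of multiplication by $\|\nabla F\|^2$. Moreover, let $\mathcal I$ be an open interval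 whose closure is included in $[-\frac12,1]\setminus\{-\frac12,-\frac13,1\}$. Then there exist $c>0$ and a compact operator $K$ on $L^2([-\pi,\pi]^2)$ such that $$E_{\mathcal I}(\Delta_{\mathcal F})\,[\Delta_{\mathcal F},i\widehat A]_\circ\,E_{\mathcal I}(\Delta_{\mathcal F})\ \ge\ c\,E_{\mathcal I}(\Delta_{\mathcal F})+K$$ and, with $K_T:=\mathcal F^{-1}K\mathcal F$, $$E_{\mathcal I}(\Delta_T)\,[\Delta_T,iA]_\circ\,E_{\mathcal I}(\Delta_T)\ \ge\ c\,E_{\mathcal I}(\Delta_T)+K_T .$$ For such $\mathcal I$ the two inequalities are equivalent, for every real $c$ and every bounded operator $K$ on $L^2([-\pi,\pi]^2)$. -/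

import Mathlib

open scoped ContDiff InnerProductSpace

noncomputable section

namespace TriangularLattice

/-! ### Abstract commutator theory in a complex Hilbert space -/

section Abstract

variable {E : Type*} [NormedAddCommGroup E] [InnerProductSpace ℂ E] [CompleteSpace E]

/-- `U` is the strongly continuous one-parameter unitary group `U t = exp (i t A)` whose generator
is exactly `A`: a pair `(f, g)` lies in the graph of `A` if and only if `t ↦ U t f` is
differentiable at `0` with derivative `i g`. By Stone's theorem such a group exists if and only if
`A` is (densely defined and) self-adjoint, and it is then unique. -/
structure IsUnitaryGroupGeneratedBy (A : E →ₗ.[ℂ] E) (U : ℝ → E ≃ₗᵢ[ℂ] E) : Prop where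
  map_add : ∀ (s t : ℝ) (f : E), U (s + t) f = U s (U t f)
  continuous_apply : ∀ f : E, Continuous fun t : ℝ => U t f
  mem_graph_iff : ∀ f g : E,
    (f, g) ∈ A.graph ↔ HasDerivAt (fun t : ℝ => U t f) (Complex.I • g) 0

/-- `H ∈ 𝒞¹(A)`: the operator `A` generates a unitary group `exp (i t A)` (that is, `A` is
self-adjoint), and for every `f` the map `t ↦ exp (i t A) H exp (-i t A) f` is of class `C¹`. -/
def IsC1 (H : E →L[ℂ] E) (A : E →ₗ.[ℂ] E) : Prop :=
  ∃ U : ℝ → E ≃ₗᵢ[ℂ] E, IsUnitaryGroupGeneratedBy A U ∧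
    ∀ f : E, ContDiff ℝ 1 fun t : ℝ => U t (H (U (-t) f))

/-- The bounded operator `B` extends the form `[H, iA]`, where the form `[H, A]` is defined on
`D(A) × D(A)` by `⟨f, [H, A] g⟩ = ⟨H f, A g⟩ - ⟨A f, H g⟩`, and `[H, iA] = i [H, A]`. -/
def ExtendsCommutator (H : E →L[ℂ] E) (A : E →ₗ.[ℂ] E) (B : E →L[ℂ] E) : Prop :=
  ∀ f g : A.domain,
    ⟪(f : E), B (g : E)⟫_ℂ =
      Complex.I * (⟪H (f : E), A g⟫_ℂ - ⟪A f, H (g : E)⟫_ℂ)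

open Classical in
/-- The operator `[H, iA]_∘`: the bounded operator extending the form `[H, iA]` (unique, as `D(A)`
is dense), with the value `0` if the form has no bounded extension. -/
def commutatorExt (H : E →L[ℂ] E) (A : E →ₗ.[ℂ] E) : E →L[ℂ] E :=
  if h : ∃ B : E →L[ℂ] E, ExtendsCommutator H A B then h.choose else 0

/-- The range of the spectral projection of a bounded self-adjoint operator `H` above an *open* set
`I ⊆ ℝ`: the closed linear span of the ranges of the operators `φ(H)`, for `φ : ℝ → ℝ` continuous
and vanishing outside `I`. (For open `I` the indicator of `I` is the supremum of such `φ` with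
values in `[0, 1]`.) -/
def spectralSubspace (H : E →L[ℂ] E) (I : Set ℝ) : Submodule ℂ E :=
  (⨆ φ : {φ : C(ℝ, ℝ) // ∀ x, x ∉ I → φ x = 0},
    (cfc (φ.1 : ℝ → ℝ) H : E →L[ℂ] E).range).topologicalClosure

instance (H : E →L[ℂ] E) (I : Set ℝ) : CompleteSpace (spectralSubspace H I) :=
  (Submodule.isClosed_topologicalClosure _).completeSpace_coe

/-- The spectral projection `E_I(H)` of a bounded self-adjoint operator `H` above an open set `I`,
as an orthogonal projection. -/
def spectralProjection (H : E →L[ℂ] E) (I : Set ℝ) : E →L[ℂ] E :=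
  (spectralSubspace H I).starProjection

/-- The inequality `E_I(H) [H, iA]_∘ E_I(H) ≥ c E_I(H) + K` between bounded operators. -/
def MourreInequality (H : E →L[ℂ] E) (A : E →ₗ.[ℂ] E) (I : Set ℝ) (c : ℝ) (K : E →L[ℂ] E) :
    Prop :=
  (c : ℂ) • spectralProjection H I + K ≤
    spectralProjection H I ∘L commutatorExt H A ∘L spectralProjection H I

end Abstract

/-! ### Position space

The triangular lattice `{k₁ v₁ + k₂ v₂}`, `v₁ = (1, 0)`, `v₂ = (1/2, √3/2)`, is identified with
`ℤ²` through the coordinates `(k₁, k₂)`. The six neighbours of `n` are `n ± v₁`, `n ± v₂`,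
`n ± (v₁ - v₂)`. -/

/-- The Hilbert space `ℓ²(ℤ²)`. -/
abbrev Ell2 : Type := lp (fun _ : Fin 2 → ℤ => ℂ) 2

/-- The steps `v₁`, `v₂`, `v₃ = v₁ - v₂` of the lattice, in coordinates. -/
def step : Fin 3 → (Fin 2 → ℤ) := ![![1, 0], ![0, 1], ![1, -1]]

theorem memℓp_shift (v : Fin 2 → ℤ) (f : Ell2) :
    Memℓp (fun n : Fin 2 → ℤ => f (n + v)) 2 := by
  have h := (memℓp_gen_iff (p := 2) (by simp)).1 (lp.memℓp f)
  refine (memℓp_gen_iff (p := 2) (by simp)).2 ?_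
  exact (Equiv.addRight v).summable_iff.2 h

/-- The translation `(shift v f)(n) = f(n + v)` on `ℓ²(ℤ²)`. -/
def shift (v : Fin 2 → ℤ) : Ell2 →L[ℂ] Ell2 :=
  LinearMap.mkContinuous
    { toFun := fun f => ⟨fun n => f (n + v), memℓp_shift v f⟩
      map_add' := fun _ _ => rfl
      map_smul' := fun _ _ => rfl } 1 (by
    intro f
    rw [one_mul, lp.norm_eq_tsum_rpow (by simp), lp.norm_eq_tsum_rpow (by simp)]
    refine Real.rpow_le_rpow (tsum_nonneg fun n => by positivity) (le_of_eq ?_) (by simp)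
    exact (Equiv.addRight v).tsum_eq (fun n => ‖f n‖ ^ (2 : ENNReal).toReal))

/-- The Laplacian of the triangular lattice,
`Δ_T f(n) = (1/6) ∑ᵢ (f(n + vᵢ) + f(n - vᵢ))`. -/
def laplacian : Ell2 →L[ℂ] Ell2 :=
  (1 / 6 : ℂ) • ∑ i : Fin 3, (shift (step i) + shift (-step i))

/-- The discrete Schwartz space `𝒮` of rapidly decreasing functions on `ℤ²`. -/
def rapidlyDecreasing : Submodule ℂ ((Fin 2 → ℤ) → ℂ) where
  carrier := {f | ∀ N : ℕ, ∃ C : ℝ, ∀ n : Fin 2 → ℤ,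
    (1 + (n 0 : ℝ) ^ 2 + (n 1 : ℝ) ^ 2) ^ N * ‖f n‖ ≤ C}
  zero_mem' := fun N => ⟨0, fun n => by simp⟩
  add_mem' := by
    intro f g hf hg N
    obtain ⟨C, hC⟩ := hf N
    obtain ⟨D, hD⟩ := hg N
    refine ⟨C + D, fun n => le_trans ?_ (add_le_add (hC n) (hD n))⟩
    rw [← mul_add]
    exact mul_le_mul_of_nonneg_left (norm_add_le _ _) (by positivity)
  smul_mem' := by
    intro c f hf N
    obtain ⟨C, hC⟩ := hf N
    refine ⟨‖c‖ * C, fun n => ?_⟩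
    have := mul_le_mul_of_nonneg_left (hC n) (norm_nonneg c)
    simp only [Pi.smul_apply, norm_smul]
    linarith

/-- Translation `f ↦ f(· + v)` of arbitrary functions on `ℤ²`. -/
def translate (v : Fin 2 → ℤ) : ((Fin 2 → ℤ) → ℂ) →ₗ[ℂ] ((Fin 2 → ℤ) → ℂ) where
  toFun f n := f (n + v)
  map_add' _ _ := rfl
  map_smul' _ _ := rfl

/-- The position operator `Q_j f(n) = n_j f(n)`. -/
def position (j : Fin 2) : ((Fin 2 → ℤ) → ℂ) →ₗ[ℂ] ((Fin 2 → ℤ) → ℂ) where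
  toFun f n := (n j : ℂ) * f n
  map_add' f g := by ext n; simp [mul_add]
  map_smul' c f := by ext n; simp; ring

/-- The antisymmetric difference operators
`P₁ = (U₁* - U₁)/2 + (U₁* U₂ - U₁ U₂*)/2` and `P₂ = (U₂* - U₂)/2 + (U₁ U₂* - U₁* U₂)/2`, where
`U_j* f(n) = f(n + e_j)` and `U_j f(n) = f(n - e_j)`. -/
def difference : Fin 2 → (((Fin 2 → ℤ) → ℂ) →ₗ[ℂ] ((Fin 2 → ℤ) → ℂ)) :=
  ![(1 / 2 : ℂ) • (translate ![1, 0] - translate ![-1, 0]) +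
      (1 / 2 : ℂ) • (translate ![1, -1] - translate ![-1, 1]),
    (1 / 2 : ℂ) • (translate ![0, 1] - translate ![0, -1]) +
      (1 / 2 : ℂ) • (translate ![-1, 1] - translate ![1, -1])]

/-- The expression `(i/6) ∑_j P_j Q_j + adj`. Since `P_j` is antisymmetric and `Q_j` symmetric, the
formal adjoint of `(i/6) P_j Q_j` is `(i/6) Q_j P_j`. -/
def conjugateExpr : ((Fin 2 → ℤ) → ℂ) →ₗ[ℂ] ((Fin 2 → ℤ) → ℂ) :=
  (Complex.I / 6) • ∑ j : Fin 2,
    (difference j ∘ₗ position j + position j ∘ₗ difference j)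

theorem translate_mem (v : Fin 2 → ℤ) {f : (Fin 2 → ℤ) → ℂ} (hf : f ∈ rapidlyDecreasing) :
    translate v f ∈ rapidlyDecreasing := by
  intro N
  obtain ⟨C, hC⟩ := hf N
  set M : ℝ := 2 * (1 + (v 0 : ℝ) ^ 2 + (v 1 : ℝ) ^ 2) with hM
  have hM0 : 0 ≤ M := by positivity
  refine ⟨M ^ N * C, fun n => ?_⟩
  have h1 : 1 + (n 0 : ℝ) ^ 2 + (n 1 : ℝ) ^ 2 ≤
      M * (1 + ((n + v) 0 : ℝ) ^ 2 + ((n + v) 1 : ℝ) ^ 2) := by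
    simp only [Pi.add_apply, Int.cast_add, hM]
    have e1 := sq_nonneg ((n 0 : ℝ) + 2 * v 0)
    have e2 := sq_nonneg ((n 1 : ℝ) + 2 * v 1)
    have e3 : 0 ≤ ((v 0 : ℝ) ^ 2 + (v 1 : ℝ) ^ 2) *
      (((n 0 : ℝ) + v 0) ^ 2 + ((n 1 : ℝ) + v 1) ^ 2) := by positivity
    nlinarith
  calc _ ≤ (M * (1 + ((n + v) 0 : ℝ) ^ 2 + ((n + v) 1 : ℝ) ^ 2)) ^ N * ‖f (n + v)‖ :=
        mul_le_mul_of_nonneg_right (pow_le_pow_left₀ (by positivity) h1 N) (norm_nonneg _)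
    _ = M ^ N * ((1 + ((n + v) 0 : ℝ) ^ 2 + ((n + v) 1 : ℝ) ^ 2) ^ N * ‖f (n + v)‖) := by
        rw [mul_pow]; ring
    _ ≤ M ^ N * C := mul_le_mul_of_nonneg_left (hC (n + v)) (by positivity)

theorem position_mem (j : Fin 2) {f : (Fin 2 → ℤ) → ℂ} (hf : f ∈ rapidlyDecreasing) :
    position j f ∈ rapidlyDecreasing := by
  intro N
  obtain ⟨C, hC⟩ := hf (N + 1)
  refine ⟨C, fun n => le_trans ?_ (hC n)⟩
  have h : ‖(n j : ℂ)‖ ≤ 1 + (n 0 : ℝ) ^ 2 + (n 1 : ℝ) ^ 2 := by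
    rw [Complex.norm_intCast]
    have : ∀ a : ℝ, |a| ≤ 1 + a ^ 2 := fun a => by
      rw [abs_le]; constructor <;> nlinarith [sq_nonneg (a - 1), sq_nonneg (a + 1)]
    fin_cases j
    · have := this (n 0); simp only [Fin.zero_eta]; nlinarith [sq_nonneg (n 1 : ℝ)]
    · have := this (n 1); simp only [Fin.mk_one]; nlinarith [sq_nonneg (n 0 : ℝ)]
  simp only [position, LinearMap.coe_mk, AddHom.coe_mk, norm_mul]
  calc _ ≤ (1 + (n 0 : ℝ) ^ 2 + (n 1 : ℝ) ^ 2) ^ N *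
        ((1 + (n 0 : ℝ) ^ 2 + (n 1 : ℝ) ^ 2) * ‖f n‖) := by gcongr
    _ = _ := by ring

theorem difference_mem (j : Fin 2) {f : (Fin 2 → ℤ) → ℂ} (hf : f ∈ rapidlyDecreasing) :
    difference j f ∈ rapidlyDecreasing := by
  fin_cases j <;>
  · simp only [difference, Fin.zero_eta, Fin.mk_one, Matrix.cons_val_zero, Matrix.cons_val_one,
      LinearMap.add_apply, LinearMap.smul_apply, LinearMap.sub_apply]
    exact Submodule.add_mem _
      (Submodule.smul_mem _ _ (Submodule.sub_mem _ (translate_mem _ hf) (translate_mem _ hf)))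
      (Submodule.smul_mem _ _ (Submodule.sub_mem _ (translate_mem _ hf) (translate_mem _ hf)))

theorem conjugateExpr_mem {f : (Fin 2 → ℤ) → ℂ} (hf : f ∈ rapidlyDecreasing) :
    conjugateExpr f ∈ rapidlyDecreasing := by
  simp only [conjugateExpr, LinearMap.smul_apply, LinearMap.sum_apply, LinearMap.add_apply,
    LinearMap.comp_apply]
  exact Submodule.smul_mem _ _ (Submodule.sum_mem _ fun j _ => Submodule.add_mem _
    (difference_mem j (position_mem j hf)) (position_mem j (difference_mem j hf)))

theorem summable_int_inv_one_add_sq : Summable fun k : ℤ => 1 / (1 + (k : ℝ) ^ 2) := by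
  refine (Real.summable_one_div_int_pow.2 one_lt_two).of_norm_bounded_eventually ?_
  filter_upwards [(Set.finite_singleton (0 : ℤ)).compl_mem_cofinite] with k hk
  have hk : (k : ℝ) ≠ 0 := by simpa using hk
  rw [Real.norm_of_nonneg (by positivity)]
  exact one_div_le_one_div_of_le (by positivity) (by linarith)

theorem memℓp_of_rapidlyDecreasing {f : (Fin 2 → ℤ) → ℂ} (hf : f ∈ rapidlyDecreasing) :
    Memℓp f 2 := by
  obtain ⟨C, hC⟩ := hf 1
  refine memℓp_gen ?_
  have hs : Summable fun n : Fin 2 → ℤ =>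
      C ^ 2 * ((1 / (1 + (n 0 : ℝ) ^ 2)) * (1 / (1 + (n 1 : ℝ) ^ 2))) := by
    refine Summable.mul_left _ ?_
    have := summable_int_inv_one_add_sq.mul_of_nonneg summable_int_inv_one_add_sq
      (fun k => by positivity) (fun k => by positivity)
    exact (finTwoArrowEquiv ℤ).summable_iff.2 this
  refine hs.of_nonneg_of_le (fun n => by positivity) fun n => ?_
  have h := hC n
  rw [pow_one] at h
  have h2 : ((1 + (n 0 : ℝ) ^ 2 + (n 1 : ℝ) ^ 2) * ‖f n‖) ^ 2 ≤ C ^ 2 :=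
    pow_le_pow_left₀ (by positivity) h 2
  have h3 : (1 + (n 0 : ℝ) ^ 2) * (1 + (n 1 : ℝ) ^ 2) ≤
      (1 + (n 0 : ℝ) ^ 2 + (n 1 : ℝ) ^ 2) ^ 2 := by
    nlinarith [sq_nonneg (n 0 : ℝ), sq_nonneg (n 1 : ℝ),
      mul_nonneg (sq_nonneg (n 0 : ℝ)) (sq_nonneg (n 1 : ℝ))]
  rw [one_div_mul_one_div, mul_one_div, le_div_iff₀ (by positivity)]
  simp only [ENNReal.toReal_ofNat, Real.rpow_ofNat]
  calc _ ≤ ‖f n‖ ^ 2 * (1 + (n 0 : ℝ) ^ 2 + (n 1 : ℝ) ^ 2) ^ 2 := by gcongr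
    _ ≤ C ^ 2 := by rw [← mul_pow, mul_comm]; exact h2

/-- The operator `A` on the domain `𝒮 ⊆ ℓ²(ℤ²)`. -/
def conjugateOpCore : Ell2 →ₗ.[ℂ] Ell2 where
  domain :=
    { carrier := {f | (f : (Fin 2 → ℤ) → ℂ) ∈ rapidlyDecreasing}
      zero_mem' := Submodule.zero_mem rapidlyDecreasing
      add_mem' := fun hf hg => Submodule.add_mem rapidlyDecreasing hf hg
      smul_mem' := fun c _ hf => Submodule.smul_mem rapidlyDecreasing c hf }
  toFun :=
    { toFun := fun f => ⟨conjugateExpr (f.1 : (Fin 2 → ℤ) → ℂ),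
        memℓp_of_rapidlyDecreasing (conjugateExpr_mem f.2)⟩
      map_add' := fun f g => Subtype.ext (map_add conjugateExpr f.1.1 g.1.1)
      map_smul' := fun c f => Subtype.ext (map_smul conjugateExpr c f.1.1) }

/-- The conjugate operator `A`: the closure of its restriction to `𝒮`. -/
def conjugateOp : Ell2 →ₗ.[ℂ] Ell2 := conjugateOpCore.closure

/-! ### Momentum space -/

/-- Lebesgue measure on the square `[-π, π]²`. -/
abbrev boxMeasure : MeasureTheory.Measure (Fin 2 → ℝ) :=
  MeasureTheory.volume.restrict (Set.Icc (fun _ => -Real.pi) (fun _ => Real.pi))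

instance : MeasureTheory.IsFiniteMeasure boxMeasure :=
  MeasureTheory.isFiniteMeasure_restrict.2 isCompact_Icc.measure_lt_top.ne

/-- The Hilbert space `L²([-π, π]²)`. -/
abbrev L2Box : Type := MeasureTheory.Lp ℂ 2 boxMeasure

theorem memLp_of_continuous {φ : (Fin 2 → ℝ) → ℂ} (hφ : Continuous φ) :
    MeasureTheory.MemLp φ 2 boxMeasure :=
  MeasureTheory.MemLp.mono_exponent (q := ⊤) (by
    obtain ⟨C, hC⟩ := (isCompact_Icc.bddAbove_image hφ.norm.continuousOn)
    refine MeasureTheory.memLp_top_of_bound hφ.aestronglyMeasurable C ?_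
    filter_upwards [MeasureTheory.ae_restrict_mem measurableSet_Icc] with x hx
    exact hC (Set.mem_image_of_mem _ hx)) le_top

/-- The character `x ↦ (2π)⁻¹ exp (-i ⟨n, x⟩)`. -/
def character (n : Fin 2 → ℤ) (x : Fin 2 → ℝ) : ℂ :=
  (1 / (2 * Real.pi) : ℂ) * Complex.exp (-Complex.I * ∑ j : Fin 2, (n j : ℂ) * (x j : ℂ))

theorem continuous_character (n : Fin 2 → ℤ) : Continuous (character n) := by
  unfold character; fun_prop

/-- The character as an element of `L²([-π, π]²)`. -/
def characterLp (n : Fin 2 → ℤ) : L2Box := (memLp_of_continuous (continuous_character n)).toLp _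

theorem characterLp_coeFn (n : Fin 2 → ℤ) : characterLp n =ᵐ[boxMeasure] character n :=
  MeasureTheory.MemLp.coeFn_toLp _

theorem boxMeasure_eq_pi : boxMeasure = MeasureTheory.Measure.pi fun _ : Fin 2 =>
    (MeasureTheory.volume.restrict (Set.Icc (-Real.pi) Real.pi) :
      MeasureTheory.Measure ℝ) := by
  rw [← MeasureTheory.Measure.restrict_pi_pi, Set.pi_univ_Icc]
  rfl

theorem integral_character (k : ℤ) :
    ∫ x in Set.Icc (-Real.pi) Real.pi, Complex.exp (Complex.I * k * (x : ℂ)) =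
      if k = 0 then (2 * Real.pi : ℂ) else 0 := by
  rw [MeasureTheory.integral_Icc_eq_integral_Ioc,
    ← intervalIntegral.integral_of_le (by linarith [Real.pi_pos])]
  split_ifs with hk
  · simp [hk]; ring
  · rw [integral_exp_mul_complex (by simp [hk])]
    have : Complex.exp (Complex.I * k * (Real.pi : ℂ)) =
        Complex.exp (Complex.I * k * ((-Real.pi : ℝ) : ℂ)) := by
      rw [Complex.exp_eq_exp_iff_exists_int]
      exact ⟨k, by push_cast; ring⟩
    rw [this, sub_self, zero_div]

theorem orthonormal_characterLp : Orthonormal ℂ characterLp := by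
  rw [orthonormal_iff_ite]
  intro m n
  rw [MeasureTheory.L2.inner_def]
  have h1 : ∫ x, ⟪(characterLp m : (Fin 2 → ℝ) → ℂ) x, characterLp n x⟫_ℂ ∂boxMeasure =
      ∫ x, (1 / (2 * Real.pi : ℂ)) ^ 2 *
        ∏ j : Fin 2, Complex.exp (Complex.I * ((m j - n j : ℤ) : ℂ) * (x j : ℂ)) ∂boxMeasure := by
    refine MeasureTheory.integral_congr_ae ?_
    filter_upwards [characterLp_coeFn m, characterLp_coeFn n] with x hm hn
    rw [hm, hn]
    simp only [character, RCLike.inner_apply, map_mul, ← Complex.exp_conj, map_add, map_neg,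
      Complex.conj_I, Complex.conj_ofReal, map_div₀, map_one, map_ofNat, map_intCast,
      Fin.sum_univ_two, Fin.prod_univ_two]
    rw [mul_mul_mul_comm, ← Complex.exp_add, ← Complex.exp_add, sq]
    congr 2
    push_cast
    ring
  rw [h1, MeasureTheory.integral_const_mul, boxMeasure_eq_pi,
    MeasureTheory.integral_fintype_prod_eq_prod
      (f := fun (j : Fin 2) (x : ℝ) => Complex.exp (Complex.I * ((m j - n j : ℤ) : ℂ) * (x : ℂ)))]
  simp only [integral_character, Fin.prod_univ_two]
  have hpi : (Real.pi : ℂ) ≠ 0 := by exact_mod_cast Real.pi_ne_zero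
  by_cases h : m = n
  · subst h; simp; field_simp
  · rw [if_neg h]
    have : m 0 - n 0 ≠ 0 ∨ m 1 - n 1 ≠ 0 := by
      by_contra hc
      push Not at hc
      apply h; ext j; fin_cases j
      · simpa [sub_eq_zero] using hc.1
      · simpa [sub_eq_zero] using hc.2
    rcases this with h0 | h0 <;> simp [h0]

/-- The covering map of the torus `(ℝ/ℤ)²` by the plane, `x ↦ -x / 2π`. -/
def toTorus (x : Fin 2 → ℝ) : UnitAddTorus (Fin 2) := fun i => ((-(x i) / (2 * Real.pi) : ℝ) :)

theorem continuous_toTorus : Continuous toTorus :=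
  continuous_pi fun i => (AddCircle.continuous_mk' 1).comp (by fun_prop)

theorem mFourier_toTorus (n : Fin 2 → ℤ) (x : Fin 2 → ℝ) :
    (1 / (2 * Real.pi) : ℂ) * UnitAddTorus.mFourier n (toTorus x) = character n x := by
  have hpi : (Real.pi : ℂ) ≠ 0 := by exact_mod_cast Real.pi_ne_zero
  simp only [UnitAddTorus.mFourier, ContinuousMap.coe_mk, toTorus, character, Fin.prod_univ_two,
    Fin.sum_univ_two, fourier_coe_apply]
  rw [← Complex.exp_add]
  congr 2
  push_cast
  field_simp
  ring

/-- A measurable section of `toTorus`. -/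
def ofTorus (t : UnitAddTorus (Fin 2)) (i : Fin 2) : ℝ :=
  -(2 * Real.pi) * (AddCircle.measurableEquivIoc 1 (-1 / 2) (t i) : ℝ)

theorem measurable_ofTorus : Measurable ofTorus :=
  measurable_pi_lambda _ fun i => Measurable.const_mul (measurable_subtype_coe.comp
    ((AddCircle.measurableEquivIoc 1 (-1 / 2)).measurable.comp (measurable_pi_apply i))) _

theorem ofTorus_toTorus : ∀ᵐ x ∂boxMeasure, ofTorus (toTorus x) = x := by
  have hae : ∀ᵐ x : Fin 2 → ℝ, ∀ i, x i ≠ Real.pi := by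
    rw [MeasureTheory.ae_all_iff]
    intro i
    have : MeasureTheory.volume ((fun x : Fin 2 → ℝ => x i) ⁻¹' {Real.pi}) = 0 :=
      (MeasureTheory.Measure.quasiMeasurePreserving_eval
        (fun _ : Fin 2 => (MeasureTheory.volume : MeasureTheory.Measure ℝ)) i).preimage_null
        (by simp)
    exact MeasureTheory.measure_eq_zero_iff_ae_notMem.1 this
  filter_upwards [MeasureTheory.ae_restrict_mem measurableSet_Icc,
    MeasureTheory.ae_restrict_of_ae hae] with x hx hx'
  have hpi := Real.pi_pos
  ext i
  have h1 : -Real.pi ≤ x i := hx.1 i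
  have h2 : x i < Real.pi := lt_of_le_of_ne (hx.2 i) (hx' i)
  have hmem : -(x i) / (2 * Real.pi) ∈ Set.Ioc (-1 / 2 : ℝ) (-1 / 2 + 1) := by
    constructor
    · rw [lt_div_iff₀ (by positivity)]; linarith
    · rw [div_le_iff₀ (by positivity)]; linarith
  have : (AddCircle.measurableEquivIoc 1 (-1 / 2) (toTorus x i) : ℝ) =
      -(x i) / (2 * Real.pi) := congrArg Subtype.val (AddCircle.equivIoc_coe_eq (p := (1 : ℝ)) hmem)
  rw [ofTorus, this]
  field_simp

theorem span_characterLp : ⊤ ≤ (Submodule.span ℂ (Set.range characterLp)).topologicalClosure := by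
  set ν : MeasureTheory.Measure (UnitAddTorus (Fin 2)) := boxMeasure.map toTorus with hν
  have hmp : MeasureTheory.MeasurePreserving toTorus boxMeasure ν :=
    ⟨continuous_toTorus.measurable, rfl⟩
  have : MeasureTheory.IsFiniteMeasure ν := MeasureTheory.Measure.isFiniteMeasure_map _ _
  set T : MeasureTheory.Lp ℂ 2 ν →ₗᵢ[ℂ] L2Box :=
    MeasureTheory.Lp.compMeasurePreservingₗᵢ ℂ toTorus hmp with hT
  have hsurj : Function.Surjective T := by
    intro f
    have hcomp : (fun t => f (ofTorus t)) ∘ toTorus =ᵐ[boxMeasure] f := by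
      filter_upwards [ofTorus_toTorus] with x hx
      simp [hx]
    have hmeas : MeasureTheory.AEStronglyMeasurable (fun t => f (ofTorus t)) ν :=
      ((MeasureTheory.Lp.stronglyMeasurable f).comp_measurable
        measurable_ofTorus).aestronglyMeasurable
    have hL : MeasureTheory.MemLp (fun t => f (ofTorus t)) 2 ν :=
      (MeasureTheory.memLp_map_measure_iff hmeas continuous_toTorus.aemeasurable).2
        ((MeasureTheory.memLp_congr_ae hcomp).2 (MeasureTheory.Lp.memLp f))
    refine ⟨hL.toLp _, MeasureTheory.Lp.ext ?_⟩
    refine (MeasureTheory.Lp.coeFn_compMeasurePreserving _ hmp).trans ?_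
    exact (hmp.quasiMeasurePreserving.ae_eq_comp hL.coeFn_toLp).trans hcomp
  set L : C(UnitAddTorus (Fin 2), ℂ) →L[ℂ] L2Box :=
    T.toContinuousLinearMap ∘L ContinuousMap.toLp 2 ν ℂ with hL
  have hdense : DenseRange L :=
    hsurj.denseRange.comp (ContinuousMap.toLp_denseRange ℂ ν ℂ (by simp)) T.continuous
  have hLn : ∀ n, (1 / (2 * Real.pi) : ℂ) • L (UnitAddTorus.mFourier n) = characterLp n := by
    intro n
    refine MeasureTheory.Lp.ext ?_
    refine (MeasureTheory.Lp.coeFn_smul _ _).trans ?_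
    have h1 : (L (UnitAddTorus.mFourier n) : (Fin 2 → ℝ) → ℂ) =ᵐ[boxMeasure]
        fun x => UnitAddTorus.mFourier n (toTorus x) :=
      (MeasureTheory.Lp.coeFn_compMeasurePreserving _ hmp).trans
        (hmp.quasiMeasurePreserving.ae_eq_comp (ContinuousMap.coeFn_toLp ν _))
    filter_upwards [h1, characterLp_coeFn n] with x hx hx'
    rw [hx', Pi.smul_apply, hx, smul_eq_mul, mFourier_toTorus]
  have hspan := hdense.topologicalClosure_map_submodule
    (UnitAddTorus.span_mFourier_closure_eq_top (d := Fin 2))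
  rw [← hspan]
  refine Submodule.topologicalClosure_mono ?_
  rw [Submodule.map_span, Submodule.span_le]
  rintro _ ⟨_, ⟨n, rfl⟩, rfl⟩
  have hpi : (1 / (2 * Real.pi) : ℂ) ≠ 0 := by
    have : (Real.pi : ℂ) ≠ 0 := by exact_mod_cast Real.pi_ne_zero
    simp [this]
  rw [SetLike.mem_coe, ← Submodule.smul_mem_iff _ hpi]
  exact Submodule.subset_span ⟨n, (hLn n).symm⟩

/-- The Hilbert basis of characters of `L²([-π, π]²)`. -/
def characterBasis : HilbertBasis (Fin 2 → ℤ) ℂ L2Box :=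
  HilbertBasis.mk orthonormal_characterLp span_characterLp

/-- The Fourier transform `𝓕 f(x) = (2π)⁻¹ ∑ₙ f(n) exp (-i ⟨n, x⟩)`, a unitary operator from
`ℓ²(ℤ²)` onto `L²([-π, π]²)`. -/
def fourierTransform : Ell2 ≃ₗᵢ[ℂ] L2Box := characterBasis.repr.symm

theorem hasSum_fourierTransform (f : Ell2) :
    HasSum (fun n => f n • characterLp n) (fourierTransform f) := by
  have h := characterBasis.hasSum_repr_symm f
  simpa only [characterBasis, HilbertBasis.coe_mk] using! h

/-- The transported Laplacian `Δ_𝓕 = 𝓕 Δ_T 𝓕⁻¹`. -/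
def laplacianFourier : L2Box →L[ℂ] L2Box :=
  (fourierTransform : Ell2 →L[ℂ] L2Box) ∘L laplacian ∘L (fourierTransform.symm : L2Box →L[ℂ] Ell2)

/-- The function `F(x) = (cos x₁ + cos x₂ + cos (x₁ - x₂)) / 3`. -/
def symbol (x : Fin 2 → ℝ) : ℝ :=
  (1 / 3) * (Real.cos (x 0) + Real.cos (x 1) + Real.cos (x 0 - x 1))

/-- The partial derivative `∂_j φ`. -/
def partialDeriv {V : Type*} [NormedAddCommGroup V] [NormedSpace ℝ V] (j : Fin 2)
    (φ : (Fin 2 → ℝ) → V) (x : Fin 2 → ℝ) : V :=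
  fderiv ℝ φ x (Pi.single j 1)

/-- The components `∂_j F` of the gradient of `F`. -/
def gradSymbol (j : Fin 2) : (Fin 2 → ℝ) → ℝ := partialDeriv j symbol

/-- The function `‖∇F‖²`. -/
def gradSymbolSq (x : Fin 2 → ℝ) : ℝ := ∑ j : Fin 2, gradSymbol j x ^ 2

/-- Smooth functions on the plane that are `2π`-periodic in each variable. -/
def smoothPeriodic : Submodule ℂ ((Fin 2 → ℝ) → ℂ) where
  carrier := {φ | ContDiff ℝ ∞ φ ∧
    ∀ (j : Fin 2) (x : Fin 2 → ℝ), φ (x + Pi.single j (2 * Real.pi)) = φ x}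
  zero_mem' := ⟨contDiff_const, fun _ _ => rfl⟩
  add_mem' := fun hf hg => ⟨hf.1.add hg.1, fun j x => by simp [hf.2 j x, hg.2 j x]⟩
  smul_mem' := fun c _ hf => ⟨contDiff_const.smul hf.1, fun j x => by simp [hf.2 j x]⟩

/-- The expression `(i/2) (∇F · ∇ + ∇ · ∇F) φ = (i/2) ∑_j (∂_jF ∂_jφ + ∂_j(∂_jF φ))`. -/
def conjugateFourierExpr (φ : (Fin 2 → ℝ) → ℂ) (x : Fin 2 → ℝ) : ℂ :=
  (Complex.I / 2) * ∑ j : Fin 2,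
    ((gradSymbol j x : ℂ) * partialDeriv j φ x +
      partialDeriv j (fun y => (gradSymbol j y : ℂ) * φ y) x)

theorem contDiff_symbol : ContDiff ℝ ∞ symbol := by
  unfold symbol
  refine contDiff_const.mul (((Real.contDiff_cos.comp (contDiff_apply ℝ ℝ 0)).add
    (Real.contDiff_cos.comp (contDiff_apply ℝ ℝ 1))).add
    (Real.contDiff_cos.comp ((contDiff_apply ℝ ℝ 0).sub (contDiff_apply ℝ ℝ 1))))

theorem contDiff_partialDeriv {V : Type*} [NormedAddCommGroup V] [NormedSpace ℝ V] (j : Fin 2)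
    {φ : (Fin 2 → ℝ) → V} (hφ : ContDiff ℝ ∞ φ) : ContDiff ℝ ∞ (partialDeriv j φ) :=
  (hφ.fderiv_right (m := ∞) (by simp)).clm_apply contDiff_const

theorem contDiff_gradSymbol (j : Fin 2) :
    ContDiff ℝ ∞ fun y => (gradSymbol j y : ℂ) :=
  Complex.ofRealCLM.contDiff.comp (contDiff_partialDeriv j contDiff_symbol)

theorem contDiff_conjugateFourierExpr {φ : (Fin 2 → ℝ) → ℂ} (hφ : ContDiff ℝ ∞ φ) :
    ContDiff ℝ ∞ (conjugateFourierExpr φ) :=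
  contDiff_const.mul (ContDiff.sum fun j _ =>
    ((contDiff_gradSymbol j).mul (contDiff_partialDeriv j hφ)).add
      (contDiff_partialDeriv j ((contDiff_gradSymbol j).mul hφ)))

theorem partialDeriv_add (j : Fin 2) {φ ψ : (Fin 2 → ℝ) → ℂ} (hφ : ContDiff ℝ ∞ φ)
    (hψ : ContDiff ℝ ∞ ψ) (x : Fin 2 → ℝ) :
    partialDeriv j (φ + ψ) x = partialDeriv j φ x + partialDeriv j ψ x := by
  unfold partialDeriv
  rw [fderiv_add (hφ.differentiable (by simp) x) (hψ.differentiable (by simp) x)]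
  rfl

theorem partialDeriv_smul (j : Fin 2) (c : ℂ) {φ : (Fin 2 → ℝ) → ℂ} (hφ : ContDiff ℝ ∞ φ)
    (x : Fin 2 → ℝ) : partialDeriv j (c • φ) x = c * partialDeriv j φ x := by
  unfold partialDeriv
  rw [fderiv_const_smul (hφ.differentiable (by simp) x)]
  rfl

theorem conjugateFourierExpr_add {φ ψ : (Fin 2 → ℝ) → ℂ} (hφ : ContDiff ℝ ∞ φ)
    (hψ : ContDiff ℝ ∞ ψ) :
    conjugateFourierExpr (φ + ψ) = conjugateFourierExpr φ + conjugateFourierExpr ψ := by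
  ext x
  have h : ∀ j : Fin 2, (fun y => (gradSymbol j y : ℂ) * (φ + ψ) y) =
      (fun y => (gradSymbol j y : ℂ) * φ y) +
        fun y => (gradSymbol j y : ℂ) * ψ y := fun j => by
    ext y; simp [mul_add]
  simp only [conjugateFourierExpr, Pi.add_apply, Fin.sum_univ_two, partialDeriv_add _ hφ hψ]
  simp only [← Pi.add_apply φ ψ, h, partialDeriv_add _ ((contDiff_gradSymbol _).mul hφ)
    ((contDiff_gradSymbol _).mul hψ)]
  ring

theorem conjugateFourierExpr_smul (c : ℂ) {φ : (Fin 2 → ℝ) → ℂ} (hφ : ContDiff ℝ ∞ φ) :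
    conjugateFourierExpr (c • φ) = c • conjugateFourierExpr φ := by
  ext x
  have h : ∀ j : Fin 2, (fun y => (gradSymbol j y : ℂ) * (c • φ) y) =
      c • (fun y => (gradSymbol j y : ℂ) * φ y) := fun j => by
    ext y; simp; ring
  simp only [conjugateFourierExpr, Pi.smul_apply, Fin.sum_univ_two, partialDeriv_smul _ _ hφ]
  simp only [← Pi.smul_apply c φ, h, partialDeriv_smul _ _ ((contDiff_gradSymbol _).mul hφ)]
  simp only [smul_eq_mul]
  ring

/-- The class in `L²([-π, π]²)` of a smooth periodic function. -/
def smoothPeriodicToLp : smoothPeriodic →ₗ[ℂ] L2Box where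
  toFun φ := (memLp_of_continuous φ.2.1.continuous).toLp _
  map_add' _ _ := rfl
  map_smul' _ _ := rfl

theorem periodic_zsmul {φ : (Fin 2 → ℝ) → ℂ} (hφ : φ ∈ smoothPeriodic) (j : Fin 2) (k : ℤ)
    (x : Fin 2 → ℝ) : φ (x + Pi.single j (k * (2 * Real.pi))) = φ x := by
  have h : Function.Periodic φ (Pi.single j (2 * Real.pi)) := hφ.2 j
  have := h.zsmul k x
  rwa [← Pi.single_zsmul, zsmul_eq_mul] at this

theorem smoothPeriodicToLp_injective : Function.Injective smoothPeriodicToLp := by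
  rw [← LinearMap.ker_eq_bot, LinearMap.ker_eq_bot']
  rintro ⟨φ, hφ⟩ h
  have hcont : Continuous φ := hφ.1.continuous
  have h0 : φ =ᵐ[boxMeasure] 0 :=
    ((memLp_of_continuous hcont).coeFn_toLp).symm.trans
      ((MeasureTheory.Lp.ext_iff.1 h).trans (MeasureTheory.Lp.coeFn_zero _ _ _))
  have hpi := Real.pi_pos
  have hint : closure (interior (Set.Icc (fun _ : Fin 2 => -Real.pi) (fun _ => Real.pi))) =
      Set.Icc (fun _ : Fin 2 => -Real.pi) (fun _ => Real.pi) := by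
    rw [← Set.pi_univ_Icc, interior_pi_set Set.finite_univ]
    simp only [interior_Icc, closure_pi_set]
    congr 1; ext j : 1
    exact closure_Ioo (by linarith)
  have hbox : Set.EqOn φ 0 (Set.Icc (fun _ : Fin 2 => -Real.pi) (fun _ => Real.pi)) :=
    MeasureTheory.Measure.eqOn_of_ae_eq h0 hcont.continuousOn continuousOn_const
      (by rw [hint])
  refine Subtype.ext (funext fun x => ?_)
  obtain ⟨k, hk⟩ : ∃ k : Fin 2 → ℤ, ∀ j, x j + k j * (2 * Real.pi) ∈
      Set.Icc (-Real.pi) Real.pi := by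
    refine ⟨fun j => -toIocDiv (by positivity : 0 < 2 * Real.pi) (-Real.pi) (x j), fun j => ?_⟩
    have := toIocMod_mem_Ioc (by positivity : 0 < 2 * Real.pi) (-Real.pi) (x j)
    rw [toIocMod, zsmul_eq_mul] at this
    constructor
    · push_cast; linarith [this.1]
    · push_cast; linarith [this.2]
  have h1 := periodic_zsmul hφ 0 (k 0) x
  have h2 := periodic_zsmul hφ 1 (k 1) (x + Pi.single 0 (k 0 * (2 * Real.pi)))
  rw [h1] at h2
  change φ x = 0
  rw [← h2]
  refine hbox ⟨fun j => ?_, fun j => ?_⟩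
  · fin_cases j
    · simpa using (hk 0).1
    · simpa using (hk 1).1
  · fin_cases j
    · simpa using (hk 0).2
    · simpa using (hk 1).2

/-- The differential operator `(i/2) (∇F · ∇ + ∇ · ∇F)` as a map from smooth periodic functions to
`L²([-π, π]²)`. -/
def conjugateFourierLp : smoothPeriodic →ₗ[ℂ] L2Box where
  toFun φ := (memLp_of_continuous (contDiff_conjugateFourierExpr φ.2.1).continuous).toLp _
  map_add' φ ψ := by
    rw [← MeasureTheory.MemLp.toLp_add]
    exact MeasureTheory.MemLp.toLp_congr _ _
      (Filter.EventuallyEq.of_eq (conjugateFourierExpr_add φ.2.1 ψ.2.1))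
  map_smul' c φ := by
    rw [RingHom.id_apply, ← MeasureTheory.MemLp.toLp_const_smul]
    exact MeasureTheory.MemLp.toLp_congr _ _
      (Filter.EventuallyEq.of_eq (conjugateFourierExpr_smul c φ.2.1))

/-- The operator `(i/2) (∇F · ∇ + ∇ · ∇F)` in `L²([-π, π]²)`, with domain the smooth periodic
functions. -/
def conjugateOpFourierCore : L2Box →ₗ.[ℂ] L2Box where
  domain := LinearMap.range smoothPeriodicToLp
  toFun := conjugateFourierLp ∘ₗ
    (LinearEquiv.ofInjective smoothPeriodicToLp smoothPeriodicToLp_injective).symm.toLinearMap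

/-- The conjugate operator `Â` in `L²([-π, π]²)`: the closure of its restriction to smooth periodic
functions. -/
def conjugateOpFourier : L2Box →ₗ.[ℂ] L2Box := conjugateOpFourierCore.closure

/-- The operator `𝓕⁻¹ K 𝓕` on `ℓ²(ℤ²)`. -/
def inverseFourierConj (K : L2Box →L[ℂ] L2Box) : Ell2 →L[ℂ] Ell2 :=
  (fourierTransform.symm : L2Box →L[ℂ] Ell2) ∘L K ∘L (fourierTransform : Ell2 →L[ℂ] L2Box)

end TriangularLattice
end

open TriangularLattice

/-! Two computations govern everything. On the lattice, `A` is the commutator (i/2)[Δ_T, |Q|²] with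
|n|² = n₁² + n₂² (`conjugateExpr_apply`). In momentum space Δ_T is multiplication by F
(`laplacianFourier_eq_symbolOp`) and `Â` is the symmetrized vector field i∇F·∇, so the Leibniz rule
gives [F, iÂ] = ‖∇F‖² (`conjugateFourierExpr_symbol_mul`).

Self-adjointness is obtained in position space by constructing the unitary group. Replace |Q|² by
min(|Q|², N): the operators A_N = (i/2)[Δ_T, min(|Q|², N)] are bounded and self-adjoint. The
commutator of A_N with the weight 1 + min(|Q|², N) is bounded by the weight, uniformly in N, because
the increments of |n|² along a step are O(|n|); hence exp(isA_N) increases weighted norms by at most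
e^{8|s|}. Moreover A_N preserves the functions supported in {|n|² ≤ 2N + 4}, and on them A_M - A_N,
for M ≥ N, is O(N^{-1/2}) relative to the weight. By Duhamel's formula the groups exp(itA_N)
converge strongly, and the finitely supported functions form a core of the limiting generator
(`exists_isUnitaryGroup_of_approx`, `exists_conjugateGroup`).

The generator is also the maximal operator: a pair in ℓ² that satisfies the formal expression
pointwise lies in its graph (`mem_generatorGraph_of_conjugateExpr`). Both the rapidly decreasing
functions and, through the Fourier transform, the smooth periodic functions are thus caught between
the finitely supported core and the maximal operator, so `A` and `Â` are unitarily equivalent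
generators.

The Leibniz identity, valid on smooth periodic functions, extends to the whole domain by closedness.
A bounded commutator then gives 𝒞¹ by integrating the derivative of exp(itA) H exp(-itA).

For the Mourre estimate, the critical values of F are 1, -1/2 and -1/3
(`symbol_of_gradSymbolSq_eq_zero`). By compactness ‖∇F‖² ≥ c > 0 where F lies in the closure of the
interval, and the range of the spectral projection consists of functions supported there. The
estimate therefore holds with K = 0. Its position-space form follows because every ingredient is
natural under unitary conjugation (`mourreInequality_conj`). -/

noncomputable section

namespace TriangularLattice

/-! ### One-parameter unitary groups and their generators -/

section UnitaryGroup

open MeasureTheory Filter Topology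

variable {E : Type*} [NormedAddCommGroup E] [InnerProductSpace ℂ E]

/-- A strongly continuous one-parameter unitary group. -/
structure IsUnitaryGroup (U : ℝ → E ≃ₗᵢ[ℂ] E) : Prop where
  map_add : ∀ (s t : ℝ) (f : E), U (s + t) f = U s (U t f)
  continuous_apply : ∀ f : E, Continuous fun t : ℝ => U t f

/-- The graph of the generator `A` of `U t = exp (i t A)`. -/
def generatorGraph (U : ℝ → E ≃ₗᵢ[ℂ] E) : Submodule ℂ (E × E) where
  carrier := {p | HasDerivAt (fun t : ℝ => U t p.1) (Complex.I • p.2) 0}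
  zero_mem' := by simpa using hasDerivAt_const (0 : ℝ) (0 : E)
  add_mem' := by
    intro p q hp hq
    simpa only [Set.mem_ofPred_eq, Prod.fst_add, Prod.snd_add, map_add, smul_add] using! hp.add hq
  smul_mem' := by
    intro c p hp
    have := HasDerivAt.const_smul c hp
    simpa only [Set.mem_ofPred_eq, Prod.smul_fst, Prod.smul_snd, map_smul, smul_comm c] using! this

theorem mem_generatorGraph {U : ℝ → E ≃ₗᵢ[ℂ] E} {f g : E} :
    (f, g) ∈ generatorGraph U ↔ HasDerivAt (fun t : ℝ => U t f) (Complex.I • g) 0 := Iff.rfl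

namespace IsUnitaryGroup

variable {U : ℝ → E ≃ₗᵢ[ℂ] E}

theorem map_zero (hU : IsUnitaryGroup U) (f : E) : U 0 f = f :=
  (U 0).injective (by rw [← hU.map_add, add_zero])

theorem map_map_neg (hU : IsUnitaryGroup U) (t : ℝ) (f : E) : U t (U (-t) f) = f := by
  rw [← hU.map_add, add_neg_cancel, hU.map_zero]

theorem inner_map_left (hU : IsUnitaryGroup U) (t : ℝ) (f g : E) :
    ⟪U t f, g⟫_ℂ = ⟪f, U (-t) g⟫_ℂ := by
  rw [← (U t).inner_map_map f, hU.map_map_neg]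

/-- The factorization `U s = U t ∘ U (s - t)` carries the derivative at 0 to every time. -/
theorem hasDerivAt (hU : IsUnitaryGroup U) {f g : E} (h : (f, g) ∈ generatorGraph U) (t : ℝ) :
    HasDerivAt (fun s : ℝ => U s f) (U t (Complex.I • g)) t := by
  rw [mem_generatorGraph] at h
  have h1 : HasDerivAt (fun s : ℝ => U (s - t) f) (Complex.I • g) t := by
    exact HasDerivAt.comp_sub_const (f := fun s : ℝ => U s f) t t (by simpa using h)
  have h2 := ((U t : E →L[ℂ] E).restrictScalars ℝ).hasFDerivAt.comp_hasDerivAt t h1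
  refine h2.congr_of_eventuallyEq (Eventually.of_forall fun s => ?_)
  simp [← hU.map_add]

theorem map_mem_generatorGraph (hU : IsUnitaryGroup U) {f g : E}
    (h : (f, g) ∈ generatorGraph U) (s : ℝ) : (U s f, U s g) ∈ generatorGraph U := by
  have := ((U s : E →L[ℂ] E).restrictScalars ℝ).hasFDerivAt.comp_hasDerivAt (0 : ℝ) h
  rw [mem_generatorGraph]
  refine (this.congr_of_eventuallyEq (Eventually.of_forall fun t => ?_)).congr_deriv ?_
  · simp [← hU.map_add, add_comm]
  · simp

theorem intervalIntegrable (hU : IsUnitaryGroup U) (f : E) (a b : ℝ) :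
    IntervalIntegrable (fun s => U s f) volume a b :=
  (hU.continuous_apply f).intervalIntegrable a b

theorem norm_integral_le (U : ℝ → E ≃ₗᵢ[ℂ] E) (f : E) (t : ℝ) :
    ‖∫ s in (0 : ℝ)..t, U s f‖ ≤ |t| * ‖f‖ := by
  have := intervalIntegral.norm_integral_le_of_norm_le_const (a := (0 : ℝ)) (b := t)
    (f := fun s => U s f) (C := ‖f‖) (fun s _ => by simp)
  simpa [mul_comm] using this

/-- The integral `∫₀ᵗ U s ds` as a bounded operator. -/
def integralCLM (hU : IsUnitaryGroup U) (t : ℝ) : E →L[ℂ] E :=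
  LinearMap.mkContinuous
    { toFun := fun f => ∫ s in (0 : ℝ)..t, U s f
      map_add' := fun f g => by
        simp only [_root_.map_add]
        exact intervalIntegral.integral_add (hU.intervalIntegrable f _ _)
          (hU.intervalIntegrable g _ _)
      map_smul' := fun c f => by simp } |t| (norm_integral_le U · t)

theorem integralCLM_apply (hU : IsUnitaryGroup U) (t : ℝ) (f : E) :
    hU.integralCLM t f = ∫ s in (0 : ℝ)..t, U s f := rfl

/-- Symmetry of the generator: the function t ↦ ⟨U t f, U t f'⟩ is constant, and its derivative at 0
vanishes. -/
theorem inner_eq_inner (hU : IsUnitaryGroup U) {f g f' g' : E} (h : (f, g) ∈ generatorGraph U)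
    (h' : (f', g') ∈ generatorGraph U) : ⟪g, f'⟫_ℂ = ⟪f, g'⟫_ℂ := by
  have h1 := HasDerivAt.inner ℂ h h'
  simp only [LinearIsometryEquiv.inner_map_map, hU.map_zero] at h1
  have h2 := h1.unique (hasDerivAt_const (0 : ℝ) ⟪f, f'⟫_ℂ)
  rw [inner_smul_left, inner_smul_right, Complex.conj_I] at h2
  have h3 : Complex.I * (⟪f, g'⟫_ℂ - ⟪g, f'⟫_ℂ) = 0 := by rw [← h2]; ring
  simpa [sub_eq_zero, eq_comm] using h3

variable [CompleteSpace E]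

/-- The integrated equation involves only bounded operators, so unlike the derivative it passes to
limits of `f`, of `g` and of the group itself. -/
theorem mem_generatorGraph_iff_integral (hU : IsUnitaryGroup U) {f g : E} :
    (f, g) ∈ generatorGraph U ↔ ∀ t, U t f = f + hU.integralCLM t (Complex.I • g) := by
  constructor
  · intro h t
    rw [integralCLM_apply, intervalIntegral.integral_eq_sub_of_hasDerivAt
      (fun s _ => hU.hasDerivAt h s) (hU.intervalIntegrable _ _ _), hU.map_zero]
    abel
  · intro h
    have h1 : HasDerivAt (fun t => ∫ s in (0 : ℝ)..t, U s (Complex.I • g))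
        (U 0 (Complex.I • g)) 0 :=
      intervalIntegral.integral_hasDerivAt_right (hU.intervalIntegrable _ _ _)
        ((hU.continuous_apply _).stronglyMeasurableAtFilter _ _)
        (hU.continuous_apply _).continuousAt
    rw [hU.map_zero] at h1
    rw [mem_generatorGraph]
    simpa only [funext h] using! h1.const_add f

theorem isClosed_generatorGraph (hU : IsUnitaryGroup U) :
    IsClosed (generatorGraph U : Set (E × E)) := by
  have : (generatorGraph U : Set (E × E)) =
      ⋂ t : ℝ, {p | U t p.1 = p.1 + hU.integralCLM t (Complex.I • p.2)} := by
    ext ⟨f, g⟩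
    simpa using hU.mem_generatorGraph_iff_integral
  rw [this]
  exact isClosed_iInter fun t => isClosed_eq (by fun_prop) (by fun_prop)

/-- A dense subspace of the graph of the generator whose closure is invariant under the group is
dense in the graph. -/
theorem generatorGraph_eq_topologicalClosure (hU : IsUnitaryGroup U) {Γ : Submodule ℂ (E × E)}
    (hΓ : Γ ≤ generatorGraph U) (hd : Dense (Prod.fst '' (Γ : Set (E × E))))
    (hinv : ∀ p ∈ Γ, ∀ s, (U s p.1, U s p.2) ∈ Γ.topologicalClosure) :
    generatorGraph U = Γ.topologicalClosure := by
  refine le_antisymm ?_ (Submodule.topologicalClosure_minimal _ hΓ hU.isClosed_generatorGraph)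
  have hcl : IsClosed (Γ.topologicalClosure : Set (E × E)) := Γ.isClosed_topologicalClosure
  -- averages of elements of `Γ`
  have h1 : ∀ p ∈ Γ, ∀ t : ℝ, 0 < t →
      (hU.integralCLM t p.1, hU.integralCLM t p.2) ∈ Γ.topologicalClosure := by
    rintro ⟨f, g⟩ hp t ht
    have hi : IntervalIntegrable (fun s => ((U s f, U s g) : E × E)) volume 0 t :=
      ((hU.continuous_apply f).prodMk (hU.continuous_apply g)).intervalIntegrable _ _
    have h2 : ∫ s in (0 : ℝ)..t, ((U s f, U s g) : E × E) =
        (hU.integralCLM t f, hU.integralCLM t g) := by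
      refine Prod.ext ?_ ?_
      · exact ((ContinuousLinearMap.fst ℝ E E).intervalIntegral_comp_comm hi).symm
      · exact ((ContinuousLinearMap.snd ℝ E E).intervalIntegral_comp_comm hi).symm
    -- An average of points of a closed convex set stays in the set.
    have h3 : ⨍ s in Set.Ioc 0 t, ((U s f, U s g) : E × E) ∈
        (Γ.topologicalClosure : Set (E × E)) := by
      refine Convex.set_average_mem ((Γ.topologicalClosure.restrictScalars ℝ).convex) hcl
        (by simp [ht]) (by simp) (Eventually.of_forall fun s => hinv _ hp s) ?_
      exact (intervalIntegrable_iff_integrableOn_Ioc_of_le ht.le).1 hi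
    rw [setAverage_eq, ← intervalIntegral.integral_of_le ht.le, h2] at h3
    have h4 := (Γ.topologicalClosure.restrictScalars ℝ).smul_mem t h3
    have ht' : (volume : Measure ℝ).real (Set.Ioc 0 t) = t := by simp [ht.le]
    rw [ht', smul_inv_smul₀ ht.ne'] at h4
    exact h4
  -- For (f, g) in Γ, `U t f - f` is i ∫₀ᵗ U s g ds, so this pair is i times the previous one. It no
  -- longer mentions g and depends continuously on f, hence density of the first components gives it
  -- for all f.
  have h2 : ∀ (f : E) (t : ℝ), 0 < t → (Complex.I • hU.integralCLM t f, U t f - f) ∈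
      Γ.topologicalClosure := by
    intro f t ht
    have hc : IsClosed {f : E | (Complex.I • hU.integralCLM t f, U t f - f) ∈
        Γ.topologicalClosure} := hcl.preimage (f := fun f : E =>
          (Complex.I • hU.integralCLM t f, U t f - f)) (by fun_prop)
    refine hc.closure_subset_iff.2 ?_ (hd f)
    rintro _ ⟨⟨f, g⟩, hp, rfl⟩
    have h3 := Γ.topologicalClosure.smul_mem Complex.I (h1 _ hp t ht)
    have h4 := hU.mem_generatorGraph_iff_integral.1 (hΓ hp) t
    simp only [Set.mem_ofPred_eq, h4, add_sub_cancel_left, map_smul]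
    simpa using! h3
  rintro ⟨f, g⟩ hp
  -- Multiplication by -i/t; for (f, g) in the generator these pairs tend to (f, g) as t decreases
  -- to 0.
  have h3 : ∀ t : ℝ, 0 < t → ((t⁻¹ : ℝ) • hU.integralCLM t f,
      -Complex.I • ((t⁻¹ : ℝ) • (U t f - f))) ∈ Γ.topologicalClosure := by
    intro t ht
    have h4 := (Γ.topologicalClosure.restrictScalars ℝ).smul_mem t⁻¹
      (Γ.topologicalClosure.smul_mem (-Complex.I) (h2 f t ht))
    simp only [Prod.smul_mk, smul_smul, neg_mul, Complex.I_mul_I, neg_neg, one_smul] at h4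
    rw [smul_comm] at h4
    exact h4
  have h4 : Tendsto (fun t : ℝ => ((t⁻¹ : ℝ) • hU.integralCLM t f,
      -Complex.I • ((t⁻¹ : ℝ) • (U t f - f)))) (𝓝[>] 0) (𝓝 (f, g)) := by
    refine Tendsto.prodMk_nhds ?_ ?_
    · have h5 : HasDerivAt (fun t => ∫ s in (0 : ℝ)..t, U s f) (U 0 f) 0 :=
        intervalIntegral.integral_hasDerivAt_right (hU.intervalIntegrable _ _ _)
          ((hU.continuous_apply _).stronglyMeasurableAtFilter _ _)
          (hU.continuous_apply _).continuousAt
      rw [hU.map_zero] at h5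
      simpa using! h5.tendsto_slope_zero_right
    · have h5 := (mem_generatorGraph.1 hp).tendsto_slope_zero_right
      simp only [zero_add, hU.map_zero] at h5
      simpa [smul_smul] using h5.const_smul (-Complex.I)
  exact hcl.mem_of_tendsto h4 (by filter_upwards [self_mem_nhdsWithin] with t ht using h3 t ht)

/-- The generator is the adjoint of its restriction to any core. -/
theorem mem_generatorGraph_of_inner (hU : IsUnitaryGroup U) {Γ : Submodule ℂ (E × E)}
    (hΓ : generatorGraph U = Γ.topologicalClosure) (hd : Dense (Prod.fst '' (Γ : Set (E × E))))
    {f g : E} (h : ∀ p ∈ Γ, ⟪g, p.1⟫_ℂ = ⟪f, p.2⟫_ℂ) : (f, g) ∈ generatorGraph U := by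
  have h1 : ∀ p ∈ generatorGraph U, ⟪g, p.1⟫_ℂ = ⟪f, p.2⟫_ℂ := by
    intro p hp
    rw [hΓ] at hp
    have hc : IsClosed {p : E × E | ⟪g, p.1⟫_ℂ = ⟪f, p.2⟫_ℂ} :=
      isClosed_eq (by fun_prop) (by fun_prop)
    exact hc.closure_subset_iff.2 (fun p hp => h p hp) hp
  rw [hU.mem_generatorGraph_iff_integral]
  intro t
  rw [← sub_eq_zero]
  -- The integrated equation for f is tested against the dense set of first components of Γ.
  refine hd.eq_zero_of_inner_right (𝕜 := ℂ) ?_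
  rintro _ ⟨⟨x, y⟩, hp, rfl⟩
  have hp' : (x, y) ∈ generatorGraph U := by
    rw [hΓ]; exact Γ.le_topologicalClosure hp
  change ⟪x, _⟫_ℂ = 0
  -- The orbit of f is not known to be differentiable, so the group is moved onto x, which lies in
  -- the domain along with its orbit; the adjoint relation `h1` then turns y back into g.
  have h2 : ∀ s, HasDerivAt (fun s => ⟪x, U s f⟫_ℂ) ⟪x, U s (Complex.I • g)⟫_ℂ s := by
    intro s
    have h3 : HasDerivAt (fun s : ℝ => U (-s) x) (-U (-s) (Complex.I • y)) s := by
      have := HasDerivAt.scomp s (h := fun s : ℝ => -s) (g₁ := fun s : ℝ => U s x)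
        (hU.hasDerivAt hp' (-s)) (hasDerivAt_neg s)
      simpa using! this
    have h4 := HasDerivAt.inner ℂ h3 (hasDerivAt_const s f)
    have h5 : ∀ s u v, ⟪U (-s) u, v⟫_ℂ = ⟪u, U s v⟫_ℂ := fun s u v => by
      rw [hU.inner_map_left, neg_neg]
    have h6 := h1 _ (hU.map_mem_generatorGraph hp' (-s))
    have h6' : ⟪U (-s) x, g⟫_ℂ = ⟪U (-s) y, f⟫_ℂ := by
      rw [← inner_conj_symm, h6, inner_conj_symm]
    simp only [h5, inner_neg_left] at h4 h6'
    simp only [map_smul, inner_smul_left, inner_smul_right, Complex.conj_I] at h4 ⊢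
    rw [h6']
    simpa using h4
  have h3 := intervalIntegral.integral_eq_sub_of_hasDerivAt (a := 0) (b := t)
    (fun s _ => h2 s) (((continuous_const.inner
      (hU.continuous_apply (Complex.I • g)))).intervalIntegrable _ _)
  have h4 : ∫ s in (0 : ℝ)..t, ⟪x, U s (Complex.I • g)⟫_ℂ =
      ⟪x, hU.integralCLM t (Complex.I • g)⟫_ℂ :=
    ((innerSL ℂ x).restrictScalars ℝ).intervalIntegral_comp_comm
      (hU.intervalIntegrable (Complex.I • g) 0 t)
  rw [h4, hU.map_zero] at h3
  rw [inner_sub_right, inner_add_right, h3]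
  ring

end IsUnitaryGroup

end UnitaryGroup

/-! ### Unitary groups as limits of exponentials of bounded operators -/

section Approximation

open MeasureTheory Filter Topology

variable {E : Type*} [NormedAddCommGroup E] [InnerProductSpace ℂ E]

/-- If unitary groups `V N` converge strongly, the limit is a
one-parameter unitary group, provided it is strongly continuous. -/
theorem exists_isUnitaryGroup_of_tendsto {V : ℕ → ℝ → E ≃ₗᵢ[ℂ] E}
    (hV : ∀ N, IsUnitaryGroup (V N)) (W : ℝ → E → E)
    (hW : ∀ t f, Tendsto (fun N => V N t f) atTop (𝓝 (W t f)))
    (hc : ∀ f, Continuous fun t => W t f) :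
    ∃ U : ℝ → E ≃ₗᵢ[ℂ] E, IsUnitaryGroup U ∧ ∀ t f, U t f = W t f := by
  have hcomp : ∀ s t f, W (s + t) f = W s (W t f) := by
    intro s t f
    refine tendsto_nhds_unique (hW (s + t) f) ?_
    rw [tendsto_iff_norm_sub_tendsto_zero]
    have h1 := (tendsto_iff_norm_sub_tendsto_zero.1 (hW t f)).add
      (tendsto_iff_norm_sub_tendsto_zero.1 (hW s (W t f)))
    rw [add_zero] at h1
    refine squeeze_zero (fun _ => norm_nonneg _) (fun N => ?_) h1
    rw [(hV N).map_add, ← (V N s).norm_map (V N t f - W t f), map_sub]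
    exact norm_sub_le_norm_sub_add_norm_sub _ _ _
  have hzero : ∀ f, W 0 f = f := fun f =>
    tendsto_nhds_unique (hW 0 f) (by simp only [(hV _).map_zero]; exact tendsto_const_nhds)
  refine ⟨fun t => ⟨⟨⟨⟨W t, ?_⟩, ?_⟩, W (-t), ?_, ?_⟩, ?_⟩, ⟨fun s t f => hcomp s t f, hc⟩,
    fun _ _ => rfl⟩
  · intro f g
    refine tendsto_nhds_unique (hW t (f + g)) ?_
    simpa only [map_add] using (hW t f).add (hW t g)
  · intro c f
    refine tendsto_nhds_unique (hW t (c • f)) ?_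
    simpa only [map_smul, RingHom.id_apply] using (hW t f).const_smul c
  · intro f
    exact (hcomp _ _ _).symm.trans (by rw [neg_add_cancel, hzero])
  · intro f
    exact (hcomp _ _ _).symm.trans (by rw [add_neg_cancel, hzero])
  · intro f
    refine tendsto_nhds_unique (hW t f).norm ?_
    simp only [LinearIsometryEquiv.norm_map]
    exact tendsto_const_nhds

variable [CompleteSpace E]

/-- The unitary group `exp (i t A)` of a bounded self-adjoint operator. -/
def expGroup {A : E →L[ℂ] E} (hA : IsSelfAdjoint A) (t : ℝ) : E ≃ₗᵢ[ℂ] E :=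
  Unitary.linearIsometryEquiv ⟨NormedSpace.exp (t • (Complex.I • A)), by
    let _ : NormedAlgebra ℚ (E →L[ℂ] E) := .restrictScalars ℚ ℂ _
    refine NormedSpace.exp_mem_unitary_of_mem_skewAdjoint ?_
    rw [skewAdjoint.mem_iff, star_smul, star_smul, hA.star_eq]
    simp⟩

theorem expGroup_apply {A : E →L[ℂ] E} (hA : IsSelfAdjoint A) (t : ℝ) (f : E) :
    expGroup hA t f = (NormedSpace.exp (t • (Complex.I • A)) : E →L[ℂ] E) f := rfl

/-- Duhamel's formula in differential form. With `L` the identity it compares two groups; with `B =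
A` it propagates the weight `L`. -/
theorem hasDerivAt_expGroup_conj {A B : E →L[ℂ] E} (hA : IsSelfAdjoint A) (hB : IsSelfAdjoint B)
    (L : E →L[ℂ] E) (f : E) (s : ℝ) :
    HasDerivAt (fun s : ℝ => expGroup hB (-s) (L (expGroup hA s f)))
      (expGroup hB (-s) (Complex.I • (L (A (expGroup hA s f)) - B (L (expGroup hA s f))))) s := by
  have h1 : HasDerivAt (fun s : ℝ => (NormedSpace.exp (s • (Complex.I • A)) : E →L[ℂ] E))
      ((Complex.I • A) * NormedSpace.exp (s • (Complex.I • A))) s :=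
    hasDerivAt_exp_smul_const' _ _
  have h2 : HasDerivAt (fun s : ℝ => (NormedSpace.exp (s • (-(Complex.I • B))) : E →L[ℂ] E))
      (NormedSpace.exp (s • (-(Complex.I • B))) * -(Complex.I • B)) s :=
    hasDerivAt_exp_smul_const _ _
  have h3 := h2.mul (h1.const_mul L)
  have h4 := ((ContinuousLinearMap.apply ℂ E f).restrictScalars ℝ).hasFDerivAt.comp_hasDerivAt s h3
  refine (h4.congr_of_eventuallyEq (Eventually.of_forall fun t => ?_)).congr_deriv ?_
  · simp [expGroup_apply]
  · simp [expGroup_apply, smul_sub]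
    abel

theorem hasDerivAt_expGroup {A : E →L[ℂ] E} (hA : IsSelfAdjoint A) (f : E) (s : ℝ) :
    HasDerivAt (fun s : ℝ => expGroup hA s f) (Complex.I • A (expGroup hA s f)) s := by
  have h1 : HasDerivAt (fun s : ℝ => (NormedSpace.exp (s • (Complex.I • A)) : E →L[ℂ] E))
      ((Complex.I • A) * NormedSpace.exp (s • (Complex.I • A))) s :=
    hasDerivAt_exp_smul_const' _ _
  exact ((ContinuousLinearMap.apply ℂ E f).restrictScalars ℝ).hasFDerivAt.comp_hasDerivAt s h1

theorem isUnitaryGroup_expGroup {A : E →L[ℂ] E} (hA : IsSelfAdjoint A) :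
    IsUnitaryGroup (expGroup hA) where
  map_add s t f := by
    let _ : NormedAlgebra ℚ (E →L[ℂ] E) := .restrictScalars ℚ ℂ _
    simp only [expGroup_apply]
    rw [add_smul, NormedSpace.exp_add_of_commute
      (((Commute.refl (Complex.I • A)).smul_left s).smul_right t)]
    rfl
  continuous_apply f := continuous_iff_continuousAt.2 fun s =>
    (hasDerivAt_expGroup hA f s).continuousAt

theorem expGroup_commute {A B : E →L[ℂ] E} (hA : IsSelfAdjoint A) (h : Commute B A) (t : ℝ)
    (f : E) : B (expGroup hA t f) = expGroup hA t (B f) := by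
  let _ : NormedAlgebra ℚ (E →L[ℂ] E) := .restrictScalars ℚ ℂ _
  have h1 : Commute B (NormedSpace.exp (t • (Complex.I • A))) :=
    ((h.smul_right Complex.I).smul_right t).exp_right
  exact congrArg (fun T : E →L[ℂ] E => T f) h1.eq

theorem expGroup_neg {A : E →L[ℂ] E} (hA : IsSelfAdjoint A) (t : ℝ) (f : E) :
    expGroup hA (-t) f = expGroup hA.neg t f := by
  simp [expGroup_apply]

theorem mem_generatorGraph_expGroup {A : E →L[ℂ] E} (hA : IsSelfAdjoint A) (f : E) :
    (f, A f) ∈ generatorGraph (expGroup hA) := by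
  have := hasDerivAt_expGroup hA f 0
  rwa [(isUnitaryGroup_expGroup hA).map_zero] at this

/-- The derivative of exp(-isB) exp(isA) f has norm ‖(A - B) exp(isA) f‖. The difference `B - A`
thus has to be controlled only along the orbit of the one group exp(isA). -/
theorem norm_expGroup_sub_le {A B : E →L[ℂ] E} (hA : IsSelfAdjoint A) (hB : IsSelfAdjoint B)
    (f : E) (t ε : ℝ)
    (h : ∀ s, |s| ≤ |t| → ‖B (expGroup hA s f) - A (expGroup hA s f)‖ ≤ ε) :
    ‖expGroup hB t f - expGroup hA t f‖ ≤ ε * |t| := by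
  have h1 := Convex.norm_image_sub_le_of_norm_hasDerivWithin_le
    (f := fun s : ℝ => expGroup hB (-s) (expGroup hA s f)) (s := Set.uIcc 0 t) (C := ε)
    (fun s _ => (hasDerivAt_expGroup_conj hA hB (ContinuousLinearMap.id ℂ E) f s).hasDerivWithinAt)
    (fun s hs => by
      have hs' : |s| ≤ |t| := by
        have := Set.abs_sub_left_of_mem_uIcc hs
        simpa using this
      simpa [norm_smul, norm_sub_rev, -map_sub] using h s hs')
    (convex_uIcc 0 t) Set.left_mem_uIcc Set.right_mem_uIcc
  have hU := isUnitaryGroup_expGroup hB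
  have hUA := isUnitaryGroup_expGroup hA
  simp only [neg_zero, hU.map_zero, hUA.map_zero, sub_zero, Real.norm_eq_abs] at h1
  rw [← (expGroup hB t).norm_map, map_sub, hU.map_map_neg, norm_sub_rev] at h1
  exact h1

/-- Propagation of weighted norms: if the commutator of `A` with the weight `L` is bounded by `L`,
then the group `exp (i t A)` increases the weighted norm at most exponentially. -/
theorem norm_weight_expGroup_le {A L : E →L[ℂ] E} (hA : IsSelfAdjoint A) {C : ℝ}
    (h : ∀ f, ‖L (A f) - A (L f)‖ ≤ C * ‖L f‖) (f : E) (t : ℝ) :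
    ‖L (expGroup hA t f)‖ ≤ ‖L f‖ * Real.exp (C * |t|) := by
  -- Grönwall's inequality covers forward times; negative times are forward times for `-A`, whose
  -- commutator with `L` obeys the same bound.
  have key : ∀ {A : E →L[ℂ] E} (hA : IsSelfAdjoint A),
      (∀ f, ‖L (A f) - A (L f)‖ ≤ C * ‖L f‖) → ∀ t, 0 ≤ t →
      ‖L (expGroup hA t f)‖ ≤ ‖L f‖ * Real.exp (C * t) := by
    intro A hA h t ht
    have hd := hasDerivAt_expGroup_conj hA hA L f
    have := norm_le_gronwallBound_of_norm_deriv_right_le (a := 0) (b := t) (δ := ‖L f‖) (K := C)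
      (ε := 0) (f := fun s : ℝ => expGroup hA (-s) (L (expGroup hA s f)))
      (fun s _ => (hd s).continuousAt.continuousWithinAt)
      (fun s _ => (hd s).hasDerivWithinAt) (by simp [(isUnitaryGroup_expGroup hA).map_zero])
      (fun s _ => by simpa [norm_smul, -map_sub] using h (expGroup hA s f)) t ⟨ht, le_rfl⟩
    simpa [gronwallBound_ε0] using this
  rcases le_total 0 t with ht | ht
  · rw [abs_of_nonneg ht]
    exact key hA h t ht
  · rw [abs_of_nonpos ht]
    have := key hA.neg (fun f => by
      have := h f
      rw [norm_sub_rev] at this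
      simpa [sub_eq_add_neg, add_comm] using this) (-t) (by linarith)
    rwa [← expGroup_neg, neg_neg] at this

/-- A sequence of unitary groups that converges strongly on a dense set. -/
theorem exists_tendsto_of_dense {V : ℕ → E ≃ₗᵢ[ℂ] E} {D : Set E} (hD : Dense D)
    (h : ∀ f ∈ D, CauchySeq fun N => V N f) (f : E) :
    ∃ g, Tendsto (fun N => V N f) atTop (𝓝 g) := by
  refine cauchySeq_tendsto_of_complete ?_
  rw [Metric.cauchySeq_iff']
  intro ε hε
  obtain ⟨f', hf', hdist⟩ := Metric.mem_closure_iff.1 (hD f) (ε / 3) (by positivity)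
  obtain ⟨N, hN⟩ := Metric.cauchySeq_iff'.1 (h f' hf') (ε / 3) (by positivity)
  refine ⟨N, fun n hn => ?_⟩
  calc dist (V n f) (V N f) ≤ dist (V n f) (V n f') + dist (V n f') (V N f') +
        dist (V N f') (V N f) := dist_triangle4 _ _ _ _
    _ < ε / 3 + ε / 3 + ε / 3 := by
        simp only [LinearIsometryEquiv.dist_map]
        rw [dist_comm f' f]
        gcongr
        exact hN n hn
    _ = ε := by ring

/-- A symmetric operator with graph `Γ` that is approximated by bounded self-adjoint operators `A N`
whose groups leave the domain of `Γ` invariant, uniformly in the sense of `happ`, is essentially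
self-adjoint: its closure generates a unitary group. -/
theorem exists_isUnitaryGroup_of_approx {Γ : Submodule ℂ (E × E)} {A : ℕ → E →L[ℂ] E}
    (hA : ∀ N, IsSelfAdjoint (A N)) (hd : Dense (Prod.fst '' (Γ : Set (E × E))))
    (hconv : ∀ p ∈ Γ, Tendsto (fun N => A N p.1) atTop (𝓝 p.2))
    (happ : ∀ p ∈ Γ, ∀ T : ℝ, ∃ ε : ℕ → ℝ, Tendsto ε atTop (𝓝 0) ∧
      ∀ᶠ N in atTop, ∀ s, |s| ≤ T → (∃ k, (expGroup (hA N) s p.1, k) ∈ Γ) ∧ ∀ M ≥ N,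
        ‖A M (expGroup (hA N) s p.1) - A N (expGroup (hA N) s p.1)‖ ≤ ε N) :
    ∃ U : ℝ → E ≃ₗᵢ[ℂ] E, IsUnitaryGroup U ∧ generatorGraph U = Γ.topologicalClosure := by
  have hV := fun N => isUnitaryGroup_expGroup (hA N)
  have hcauchy : ∀ t, ∀ f ∈ Prod.fst '' (Γ : Set (E × E)),
      CauchySeq fun N => expGroup (hA N) t f := by
    rintro t _ ⟨p, hp, rfl⟩
    obtain ⟨ε, hε, hN⟩ := happ p hp |t|
    rw [Metric.cauchySeq_iff']
    intro δ hδ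
    have h1 : ∀ᶠ N in atTop, ε N * |t| < δ := by
      have := hε.mul_const |t|
      rw [zero_mul] at this
      exact this.eventually_lt_const hδ
    obtain ⟨N, hN, h1⟩ := (hN.and h1).exists
    refine ⟨N, fun M hM => lt_of_le_of_lt ?_ h1⟩
    rw [dist_eq_norm]
    exact norm_expGroup_sub_le (hA N) (hA M) p.1 t (ε N) fun s hs => (hN s hs).2 M hM
  choose W hW using fun t => exists_tendsto_of_dense hd (hcauchy t)
  have hWiso : ∀ t f g, dist (W t f) (W t g) = dist f g := fun t f g =>
    tendsto_nhds_unique ((hW t f).dist (hW t g)) (by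
      simp only [LinearIsometryEquiv.dist_map]; exact tendsto_const_nhds)
  -- The speed of the orbit under exp(irA_N) is ‖A_N p.1‖ at every time r, and this tends to ‖p.2‖.
  have hlip : ∀ p ∈ Γ, ∀ s t, dist (W t p.1) (W s p.1) ≤ ‖p.2‖ * |t - s| := by
    intro p hp s t
    refine le_of_tendsto_of_tendsto' ((hW t p.1).dist (hW s p.1))
      ((hconv p hp).norm.mul_const _) fun N => ?_
    rw [dist_eq_norm]
    refine Convex.norm_image_sub_le_of_norm_hasDerivWithin_le (s := Set.univ)
      (f := fun r : ℝ => expGroup (hA N) r p.1)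
      (fun r _ => (hasDerivAt_expGroup (hA N) p.1 r).hasDerivWithinAt) (fun r _ => ?_)
      convex_univ trivial trivial
    rw [expGroup_commute (hA N) (Commute.refl _), norm_smul, LinearIsometryEquiv.norm_map]
    simp
  have hc : ∀ f, Continuous fun t => W t f := by
    intro f
    refine continuous_of_uniform_approx_of_continuous fun u hu => ?_
    obtain ⟨ε, hε, hu⟩ := Metric.mem_uniformity_dist.1 hu
    obtain ⟨_, ⟨p, hp, rfl⟩, hdist⟩ := Metric.mem_closure_iff.1 (hd f) ε hε
    -- Since each `W t` is an isometry, the orbit of p.1 approximates that of f uniformly in t.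
    refine ⟨fun t => W t p.1, ?_, fun t => hu (by rwa [hWiso])⟩
    refine LipschitzWith.continuous (K := ‖p.2‖₊) (LipschitzWith.of_dist_le_mul fun t s => ?_)
    simpa [Real.dist_eq] using hlip p hp s t
  obtain ⟨U, hU, hUW⟩ := exists_isUnitaryGroup_of_tendsto hV W hW hc
  have hUt : ∀ t f, Tendsto (fun N => expGroup (hA N) t f) atTop (𝓝 (U t f)) := fun t f => by
    rw [hUW]; exact hW t f
  have hUt' : ∀ t f (u : ℕ → E), Tendsto u atTop (𝓝 f) →
      Tendsto (fun N => expGroup (hA N) t (u N)) atTop (𝓝 (U t f)) := by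
    intro t f u hu
    have h1 := (hUt t f).add (tendsto_zero_iff_norm_tendsto_zero.2
      ((tendsto_iff_norm_sub_tendsto_zero.1 hu).congr fun N =>
        (((expGroup (hA N) t).norm_map _).symm)))
    rw [add_zero] at h1
    refine h1.congr fun N => ?_
    rw [map_sub]; abel
  refine ⟨U, hU, hU.generatorGraph_eq_topologicalClosure ?_ hd ?_⟩
  · intro p hp
    refine (hU.mem_generatorGraph_iff_integral (f := p.1) (g := p.2)).2 fun t => ?_
    have h1 : ∀ N, expGroup (hA N) t p.1 = p.1 +
        ∫ s in (0 : ℝ)..t, expGroup (hA N) s (Complex.I • A N p.1) := fun N =>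
      (hV N).mem_generatorGraph_iff_integral.1 (mem_generatorGraph_expGroup (hA N) p.1) t
    refine tendsto_nhds_unique (hUt t p.1) ?_
    simp only [h1]
    refine tendsto_const_nhds.add ?_
    refine intervalIntegral.tendsto_integral_filter_of_dominated_convergence
      (fun _ => ‖p.2‖ + 1) (Eventually.of_forall fun N =>
        ((hV N).continuous_apply _).aestronglyMeasurable) ?_ (by simp)
      (Eventually.of_forall fun s _ => ?_)
    · have h2 := (hconv p hp).norm.eventually_le_const (lt_add_one ‖p.2‖)
      filter_upwards [h2] with N hN
      refine Eventually.of_forall fun s _ => ?_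
      simpa [norm_smul] using hN
    · exact hUt' s _ _ ((hconv p hp).const_smul Complex.I)
  · intro p hp s
    obtain ⟨ε, hε, hN⟩ := happ p hp |s|
    -- The value k at exp(isA_N) p.1 is the limit over M of A_M exp(isA_N) p.1, so `happ` puts it
    -- within ε N of A_N exp(isA_N) p.1 = exp(isA_N) A_N p.1, which tends to U s p.2. The pair (U s
    -- p.1, U s p.2) is then a limit of elements of Γ.
    have h1 : ∀ᶠ N in atTop, ∃ k, (expGroup (hA N) s p.1, k) ∈ Γ ∧
        ‖k - expGroup (hA N) s (A N p.1)‖ ≤ ε N := by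
      filter_upwards [hN] with N hN
      obtain ⟨⟨k, hk⟩, h2⟩ := hN s le_rfl
      refine ⟨k, hk, ?_⟩
      rw [← expGroup_commute (hA N) (Commute.refl _)]
      exact le_of_tendsto ((hconv _ hk).sub_const _).norm
        ((eventually_ge_atTop N).mono fun M hM => h2 M hM)
    obtain ⟨k, hk⟩ : ∃ k : ℕ → E, ∀ᶠ N in atTop, (expGroup (hA N) s p.1, k N) ∈ Γ ∧
        ‖k N - expGroup (hA N) s (A N p.1)‖ ≤ ε N := by
      classical
      refine ⟨fun N => if h : ∃ k, (expGroup (hA N) s p.1, k) ∈ Γ ∧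
        ‖k - expGroup (hA N) s (A N p.1)‖ ≤ ε N then h.choose else 0, ?_⟩
      filter_upwards [h1] with N hN
      rw [dif_pos hN]
      exact hN.choose_spec
    have h2 : Tendsto (fun N => k N - expGroup (hA N) s (A N p.1)) atTop (𝓝 0) :=
      squeeze_zero_norm' (hk.mono fun N h => h.2) hε
    have h3 : Tendsto k atTop (𝓝 (U s p.2)) := by
      have := h2.add (hUt' s _ _ (hconv p hp))
      simpa using this
    exact (Γ.isClosed_topologicalClosure).mem_of_tendsto ((hUt s p.1).prodMk_nhds h3)
      (hk.mono fun N h => Γ.le_topologicalClosure h.1)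

end Approximation

/-! ### Bounded commutators -/

section Commutator

open MeasureTheory Filter Topology

variable {E : Type*} [NormedAddCommGroup E] [InnerProductSpace ℂ E]

theorem IsUnitaryGroup.continuous_map {U : ℝ → E ≃ₗᵢ[ℂ] E} (hU : IsUnitaryGroup U) {x : ℝ → E}
    (hx : Continuous x) : Continuous fun t => U t (x t) := by
  refine continuous_iff_continuousAt.2 fun s => ?_
  have h1 : Tendsto (fun t => ‖x t - x s‖ + ‖U t (x s) - U s (x s)‖) (𝓝 s) (𝓝 0) := by
    have h2 := tendsto_iff_norm_sub_tendsto_zero.1 (hx.tendsto s)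
    have h3 := tendsto_iff_norm_sub_tendsto_zero.1 ((hU.continuous_apply (x s)).tendsto s)
    simpa using h2.add h3
  refine tendsto_iff_norm_sub_tendsto_zero.2
    (squeeze_zero (fun _ => norm_nonneg _) (fun t => ?_) h1)
  rw [← (U t).norm_map (x t - x s), map_sub]
  exact norm_sub_le_norm_sub_add_norm_sub _ _ _

/-- In terms of the graph, the domain of `A` can be exchanged for `generatorGraph`. -/
theorem extendsCommutator_iff {H : E →L[ℂ] E} {A : E →ₗ.[ℂ] E} {B : E →L[ℂ] E} :
    ExtendsCommutator H A B ↔ ∀ p ∈ A.graph, ∀ q ∈ A.graph,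
      ⟪p.1, B q.1⟫_ℂ = Complex.I * (⟪H p.1, q.2⟫_ℂ - ⟪p.2, H q.1⟫_ℂ) := by
  constructor
  · intro h p hp q hq
    obtain ⟨f, hf1, hf2⟩ := (LinearPMap.mem_graph_iff A).1 hp
    obtain ⟨g, hg1, hg2⟩ := (LinearPMap.mem_graph_iff A).1 hq
    rw [← hf1, ← hf2, ← hg1, ← hg2]
    exact h f g
  · intro h f g
    exact h _ (A.mem_graph f) _ (A.mem_graph g)

theorem commutatorExt_eq {H : E →L[ℂ] E} {A : E →ₗ.[ℂ] E} {B : E →L[ℂ] E}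
    (hd : Dense (A.domain : Set E)) (hB : ExtendsCommutator H A B) : commutatorExt H A = B := by
  have h : ∃ B : E →L[ℂ] E, ExtendsCommutator H A B := ⟨B, hB⟩
  rw [commutatorExt, dif_pos h]
  refine ContinuousLinearMap.ext_on (s := (A.domain : Set E)) ?_ fun g hg => ?_
  · rwa [Submodule.span_eq]
  · refine hd.eq_of_inner_right ℂ fun f hf => ?_
    exact (h.choose_spec ⟨f, hf⟩ ⟨g, hg⟩).trans (hB ⟨f, hf⟩ ⟨g, hg⟩).symm

theorem dense_domain {A : E →ₗ.[ℂ] E} {Γ : Submodule ℂ (E × E)} (hΓ : Γ ≤ A.graph)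
    (hd : Dense (Prod.fst '' (Γ : Set (E × E)))) : Dense (A.domain : Set E) := by
  refine hd.mono ?_
  rintro _ ⟨⟨f, g⟩, hp, rfl⟩
  exact LinearPMap.mem_domain_of_mem_graph (hΓ hp)

variable [CompleteSpace E]

/-- A bounded commutator gives the regularity `H ∈ 𝒞¹(A)`. -/
theorem isC1_of_extendsCommutator {U : ℝ → E ≃ₗᵢ[ℂ] E} (hU : IsUnitaryGroup U)
    {A : E →ₗ.[ℂ] E} (hA : A.graph = generatorGraph U) (hd : Dense (A.domain : Set E))
    {H B : E →L[ℂ] E} (hH : IsSelfAdjoint H) (hB : ExtendsCommutator H A B) : IsC1 H A := by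
  rw [extendsCommutator_iff, hA] at hB
  have hHs : ∀ f g, ⟪H f, g⟫_ℂ = ⟪f, H g⟫_ℂ := fun f g => hH.isSymmetric f g
  have hneg : ∀ f, Continuous fun s => U (-s) f := fun f =>
    (hU.continuous_apply f).comp continuous_neg
  have hcont : ∀ g, Continuous fun s => U s (B (U (-s) g)) := fun g =>
    hU.continuous_map (B.continuous.comp (hneg g))
  have hderiv : ∀ f g, (f, g) ∈ generatorGraph U → ∀ s,
      HasDerivAt (fun s => U (-s) f) (-(Complex.I • U (-s) g)) s := by
    intro f g h s
    have := HasDerivAt.scomp s (h := fun s : ℝ => -s) (g₁ := fun s : ℝ => U s f)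
      (hU.hasDerivAt h (-s)) (hasDerivAt_neg s)
    simpa using! this
  have hinner : ∀ s u v, ⟪U (-s) u, v⟫_ℂ = ⟪u, U s v⟫_ℂ := fun s u v => by
    rw [hU.inner_map_left, neg_neg]
  -- the integrated commutator identity
  have hint : ∀ g t, IntervalIntegrable (fun s => U s (B (U (-s) g))) volume 0 t := fun g t =>
    (hcont g).intervalIntegrable _ _
  -- The strong integral ∫₀ᵗ U s B U(-s) ds, as a bounded operator.
  let J : ℝ → E →L[ℂ] E := fun t => LinearMap.mkContinuous
    { toFun := fun g => ∫ s in (0 : ℝ)..t, U s (B (U (-s) g))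
      map_add' := fun f g => by
        simp only [map_add]
        exact intervalIntegral.integral_add (hint f t) (hint g t)
      map_smul' := fun c f => by simp } (‖B‖ * |t|) (fun g => by
    have := intervalIntegral.norm_integral_le_of_norm_le_const (a := (0 : ℝ)) (b := t)
      (f := fun s => U s (B (U (-s) g))) (C := ‖B‖ * ‖g‖) (fun s _ => by
        rw [LinearIsometryEquiv.norm_map, ← (U (-s)).norm_map g]
        exact B.le_opNorm _)
    calc _ ≤ ‖B‖ * ‖g‖ * |t - 0| := this
      _ = _ := by rw [sub_zero]; ring)
  have hJ : ∀ t g, J t g = ∫ s in (0 : ℝ)..t, U s (B (U (-s) g)) := fun _ _ => rfl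
  -- The derivative of exp(itA) H exp(-itA) is -exp(itA) [H, iA] exp(-itA), hence the minus sign. It
  -- is computed weakly between vectors of the domain; boundedness of both sides and density extend
  -- the integrated identity to all g.
  have key : ∀ t g, U t (H (U (-t) g)) = H g - J t g := by
    intro t
    suffices h : (U t : E →L[ℂ] E) ∘L H ∘L (U (-t) : E →L[ℂ] E) = H - J t from
      fun g => congrArg (fun T : E →L[ℂ] E => T g) h
    refine ContinuousLinearMap.ext_on (s := (A.domain : Set E)) (by rwa [Submodule.span_eq])
      fun g hg => ?_
    refine hd.eq_of_inner_right ℂ fun f hf => ?_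
    have hg' : (g, A ⟨g, hg⟩) ∈ generatorGraph U := hA ▸ A.mem_graph ⟨g, hg⟩
    have hf' : (f, A ⟨f, hf⟩) ∈ generatorGraph U := hA ▸ A.mem_graph ⟨f, hf⟩
    have h1 : ∀ s, HasDerivAt (fun s => ⟪U (-s) f, H (U (-s) g)⟫_ℂ)
        (-⟪f, U s (B (U (-s) g))⟫_ℂ) s := by
      intro s
      have h2 := (H.restrictScalars ℝ).hasFDerivAt.comp_hasDerivAt s (hderiv _ _ hg' s)
      have h3 := HasDerivAt.inner ℂ (hderiv _ _ hf' s) h2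
      refine h3.congr_deriv ?_
      rw [← hinner, hB _ (hU.map_mem_generatorGraph hf' (-s)) _
        (hU.map_mem_generatorGraph hg' (-s))]
      simp only [ContinuousLinearMap.coe_restrictScalars', map_neg, map_smul, inner_neg_right,
        inner_neg_left, inner_smul_left, inner_smul_right, Complex.conj_I, hHs, Function.comp]
      ring
    have h4 := intervalIntegral.integral_eq_sub_of_hasDerivAt (a := 0) (b := t)
      (fun s _ => h1 s) ((continuous_const.inner (hcont g)).neg.intervalIntegrable _ _)
    have h5 : ∫ s in (0 : ℝ)..t, ⟪f, U s (B (U (-s) g))⟫_ℂ = ⟪f, J t g⟫_ℂ :=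
      ((innerSL ℂ f).restrictScalars ℝ).intervalIntegral_comp_comm (hint g t)
    rw [intervalIntegral.integral_neg, h5, hinner, neg_zero, hU.map_zero, hU.map_zero] at h4
    change ⟪f, U t (H (U (-t) g))⟫_ℂ = ⟪f, H g - J t g⟫_ℂ
    rw [inner_sub_right]
    linear_combination -h4
  refine ⟨U, ⟨hU.map_add, hU.continuous_apply, fun f g => by rw [hA]; rfl⟩, fun f => ?_⟩
  have hd' : ∀ t, HasDerivAt (fun t => U t (H (U (-t) f))) (-(U t (B (U (-t) f)))) t := by
    intro t
    simp only [key]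
    exact (intervalIntegral.integral_hasDerivAt_right (hint f t)
      ((hcont f).stronglyMeasurableAtFilter _ _) (hcont f).continuousAt).const_sub (H f)
  rw [contDiff_one_iff_deriv]
  refine ⟨fun t => (hd' t).differentiableAt, ?_⟩
  rw [funext fun t => (hd' t).deriv]
  exact (hcont f).neg

end Commutator

/-! ### Transport by a unitary operator -/

section Transport

open MeasureTheory Filter Topology

variable {E E' : Type*} [NormedAddCommGroup E] [InnerProductSpace ℂ E]
  [NormedAddCommGroup E'] [InnerProductSpace ℂ E']

/-- The unitary group `F U(t) F⁻¹`. -/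
def conjGroup (F : E ≃ₗᵢ[ℂ] E') (U : ℝ → E ≃ₗᵢ[ℂ] E) (t : ℝ) : E' ≃ₗᵢ[ℂ] E' :=
  (F.symm.trans (U t)).trans F

theorem conjGroup_apply (F : E ≃ₗᵢ[ℂ] E') (U : ℝ → E ≃ₗᵢ[ℂ] E) (t : ℝ) (f : E') :
    conjGroup F U t f = F (U t (F.symm f)) := rfl

theorem isUnitaryGroup_conjGroup (F : E ≃ₗᵢ[ℂ] E') {U : ℝ → E ≃ₗᵢ[ℂ] E}
    (hU : IsUnitaryGroup U) : IsUnitaryGroup (conjGroup F U) where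
  map_add s t f := by simp [conjGroup_apply, hU.map_add]
  continuous_apply f := F.continuous.comp (hU.continuous_apply _)

theorem mem_generatorGraph_conjGroup (F : E ≃ₗᵢ[ℂ] E') {U : ℝ → E ≃ₗᵢ[ℂ] E} {f g : E} :
    (F f, F g) ∈ generatorGraph (conjGroup F U) ↔ (f, g) ∈ generatorGraph U := by
  simp only [mem_generatorGraph, conjGroup_apply, LinearIsometryEquiv.symm_apply_apply]
  constructor
  · intro h
    have := ((F.symm : E' →L[ℂ] E).restrictScalars ℝ).hasFDerivAt.comp_hasDerivAt (0 : ℝ) h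
    refine (this.congr_of_eventuallyEq (Eventually.of_forall fun t => ?_)).congr_deriv ?_ <;> simp
  · intro h
    have := ((F : E →L[ℂ] E').restrictScalars ℝ).hasFDerivAt.comp_hasDerivAt (0 : ℝ) h
    refine (this.congr_of_eventuallyEq (Eventually.of_forall fun t => ?_)).congr_deriv ?_ <;> simp

variable [CompleteSpace E] [CompleteSpace E']

theorem extendsCommutator_conj (F : E ≃ₗᵢ[ℂ] E') {H B : E →L[ℂ] E} {A : E →ₗ.[ℂ] E}
    {A' : E' →ₗ.[ℂ] E'} (hA : ∀ f g, (F f, F g) ∈ A'.graph ↔ (f, g) ∈ A.graph) :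
    ExtendsCommutator (F.conjStarAlgEquiv H) A' (F.conjStarAlgEquiv B) ↔
      ExtendsCommutator H A B := by
  simp only [extendsCommutator_iff, Prod.forall, LinearIsometryEquiv.conjStarAlgEquiv_apply_apply]
  constructor
  · intro h f g hfg f' g' hfg'
    simpa using h _ _ ((hA f g).2 hfg) _ _ ((hA f' g').2 hfg')
  · intro h f g hfg f' g' hfg'
    obtain ⟨f, rfl⟩ := F.surjective f
    obtain ⟨g, rfl⟩ := F.surjective g
    obtain ⟨f', rfl⟩ := F.surjective f'
    obtain ⟨g', rfl⟩ := F.surjective g'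
    simpa using h _ _ ((hA f g).1 hfg) _ _ ((hA f' g').1 hfg')

/-- Continuous star homomorphisms commute with the functional calculus; this is what makes the
spectral projections natural under `F`. -/
theorem cfc_conjStarAlgEquiv (F : E ≃ₗᵢ[ℂ] E') {H : E →L[ℂ] E} (hH : IsSelfAdjoint H)
    (φ : C(ℝ, ℝ)) : cfc φ (F.conjStarAlgEquiv H) = F.conjStarAlgEquiv (cfc φ H) := by
  have hc : Continuous F.conjStarAlgEquiv := by
    change Continuous fun T : E →L[ℂ] E =>
      (F : E →L[ℂ] E') ∘L T ∘L (F.symm : E' →L[ℂ] E)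
    fun_prop
  exact (StarAlgHomClass.map_cfc (S := ℂ) F.conjStarAlgEquiv (φ : ℝ → ℝ) H
    φ.continuous.continuousOn hc hH (hH.map _)).symm

theorem spectralSubspace_conj (F : E ≃ₗᵢ[ℂ] E') {H : E →L[ℂ] E} (hH : IsSelfAdjoint H)
    (I : Set ℝ) : spectralSubspace (F.conjStarAlgEquiv H) I =
      (spectralSubspace H I).map (F.toLinearEquiv : E →ₗ[ℂ] E') := by
  have h1 : ∀ S : Submodule ℂ E, (S.map (F.toLinearEquiv : E →ₗ[ℂ] E')).topologicalClosure =
      S.topologicalClosure.map (F.toLinearEquiv : E →ₗ[ℂ] E') := fun S =>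
    SetLike.coe_injective (F.toHomeomorph.image_closure S).symm
  rw [spectralSubspace, spectralSubspace, ← h1, Submodule.map_iSup]
  congr 1
  refine iSup_congr fun φ => ?_
  rw [cfc_conjStarAlgEquiv F hH]
  ext y
  simp only [Submodule.mem_map, LinearMap.mem_range, ContinuousLinearMap.coe_coe,
    LinearIsometryEquiv.conjStarAlgEquiv_apply_apply, exists_exists_eq_and]
  exact ⟨fun ⟨x, hx⟩ => ⟨F.symm x, hx⟩, fun ⟨x, hx⟩ => ⟨F x, by simpa using! hx⟩⟩

theorem spectralProjection_conj (F : E ≃ₗᵢ[ℂ] E') {H : E →L[ℂ] E} (hH : IsSelfAdjoint H)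
    (I : Set ℝ) : spectralProjection (F.conjStarAlgEquiv H) I =
      F.conjStarAlgEquiv (spectralProjection H I) := by
  ext y
  simp only [spectralProjection, spectralSubspace_conj F hH,
    LinearIsometryEquiv.conjStarAlgEquiv_apply_apply]
  exact Submodule.starProjection_map_apply F _ y

theorem conjStarAlgEquiv_mono (F : E ≃ₗᵢ[ℂ] E') {S T : E →L[ℂ] E} (h : S ≤ T) :
    F.conjStarAlgEquiv S ≤ F.conjStarAlgEquiv T := by
  rw [ContinuousLinearMap.le_def, ← map_sub]
  have := ((ContinuousLinearMap.le_def S T).1 h).conj_adjoint (F : E →L[ℂ] E')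
  rwa [LinearIsometryEquiv.adjoint_eq_symm] at this

theorem conjStarAlgEquiv_le_iff (F : E ≃ₗᵢ[ℂ] E') {S T : E →L[ℂ] E} :
    F.conjStarAlgEquiv S ≤ F.conjStarAlgEquiv T ↔ S ≤ T := by
  refine ⟨fun h => ?_, conjStarAlgEquiv_mono F⟩
  have := conjStarAlgEquiv_mono F.symm h
  simpa only [← LinearIsometryEquiv.symm_conjStarAlgEquiv, StarAlgEquiv.symm_apply_apply] using this

/-- Conjugation by `F` is a star isomorphism that preserves and reflects the order and carries the
spectral projection, by naturality, and the commutator, by `hC`, to their counterparts. -/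
theorem mourreInequality_conj (F : E ≃ₗᵢ[ℂ] E') {H : E →L[ℂ] E} (hH : IsSelfAdjoint H)
    {A : E →ₗ.[ℂ] E} {A' : E' →ₗ.[ℂ] E'}
    (hC : commutatorExt (F.conjStarAlgEquiv H) A' = F.conjStarAlgEquiv (commutatorExt H A))
    (I : Set ℝ) (c : ℝ) (K : E' →L[ℂ] E') :
    MourreInequality (F.conjStarAlgEquiv H) A' I c K ↔
      MourreInequality H A I c (F.symm.conjStarAlgEquiv K) := by
  have hK : K = F.conjStarAlgEquiv (F.symm.conjStarAlgEquiv K) := by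
    rw [← LinearIsometryEquiv.symm_conjStarAlgEquiv, StarAlgEquiv.apply_symm_apply]
  unfold MourreInequality
  rw [spectralProjection_conj F hH, hC, ← conjStarAlgEquiv_le_iff F, map_add, map_smul, ← hK]
  simp only [← ContinuousLinearMap.mul_def, map_mul]

end Transport

/-! ### The conjugate operator on the lattice -/

section Lattice

open Filter Topology

/-- The function `|n|² = n₁² + n₂²` in lattice coordinates. -/
def normSq (n : Fin 2 → ℤ) : ℝ := (n 0 : ℝ) ^ 2 + (n 1 : ℝ) ^ 2

theorem normSq_nonneg (n : Fin 2 → ℤ) : 0 ≤ normSq n := by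
  unfold normSq; positivity

theorem normSq_neg (n : Fin 2 → ℤ) : normSq (-n) = normSq n := by
  simp [normSq]

theorem normSq_step_le (i : Fin 3) : normSq (step i) ≤ 2 := by
  fin_cases i <;> norm_num [step, normSq]

/-- From |n|² ≤ 2|n + v|² + 2|v|². All six steps have |v|² ≤ 2, with equality for ±(1, -1). -/
theorem normSq_le_of_step {v : Fin 2 → ℤ} (hv : normSq v ≤ 2) (n : Fin 2 → ℤ) :
    normSq n ≤ 2 * normSq (n + v) + 4 := by
  simp only [normSq, Pi.add_apply, Int.cast_add] at *
  nlinarith [sq_nonneg ((n 0 : ℝ) + 2 * v 0), sq_nonneg ((n 1 : ℝ) + 2 * v 1)]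

theorem normSq_add_le_of_step {v : Fin 2 → ℤ} (hv : normSq v ≤ 2) (n : Fin 2 → ℤ) :
    normSq (n + v) ≤ 2 * normSq n + 4 := by
  have := normSq_le_of_step (v := -v) (by rwa [normSq_neg]) (n + v)
  simpa using this

/-- The increment is ⟨v, 2n + v⟩: apply Cauchy–Schwarz and the parallelogram bound for n + (n + v).
That its square is only linear in |n|² is the reason why the commutator with the weight is
controlled by the weight. -/
theorem sq_normSq_sub_le {v : Fin 2 → ℤ} (hv : normSq v ≤ 2) (n : Fin 2 → ℤ) :
    (normSq (n + v) - normSq n) ^ 2 ≤ 4 * (normSq n + normSq (n + v)) := by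
  have h1 : (normSq (n + v) - normSq n) ^ 2 ≤
      normSq v * ((2 * (n 0 : ℝ) + v 0) ^ 2 + (2 * (n 1 : ℝ) + v 1) ^ 2) := by
    simp only [normSq, Pi.add_apply, Int.cast_add]
    nlinarith [sq_nonneg ((v 0 : ℝ) * (2 * n 1 + v 1) - v 1 * (2 * n 0 + v 0))]
  have h2 : (2 * (n 0 : ℝ) + v 0) ^ 2 + (2 * (n 1 : ℝ) + v 1) ^ 2 ≤
      2 * (normSq n + normSq (n + v)) := by
    simp only [normSq, Pi.add_apply, Int.cast_add]
    nlinarith [sq_nonneg (v 0 : ℝ), sq_nonneg (v 1 : ℝ)]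
  have h3 : 0 ≤ (2 * (n 0 : ℝ) + v 0) ^ 2 + (2 * (n 1 : ℝ) + v 1) ^ 2 := by positivity
  nlinarith [mul_le_mul_of_nonneg_right hv h3]

/-! ### The truncated weight and its increments -/

/-- The truncation `min (|n|², N)`. -/
def truncSq (N : ℕ) (n : Fin 2 → ℤ) : ℝ := min (normSq n) N

theorem truncSq_nonneg (N : ℕ) (n : Fin 2 → ℤ) : 0 ≤ truncSq N n :=
  le_min (normSq_nonneg n) (Nat.cast_nonneg N)

theorem truncSq_of_le {N : ℕ} {n : Fin 2 → ℤ} (h : normSq n ≤ N) : truncSq N n = normSq n :=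
  min_eq_left h

theorem truncSq_of_ge {N : ℕ} {n : Fin 2 → ℤ} (h : (N : ℝ) ≤ normSq n) : truncSq N n = N :=
  min_eq_right h

/-- Truncation does not enlarge increments, so the bound for |n|² survives uniformly in `N`; the
right side uses the truncated weight at the neighbour, as needed for Schur's test. -/
theorem sq_truncSq_sub_le {v : Fin 2 → ℤ} (hv : normSq v ≤ 2) (N : ℕ) (n : Fin 2 → ℤ) :
    (truncSq N (n + v) - truncSq N n) ^ 2 ≤ 16 * (1 + truncSq N (n + v)) := by
  have h1 := sq_normSq_sub_le hv n
  have h2 := normSq_le_of_step hv n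
  have h3 := normSq_add_le_of_step hv n
  have hn := normSq_nonneg n
  have hnv := normSq_nonneg (n + v)
  rcases le_total (normSq n) N with ha | ha <;> rcases le_total (normSq (n + v)) N with hb | hb
  · rw [truncSq_of_le ha, truncSq_of_le hb]; linarith
  · rw [truncSq_of_le ha, truncSq_of_ge hb]
    have : ((N : ℝ) - normSq n) ^ 2 ≤ (normSq (n + v) - normSq n) ^ 2 :=
      pow_le_pow_left₀ (by linarith) (by linarith) 2
    linarith
  · rw [truncSq_of_ge ha, truncSq_of_le hb]
    have : (normSq (n + v) - N) ^ 2 ≤ (normSq (n + v) - normSq n) ^ 2 := by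
      rw [← neg_sq, ← neg_sq (_ - normSq n)]
      exact pow_le_pow_left₀ (by linarith) (by linarith) 2
    linarith
  · rw [truncSq_of_ge ha, truncSq_of_ge hb, sub_self]
    have : (0 : ℝ) ≤ N := Nat.cast_nonneg N
    nlinarith

/-- Both ends of the edge then lie in the region where the truncation equals `N`, so A_N does not
couple them. -/
theorem truncSq_eq_of_gt {v : Fin 2 → ℤ} (hv : normSq v ≤ 2) {N : ℕ} {n : Fin 2 → ℤ}
    (h : 2 * (N : ℝ) + 4 < normSq n) : truncSq N (n + v) = truncSq N n := by
  have h2 := normSq_le_of_step hv n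
  rw [truncSq_of_ge, truncSq_of_ge] <;> linarith [Nat.cast_nonneg (α := ℝ) N]

/-- The two increments differ only on edges with an end beyond |n|² = N. There the increment is of
order the square root of the weight, and the weight is at least of order N, which gains N^{-1/2}.
The hypothesis `h` keeps |n + v|² comparable with its truncation. -/
theorem abs_truncSq_sub_sub_le {v : Fin 2 → ℤ} (hv : normSq v ≤ 2) {M N : ℕ} (hMN : N ≤ M)
    {n : Fin 2 → ℤ} (h : normSq (n + v) ≤ 2 * N + 4) :
    |(truncSq M (n + v) - truncSq M n) - (truncSq N (n + v) - truncSq N n)| ≤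
      41 / √((N : ℝ) + 1) * (1 + truncSq N (n + v)) := by
  have h2 := normSq_le_of_step hv n
  have h3 := normSq_add_le_of_step hv n
  have hMN' : (N : ℝ) ≤ M := by exact_mod_cast hMN
  have hN0 : (0 : ℝ) ≤ N := Nat.cast_nonneg N
  have hnv := normSq_nonneg (n + v)
  have hn := normSq_nonneg n
  have hrhs : 0 ≤ 41 / √((N : ℝ) + 1) * (1 + truncSq N (n + v)) := by
    have := truncSq_nonneg N (n + v); positivity
  by_cases hs : normSq n ≤ N ∧ normSq (n + v) ≤ N
  · rw [truncSq_of_le hs.1, truncSq_of_le hs.2, truncSq_of_le (hs.1.trans hMN'),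
      truncSq_of_le (hs.2.trans hMN'), sub_self, abs_zero, ← truncSq_of_le hs.2]
    exact hrhs
  have hbig : (N : ℝ) < normSq n ∨ (N : ℝ) < normSq (n + v) := by
    by_contra! hc
    exact hs hc
  have hge : (N : ℝ) ≤ 2 * normSq (n + v) + 4 := by rcases hbig with hb | hb <;> linarith
  have h1 : |(truncSq M (n + v) - truncSq M n) - (truncSq N (n + v) - truncSq N n)| ≤
      |normSq (n + v) - normSq n| := by
    -- For N ≤ M the function min(·, M) - min(·, N) is nondecreasing and 1-Lipschitz.
    have hlip : ∀ x y : ℝ, x ≤ y → 0 ≤ (min y M - min x M) - (min y N - min x N) ∧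
        (min y M - min x M) - (min y N - min x N) ≤ y - x := by
      intro x y hxy
      rcases le_total x N with h1 | h1 <;> rcases le_total y N with h2 | h2 <;>
      rcases le_total x M with h3 | h3 <;> rcases le_total y M with h4 | h4 <;>
      simp only [min_eq_left h1, min_eq_left h2, min_eq_left h3, min_eq_left h4, min_eq_right h1,
        min_eq_right h2, min_eq_right h3, min_eq_right h4] <;>
      constructor <;> linarith
    unfold truncSq
    rcases le_total (normSq n) (normSq (n + v)) with hle | hle
    · obtain ⟨ha, hb⟩ := hlip _ _ hle
      rw [abs_of_nonneg ha, abs_of_nonneg (by linarith)]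
      exact hb
    · obtain ⟨ha, hb⟩ := hlip _ _ hle
      rw [abs_sub_comm (normSq (n + v)), abs_of_nonneg (sub_nonneg.2 hle), abs_le]
      constructor <;> linarith
  refine h1.trans (abs_le_of_sq_le_sq ?_ hrhs)
  set l : ℝ := 1 + truncSq N (n + v) with hl
  have hl1 : 1 ≤ l := by have := truncSq_nonneg N (n + v); linarith
  have hl2 : (N : ℝ) + 1 ≤ 8 * l := by
    rcases le_total (normSq (n + v)) N with hb | hb
    · rw [hl, truncSq_of_le hb]; linarith
    · rw [hl, truncSq_of_ge hb]; linarith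
  have hl3 : 1 + normSq (n + v) ≤ 13 * l := by
    rcases le_total (normSq (n + v)) N with hb | hb
    · rw [hl, truncSq_of_le hb]; linarith
    · rw [hl, truncSq_of_ge hb]; linarith
  rw [mul_pow, div_pow, Real.sq_sqrt (by positivity), div_mul_eq_mul_div,
    le_div_iff₀ (by positivity)]
  have h4 : (normSq (n + v) - normSq n) ^ 2 ≤ 208 * l := by
    have := sq_normSq_sub_le hv n
    linarith
  -- Here 208 · 8 = 1664 ≤ 1681 = 41², which is the origin of 41.
  calc _ ≤ (208 * l) * (8 * l) := by gcongr
    _ ≤ _ := by nlinarith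

/-! #### Operators on `ℓ²(ℤ²)` -/

theorem memℓp_diagonal {c : (Fin 2 → ℤ) → ℝ} {C : ℝ} (hc : ∀ n, |c n| ≤ C) (f : Ell2) :
    Memℓp (fun n => (c n : ℂ) * f n) 2 := by
  have h := (memℓp_gen_iff (p := 2) (by simp)).1 (lp.memℓp f)
  refine (memℓp_gen_iff (p := 2) (by simp)).2 ?_
  refine (h.mul_left (C ^ 2)).of_nonneg_of_le (fun n => by positivity) fun n => ?_
  simp only [ENNReal.toReal_ofNat, Real.rpow_ofNat, norm_mul, Complex.norm_real, mul_pow,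
    Real.norm_eq_abs]
  gcongr
  exact hc n

theorem norm_le_mul_norm {f g : Ell2} {C : ℝ} (hC : 0 ≤ C) (h : ∀ n, ‖g n‖ ≤ C * ‖f n‖) :
    ‖g‖ ≤ C * ‖f‖ := by
  have := lp.norm_mono (p := 2) (by simp) (x := g) (y := (C : ℂ) • f) (fun n => by
    rw [lp.coeFn_smul, Pi.smul_apply, norm_smul, Complex.norm_real, Real.norm_of_nonneg hC]
    exact h n)
  rwa [lp.norm_const_smul (by simp), Complex.norm_real, Real.norm_of_nonneg hC] at this

/-- Multiplication by a bounded real function on `ℓ²(ℤ²)`. -/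
def diagonal (c : (Fin 2 → ℤ) → ℝ) (C : ℝ) (hc : ∀ n, |c n| ≤ C) : Ell2 →L[ℂ] Ell2 :=
  LinearMap.mkContinuous
    { toFun := fun f => ⟨fun n => (c n : ℂ) * f n, memℓp_diagonal hc f⟩
      map_add' := fun f g => lp.ext (funext fun n => mul_add _ _ _)
      map_smul' := fun a f => lp.ext (funext fun n => mul_left_comm _ _ _) } C fun f =>
    norm_le_mul_norm ((abs_nonneg _).trans (hc 0)) fun n => by
      simp only [LinearMap.coe_mk, AddHom.coe_mk, norm_mul, Complex.norm_real, Real.norm_eq_abs]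
      exact mul_le_mul_of_nonneg_right (hc n) (norm_nonneg _)

theorem diagonal_apply {c : (Fin 2 → ℤ) → ℝ} {C : ℝ} (hc : ∀ n, |c n| ≤ C) (f : Ell2)
    (n : Fin 2 → ℤ) : diagonal c C hc f n = (c n : ℂ) * f n := rfl

theorem isSelfAdjoint_diagonal {c : (Fin 2 → ℤ) → ℝ} {C : ℝ} (hc : ∀ n, |c n| ≤ C) :
    IsSelfAdjoint (diagonal c C hc) := by
  rw [ContinuousLinearMap.isSelfAdjoint_iff_isSymmetric]
  intro f g
  simp only [ContinuousLinearMap.coe_coe, lp.inner_eq_tsum, diagonal_apply]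
  refine tsum_congr fun n => ?_
  simp only [RCLike.inner_apply, map_mul, Complex.conj_ofReal]
  ring

theorem shift_apply (v : Fin 2 → ℤ) (f : Ell2) (n : Fin 2 → ℤ) : shift v f n = f (n + v) := rfl

theorem norm_shift (v : Fin 2 → ℤ) (f : Ell2) : ‖shift v f‖ = ‖f‖ := by
  rw [lp.norm_eq_tsum_rpow (by simp), lp.norm_eq_tsum_rpow (by simp)]
  congr 1
  exact (Equiv.addRight v).tsum_eq (fun n => ‖f n‖ ^ (2 : ENNReal).toReal)

theorem adjoint_shift (v : Fin 2 → ℤ) : star (shift v) = shift (-v) := by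
  rw [ContinuousLinearMap.star_eq_adjoint, eq_comm, ContinuousLinearMap.eq_adjoint_iff]
  intro f g
  simp only [lp.inner_eq_tsum, shift_apply]
  rw [← (Equiv.addRight v).tsum_eq]
  simp

theorem isSelfAdjoint_laplacian : IsSelfAdjoint laplacian := by
  rw [IsSelfAdjoint, laplacian, star_smul, star_sum]
  simp only [star_add, adjoint_shift, neg_neg]
  congr 1
  · simp
  · exact Finset.sum_congr rfl fun i _ => add_comm _ _

theorem laplacian_apply (f : Ell2) (n : Fin 2 → ℤ) :
    laplacian f n = (1 / 6 : ℂ) * ∑ i : Fin 3, (f (n + step i) + f (n + -step i)) := by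
  simp only [laplacian, Fin.sum_univ_three, smul_apply, add_apply, lp.coeFn_smul, lp.coeFn_add,
    Pi.smul_apply, Pi.add_apply, shift_apply, smul_eq_mul]

theorem norm_laplacian_apply_le (f : Ell2) : ‖laplacian f‖ ≤ ‖f‖ := by
  have h : ∀ i, ‖shift (step i) f + shift (-step i) f‖ ≤ 2 * ‖f‖ := fun i => by
    refine (norm_add_le _ _).trans ?_
    rw [norm_shift, norm_shift]
    linarith
  have h1 := norm_sum_le_of_le (Finset.univ : Finset (Fin 3)) fun i _ => h i
  simp only [Finset.sum_const, Finset.card_univ, Fintype.card_fin, nsmul_eq_mul] at h1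
  rw [laplacian, smul_apply, norm_smul]
  simp only [sum_apply, add_apply]
  norm_num at h1 ⊢
  linarith

theorem memℓp_norm (f : Ell2) : Memℓp (fun n => ((‖f n‖ : ℝ) : ℂ)) 2 := by
  have h := (memℓp_gen_iff (p := 2) (by simp)).1 (lp.memℓp f)
  refine (memℓp_gen_iff (p := 2) (by simp)).2 ?_
  simpa using h

/-- Schur's test for operators that only couple neighbours. -/
theorem norm_le_of_le_sum_neighbours {f g : Ell2} {C : ℝ} (hC : 0 ≤ C)
    (h : ∀ n, ‖g n‖ ≤ C * ∑ i : Fin 3, (‖f (n + step i)‖ + ‖f (n + -step i)‖)) :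
    ‖g‖ ≤ 6 * C * ‖f‖ := by
  -- With f' = |f|, the hypothesis reads |g| ≤ 6C Δ_T f' pointwise, and Δ_T has norm at most 1.
  let f' : Ell2 := ⟨fun n => ((‖f n‖ : ℝ) : ℂ), memℓp_norm f⟩
  have hf' : ∀ n, f' n = ((‖f n‖ : ℝ) : ℂ) := fun _ => rfl
  have h1 : ‖f'‖ ≤ 1 * ‖f‖ := norm_le_mul_norm zero_le_one fun n => by simp [hf']
  have h2 : ‖g‖ ≤ 6 * C * ‖laplacian f'‖ := norm_le_mul_norm (by positivity) fun n => by
    have h3 : laplacian f' n =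
        ((1 / 6 * ∑ i : Fin 3, (‖f (n + step i)‖ + ‖f (n + -step i)‖) : ℝ) : ℂ) := by
      rw [laplacian_apply]
      push_cast
      rfl
    rw [h3, Complex.norm_real, Real.norm_of_nonneg (by positivity)]
    exact (h n).trans (le_of_eq (by ring))
  calc ‖g‖ ≤ 6 * C * ‖laplacian f'‖ := h2
    _ ≤ 6 * C * ‖f'‖ := by gcongr; exact norm_laplacian_apply_le f'
    _ ≤ 6 * C * ‖f‖ := by gcongr; linarith

end Lattice

/-! ### Self-adjointness of the conjugate operator on the lattice -/

section Lattice

open Filter Topology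

theorem abs_truncSq_le (N : ℕ) (n : Fin 2 → ℤ) : |truncSq N n| ≤ N := by
  rw [abs_of_nonneg (truncSq_nonneg N n)]
  exact min_le_right _ _

theorem abs_one_add_truncSq_le (N : ℕ) (n : Fin 2 → ℤ) : |1 + truncSq N n| ≤ 1 + N := by
  have := truncSq_nonneg N n
  rw [abs_of_nonneg (by linarith)]
  linarith [min_le_right (normSq n) (N : ℝ), show truncSq N n = min (normSq n) N from rfl]

/-- The weight `1 + min (|n|², N)`. -/
def weight (N : ℕ) : Ell2 →L[ℂ] Ell2 :=
  diagonal (fun n => 1 + truncSq N n) (1 + N) (abs_one_add_truncSq_le N)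

theorem weight_apply (N : ℕ) (f : Ell2) (n : Fin 2 → ℤ) :
    weight N f n = ((1 + truncSq N n : ℝ) : ℂ) * f n := rfl

open Classical in
/-- The projection onto the functions supported in `{|n|² ≤ R}`. -/
def cutoff (R : ℝ) : Ell2 →L[ℂ] Ell2 :=
  diagonal (fun n => if normSq n ≤ R then 1 else 0) 1 fun n => by split_ifs <;> simp

open Classical in
theorem cutoff_apply (R : ℝ) (f : Ell2) (n : Fin 2 → ℤ) :
    cutoff R f n = if normSq n ≤ R then f n else 0 := by
  rw [cutoff, diagonal_apply]
  split_ifs <;> simp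

theorem cutoff_eq_self_iff {R : ℝ} {f : Ell2} :
    cutoff R f = f ↔ ∀ n, R < normSq n → f n = 0 := by
  constructor
  · intro h n hn
    rw [← h, cutoff_apply, if_neg (not_le.2 hn)]
  · intro h
    refine lp.ext (funext fun n => ?_)
    rw [cutoff_apply]
    split_ifs with hn
    · rfl
    · exact (h n (not_le.1 hn)).symm

/-- The bounded approximation `(i/2) [Δ_T, min (|Q|², N)]` of the conjugate operator. -/
def truncOp (N : ℕ) : Ell2 →L[ℂ] Ell2 :=
  (Complex.I / 2) • (laplacian * diagonal (truncSq N) N (abs_truncSq_le N) -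
    diagonal (truncSq N) N (abs_truncSq_le N) * laplacian)

theorem isSelfAdjoint_truncOp (N : ℕ) : IsSelfAdjoint (truncOp N) := by
  rw [IsSelfAdjoint, truncOp, star_smul, star_sub, star_mul, star_mul,
    isSelfAdjoint_laplacian.star_eq, (isSelfAdjoint_diagonal _).star_eq, ← neg_sub, smul_neg,
    ← neg_smul]
  congr 1
  simp [neg_div]

/-- The matrix form `(i/12) ∑ᵢ (a(n + vᵢ) - a(n)) f(n + vᵢ) + (a(n - vᵢ) - a(n)) f(n - vᵢ)` of the
operator `(i/2) [Δ_T, a(Q)]`. -/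
def commutatorExpr (a : (Fin 2 → ℤ) → ℝ) (f : (Fin 2 → ℤ) → ℂ) (n : Fin 2 → ℤ) : ℂ :=
  (Complex.I / 12) * ∑ i : Fin 3, (((a (n + step i) - a n : ℝ) : ℂ) * f (n + step i) +
    ((a (n + -step i) - a n : ℝ) : ℂ) * f (n + -step i))

theorem truncOp_apply (N : ℕ) (f : Ell2) (n : Fin 2 → ℤ) :
    truncOp N f n = commutatorExpr (truncSq N) f n := by
  simp only [truncOp, smul_apply, sub_apply, mul_apply_eq_comp, lp.coeFn_smul,
    lp.coeFn_sub, Pi.smul_apply, Pi.sub_apply, laplacian_apply, diagonal_apply, smul_eq_mul,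
    commutatorExpr, Fin.sum_univ_three]
  push_cast
  ring

/-- The structural identity A = (i/2)[Δ_T, |Q|²]: along each step v the coefficient of f(n + v) is
(i/12)(|n + v|² - |n|²). -/
theorem conjugateExpr_apply (f : (Fin 2 → ℤ) → ℂ) (n : Fin 2 → ℤ) :
    conjugateExpr f n = commutatorExpr normSq f n := by
  have e1 : (![-1, 0] : Fin 2 → ℤ) = -step 0 := by ext j; fin_cases j <;> simp [step]
  have e2 : (![0, -1] : Fin 2 → ℤ) = -step 1 := by ext j; fin_cases j <;> simp [step]
  have e3 : (![-1, 1] : Fin 2 → ℤ) = -step 2 := by ext j; fin_cases j <;> simp [step]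
  have e4 : (![1, 0] : Fin 2 → ℤ) = step 0 := rfl
  have e5 : (![0, 1] : Fin 2 → ℤ) = step 1 := rfl
  have e6 : (![1, -1] : Fin 2 → ℤ) = step 2 := rfl
  simp only [conjugateExpr, difference, position, translate, e1, e2, e3, e4, e5, e6,
    Fin.sum_univ_two, Fin.sum_univ_three, commutatorExpr, LinearMap.smul_apply,
    LinearMap.add_apply, LinearMap.sub_apply, LinearMap.comp_apply, LinearMap.coe_mk,
    AddHom.coe_mk, Pi.smul_apply, Pi.add_apply, Pi.sub_apply, smul_eq_mul, Matrix.cons_val_zero,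
    Matrix.cons_val_one, Pi.neg_apply, normSq]
  simp only [step, Matrix.cons_val_zero, Matrix.cons_val_one, Matrix.cons_val]
  push_cast
  ring

theorem commutatorExpr_congr {a b : (Fin 2 → ℤ) → ℝ} {f : (Fin 2 → ℤ) → ℂ} {n : Fin 2 → ℤ}
    (h : ∀ v, normSq v ≤ 2 → f (n + v) ≠ 0 → a (n + v) - a n = b (n + v) - b n) :
    commutatorExpr a f n = commutatorExpr b f n := by
  have h' : ∀ v, normSq v ≤ 2 → ((a (n + v) - a n : ℝ) : ℂ) * f (n + v) =
      ((b (n + v) - b n : ℝ) : ℂ) * f (n + v) := fun v hv => by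
    by_cases hf : f (n + v) = 0
    · simp [hf]
    · rw [h v hv hf]
  unfold commutatorExpr
  congr 1
  exact Finset.sum_congr rfl fun i _ => by
    rw [h' _ (normSq_step_le i), h' _ (by rw [normSq_neg]; exact normSq_step_le i)]

theorem norm_sum_neighbours_le (a b c : (Fin 2 → ℤ) → ℂ) (C : ℝ) (n : Fin 2 → ℤ)
    (h : ∀ v, normSq v ≤ 2 → ‖a (n + v) * b (n + v)‖ ≤ C * ‖c (n + v)‖) :
    ‖(Complex.I / 12) * ∑ i : Fin 3, (a (n + step i) * b (n + step i) +
      a (n + -step i) * b (n + -step i))‖ ≤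
      C / 12 * ∑ i : Fin 3, (‖c (n + step i)‖ + ‖c (n + -step i)‖) := by
  have h1 : ‖∑ i : Fin 3, (a (n + step i) * b (n + step i) +
      a (n + -step i) * b (n + -step i))‖ ≤
      ∑ i : Fin 3, (C * ‖c (n + step i)‖ + C * ‖c (n + -step i)‖) :=
    norm_sum_le_of_le _ fun i _ => (norm_add_le _ _).trans (add_le_add
      (h _ (normSq_step_le i)) (h _ (by rw [normSq_neg]; exact normSq_step_le i)))
  rw [norm_mul]
  have h2 : ‖Complex.I / 12‖ = 1 / 12 := by simp
  rw [h2]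
  simp only [← mul_add, ← Finset.mul_sum] at h1
  calc _ ≤ 1 / 12 * (C * ∑ i : Fin 3, (‖c (n + step i)‖ + ‖c (n + -step i)‖)) := by gcongr
    _ = _ := by ring

/-- A double commutator: bracketing with the weight once more squares the increments, which
`sq_truncSq_sub_le` bounds by 16 times the weight. The constant is 8 = 6 · 16/12 and does not depend
on `N`. -/
theorem norm_weight_truncOp_sub_le (N : ℕ) (f : Ell2) :
    ‖weight N (truncOp N f) - truncOp N (weight N f)‖ ≤ 8 * ‖weight N f‖ := by
  have h := norm_le_of_le_sum_neighbours (f := weight N f)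
    (g := weight N (truncOp N f) - truncOp N (weight N f)) (C := 16 / 12) (by norm_num) fun n => by
    have h1 : (weight N (truncOp N f) - truncOp N (weight N f)) n =
        (Complex.I / 12) * ∑ i : Fin 3,
          ((-(truncSq N (n + step i) - truncSq N n) ^ 2 : ℂ) * f (n + step i) +
            (-(truncSq N (n + -step i) - truncSq N n) ^ 2 : ℂ) * f (n + -step i)) := by
      simp only [lp.coeFn_sub, Pi.sub_apply, weight_apply, truncOp_apply, commutatorExpr,
        Fin.sum_univ_three]
      push_cast
      ring
    rw [h1]
    refine norm_sum_neighbours_le (fun m => (-(truncSq N m - truncSq N n) ^ 2 : ℂ)) f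
      (weight N f) 16 n fun v hv => ?_
    have h2 := sq_truncSq_sub_le hv N n
    have h3 := truncSq_nonneg N (n + v)
    rw [weight_apply, norm_mul, norm_mul, norm_neg, ← mul_assoc, Complex.norm_real,
      Real.norm_of_nonneg (by positivity), ← Complex.ofReal_sub, ← Complex.ofReal_pow,
      Complex.norm_real, Real.norm_of_nonneg (by positivity)]
    exact mul_le_mul_of_nonneg_right h2 (norm_nonneg _)
  linarith

theorem norm_truncOp_sub_le {M N : ℕ} (hMN : N ≤ M) {f : Ell2} (hf : cutoff (2 * N + 4) f = f) :
    ‖truncOp M f - truncOp N f‖ ≤ 41 / √((N : ℝ) + 1) * ‖weight N f‖ := by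
  rw [cutoff_eq_self_iff] at hf
  set ε := 41 / √((N : ℝ) + 1) with hε
  have hε0 : 0 ≤ ε := by positivity
  have h := norm_le_of_le_sum_neighbours (f := weight N f)
    (g := truncOp M f - truncOp N f) (C := ε / 12) (by positivity) fun n => by
    have h1 : (truncOp M f - truncOp N f) n =
        (Complex.I / 12) * ∑ i : Fin 3,
          ((((truncSq M (n + step i) - truncSq M n) -
            (truncSq N (n + step i) - truncSq N n) : ℝ) : ℂ) * f (n + step i) +
            (((truncSq M (n + -step i) - truncSq M n) -
            (truncSq N (n + -step i) - truncSq N n) : ℝ) : ℂ) * f (n + -step i)) := by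
      simp only [lp.coeFn_sub, Pi.sub_apply, truncOp_apply, commutatorExpr, Fin.sum_univ_three]
      push_cast
      ring
    rw [h1]
    refine norm_sum_neighbours_le (fun m => (((truncSq M m - truncSq M n) -
            (truncSq N m - truncSq N n) : ℝ) : ℂ)) f (weight N f) ε n fun v hv => ?_
    have h3 := truncSq_nonneg N (n + v)
    rcases le_or_gt (normSq (n + v)) (2 * N + 4) with h4 | h4
    · rw [weight_apply, norm_mul, norm_mul, ← mul_assoc, Complex.norm_real, Complex.norm_real,
        Real.norm_of_nonneg (by positivity : (0 : ℝ) ≤ 1 + truncSq N (n + v))]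
      exact mul_le_mul_of_nonneg_right (abs_truncSq_sub_sub_le hv hMN h4) (norm_nonneg _)
    · rw [hf _ h4, mul_zero, norm_zero]
      positivity
  have h2 : 6 * (ε / 12) * ‖weight N f‖ ≤ ε * ‖weight N f‖ := by
    refine mul_le_mul_of_nonneg_right ?_ (norm_nonneg _)
    linarith
  exact h.trans h2

/-- No edge with an end outside {|n|² ≤ 2N + 4} contributes to A_N: its values vanish outside and it
ignores the values of f there. The orbits under exp(isA_N) of functions supported in this region
therefore stay in it. -/
theorem commute_cutoff_truncOp (N : ℕ) : Commute (cutoff (2 * N + 4)) (truncOp N) := by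
  have h1 : ∀ f, cutoff (2 * N + 4) (truncOp N f) = truncOp N f := fun f => by
    rw [cutoff_eq_self_iff]
    intro n hn
    rw [truncOp_apply, commutatorExpr_congr (b := fun _ => 0) fun v hv _ => by
      rw [truncSq_eq_of_gt hv hn, sub_self, sub_self]]
    simp [commutatorExpr]
  have h2 : ∀ f, truncOp N (cutoff (2 * N + 4) f) = truncOp N f := by
    intro f
    refine lp.ext (funext fun n => ?_)
    rw [truncOp_apply, truncOp_apply]
    have h3 : ∀ v, normSq v ≤ 2 →
        ((truncSq N (n + v) - truncSq N n : ℝ) : ℂ) * cutoff (2 * N + 4) f (n + v) =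
          ((truncSq N (n + v) - truncSq N n : ℝ) : ℂ) * f (n + v) := fun v hv => by
      rw [cutoff_apply]
      split_ifs with h4
      · rfl
      · have h5 := truncSq_eq_of_gt (v := -v) (by rwa [normSq_neg]) (not_le.1 h4)
        rw [add_neg_cancel_right] at h5
        rw [h5]; simp
    unfold commutatorExpr
    congr 1
    exact Finset.sum_congr rfl fun i _ => by
      rw [h3 _ (normSq_step_le i), h3 _ (by rw [normSq_neg]; exact normSq_step_le i)]
  ext1 f
  exact (h1 f).trans (h2 f).symm

theorem truncOp_apply_eq_conjugateExpr {N : ℕ} {n : Fin 2 → ℤ} (h : 2 * normSq n + 4 ≤ N)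
    (f : Ell2) : truncOp N f n = conjugateExpr f n := by
  rw [truncOp_apply, conjugateExpr_apply]
  refine commutatorExpr_congr fun v hv _ => ?_
  have := normSq_nonneg n
  rw [truncSq_of_le ((normSq_add_le_of_step hv n).trans h), truncSq_of_le (by linarith)]

/-- Neighbours of {|n|² ≤ 2K + 4} satisfy |n|² ≤ 2(2K + 4) + 4 = 4K + 12, so truncation above this
level is invisible to f. -/
theorem truncOp_eq_truncOp {K M N : ℕ} {f : Ell2} (hf : cutoff (2 * K + 4) f = f)
    (hM : 4 * K + 12 ≤ M) (hN : 4 * K + 12 ≤ N) : truncOp M f = truncOp N f := by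
  rw [cutoff_eq_self_iff] at hf
  have hM' : 4 * (K : ℝ) + 12 ≤ M := by exact_mod_cast hM
  have hN' : 4 * (K : ℝ) + 12 ≤ N := by exact_mod_cast hN
  refine lp.ext (funext fun n => ?_)
  rw [truncOp_apply, truncOp_apply]
  refine commutatorExpr_congr fun v hv hne => ?_
  have h1 : normSq (n + v) ≤ 2 * K + 4 := not_lt.1 fun h => hne (hf _ h)
  have h2 := normSq_le_of_step hv n
  have h3 : (0 : ℝ) ≤ K := Nat.cast_nonneg K
  rw [truncSq_of_le, truncSq_of_le, truncSq_of_le, truncSq_of_le] <;> linarith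

/-! ### The core of finitely supported functions and essential self-adjointness -/

/-- The graph of the conjugate operator on finitely supported functions. -/
def finiteGraph : Submodule ℂ (Ell2 × Ell2) where
  carrier := {p | ∃ K : ℕ, ∀ N ≥ K, cutoff (2 * N + 4) p.1 = p.1 ∧ truncOp N p.1 = p.2}
  zero_mem' := ⟨0, fun N _ => by simp⟩
  add_mem' := by
    rintro p q ⟨K, hK⟩ ⟨L, hL⟩
    refine ⟨max K L, fun N hN => ?_⟩
    have h1 := hK N (le_of_max_le_left hN)
    have h2 := hL N (le_of_max_le_right hN)
    rw [Prod.fst_add, Prod.snd_add, map_add, map_add, h1.1, h1.2, h2.1, h2.2]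
    exact ⟨rfl, rfl⟩
  smul_mem' := by
    rintro c p ⟨K, hK⟩
    refine ⟨K, fun N hN => ?_⟩
    rw [Prod.smul_fst, Prod.smul_snd, map_smul, map_smul, (hK N hN).1, (hK N hN).2]
    exact ⟨rfl, rfl⟩

theorem exists_mem_finiteGraph {K : ℕ} {f : Ell2} (hf : cutoff (2 * K + 4) f = f) :
    ∃ g, (f, g) ∈ finiteGraph := by
  refine ⟨truncOp (4 * K + 12) f, 4 * K + 12, fun N hN => ⟨?_, truncOp_eq_truncOp hf hN le_rfl⟩⟩
  rw [cutoff_eq_self_iff] at *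
  have hN' : 4 * (K : ℝ) + 12 ≤ N := by exact_mod_cast hN
  intro n hn
  exact hf n (by linarith [Nat.cast_nonneg (α := ℝ) K])

theorem conjugateExpr_of_mem_finiteGraph {f g : Ell2} (h : (f, g) ∈ finiteGraph)
    (n : Fin 2 → ℤ) : conjugateExpr f n = g n := by
  obtain ⟨K, hK⟩ := h
  obtain ⟨L, hL⟩ := exists_nat_ge (2 * normSq n + 4)
  have hg : truncOp (max K L) f = g := (hK (max K L) (le_max_left _ _)).2
  rw [← hg, truncOp_apply_eq_conjugateExpr]
  exact hL.trans (by exact_mod_cast le_max_right _ _)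

theorem single_mem_finiteGraph (n : Fin 2 → ℤ) (a : ℂ) :
    ∃ g, (lp.single 2 n a, g) ∈ finiteGraph := by
  obtain ⟨K, hK⟩ := exists_nat_ge (normSq n)
  refine exists_mem_finiteGraph (K := K) (cutoff_eq_self_iff.2 fun m hm => ?_)
  rw [lp.single_apply_ne]
  rintro rfl
  linarith [Nat.cast_nonneg (α := ℝ) K]

theorem dense_finiteGraph : Dense (Prod.fst '' (finiteGraph : Set (Ell2 × Ell2))) := by
  intro f
  have h := lp.hasSum_single (p := 2) (by simp) f
  refine mem_closure_of_tendsto h (Eventually.of_forall fun s => ?_)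
  have h1 : ∑ n ∈ s, (lp.single 2 n (f n) : Ell2) ∈
      finiteGraph.map (LinearMap.fst ℂ Ell2 Ell2) := by
    refine Submodule.sum_mem _ fun n _ => ?_
    obtain ⟨g, hg⟩ := single_mem_finiteGraph n (f n)
    exact ⟨_, hg, rfl⟩
  exact h1

theorem norm_weight_le {R : ℝ} (hR : 0 ≤ R) {f : Ell2} (hf : cutoff R f = f) (N : ℕ) :
    ‖weight N f‖ ≤ (1 + R) * ‖f‖ := by
  rw [cutoff_eq_self_iff] at hf
  refine norm_le_mul_norm (by positivity) fun n => ?_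
  have h0 := truncSq_nonneg N n
  rw [weight_apply, norm_mul, Complex.norm_real, Real.norm_of_nonneg (by positivity)]
  rcases le_or_gt (normSq n) R with h | h
  · have : truncSq N n ≤ R := (min_le_left _ _).trans h
    gcongr
  · simp [hf n h]

/-- The restriction of the conjugate operator to finitely supported functions is essentially
self-adjoint. -/
theorem exists_conjugateGroup : ∃ U : ℝ → Ell2 ≃ₗᵢ[ℂ] Ell2,
    IsUnitaryGroup U ∧ generatorGraph U = finiteGraph.topologicalClosure := by
  refine exists_isUnitaryGroup_of_approx isSelfAdjoint_truncOp dense_finiteGraph ?_ ?_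
  · rintro ⟨f, g⟩ ⟨K, hK⟩
    exact tendsto_const_nhds.congr' ((eventually_ge_atTop K).mono fun N hN => (hK N hN).2.symm)
  · rintro ⟨f, g⟩ ⟨K, hK⟩ T
    -- A bound, uniform in N and in |s| ≤ T, for the weighted norm of exp(isA_N) f: its initial
    -- value is controlled by the support of f, and the growth rate is 8.
    set C : ℝ := (1 + (2 * K + 4)) * ‖f‖ * Real.exp (8 * T) with hC
    refine ⟨fun N => 41 / √((N : ℝ) + 1) * C, ?_, ?_⟩
    · have h1 : Tendsto (fun N : ℕ => √((N : ℝ) + 1)) atTop atTop :=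
        Real.tendsto_sqrt_atTop.comp (tendsto_atTop_add_const_right _ _ tendsto_natCast_atTop_atTop)
      simpa using (h1.const_div_atTop 41).mul_const C
    · filter_upwards [eventually_ge_atTop K] with N hN s hs
      have h1 : cutoff (2 * N + 4) (expGroup (isSelfAdjoint_truncOp N) s f) =
          expGroup (isSelfAdjoint_truncOp N) s f := by
        rw [expGroup_commute _ (commute_cutoff_truncOp N), (hK N hN).1]
      refine ⟨exists_mem_finiteGraph h1, fun M hM => (norm_truncOp_sub_le hM h1).trans ?_⟩
      have h2 := norm_weight_expGroup_le (isSelfAdjoint_truncOp N)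
        (norm_weight_truncOp_sub_le N) f s
      have h3 := norm_weight_le (by positivity) (hK K le_rfl).1 N
      refine mul_le_mul_of_nonneg_left (h2.trans ?_) (by positivity)
      rw [hC]
      gcongr

/-- The generator of the conjugate group is the maximal operator. -/
theorem mem_generatorGraph_of_conjugateExpr {U : ℝ → Ell2 ≃ₗᵢ[ℂ] Ell2} (hU : IsUnitaryGroup U)
    (hG : generatorGraph U = finiteGraph.topologicalClosure) {f g : Ell2}
    (h : ∀ n, g n = conjugateExpr f n) : (f, g) ∈ generatorGraph U := by
  refine hU.mem_generatorGraph_of_inner hG dense_finiteGraph ?_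
  rintro ⟨u, w⟩ ⟨K, hK⟩
  -- This truncation agrees with the formal expression on {|n|² ≤ 2K + 4}, which contains the
  -- support of u. Self-adjointness of A_N then moves the operator from u to f, and only sites in
  -- that region count in the sum.
  set N := 4 * K + 12 with hN
  have hNK : K ≤ N := by omega
  rw [← (hK N hNK).2]
  have hs : ⟪f, truncOp N u⟫_ℂ = ⟪truncOp N f, u⟫_ℂ :=
    ((isSelfAdjoint_truncOp N).isSymmetric f u).symm
  rw [hs, lp.inner_eq_tsum, lp.inner_eq_tsum]
  refine tsum_congr fun n => ?_
  have hu : 2 * (K : ℝ) + 4 < normSq n → u n = 0 := cutoff_eq_self_iff.1 (hK K le_rfl).1 n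
  rcases le_or_gt (normSq n) (2 * K + 4) with h1 | h1
  · rw [truncOp_apply_eq_conjugateExpr (by rw [hN]; push_cast; linarith), h]
  · change ⟪g n, u n⟫_ℂ = ⟪truncOp N f n, u n⟫_ℂ
    rw [hu h1, inner_zero_right, inner_zero_right]

theorem finiteGraph_le_graph : finiteGraph ≤ conjugateOpCore.graph := by
  rintro ⟨f, g⟩ h
  obtain ⟨K, hK⟩ := id h
  have hf := cutoff_eq_self_iff.1 (hK K le_rfl).1
  have hmem : (f : (Fin 2 → ℤ) → ℂ) ∈ rapidlyDecreasing := by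
    intro N
    refine ⟨(1 + (2 * K + 4)) ^ N * ‖f‖, fun n => ?_⟩
    have h0 := normSq_nonneg n
    rw [add_assoc, ← show normSq n = (n 0 : ℝ) ^ 2 + (n 1 : ℝ) ^ 2 from rfl]
    rcases le_or_gt (normSq n) (2 * K + 4) with h1 | h1
    · have := lp.norm_apply_le_norm (p := 2) (by simp) f n
      gcongr
    · rw [hf n h1, norm_zero, mul_zero]
      positivity
  rw [LinearPMap.mem_graph_iff]
  exact ⟨⟨f, hmem⟩, rfl, lp.ext (funext fun n => conjugateExpr_of_mem_finiteGraph h n)⟩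

theorem graph_conjugateOpCore_le {U : ℝ → Ell2 ≃ₗᵢ[ℂ] Ell2} (hU : IsUnitaryGroup U)
    (hG : generatorGraph U = finiteGraph.topologicalClosure) :
    conjugateOpCore.graph ≤ generatorGraph U := by
  rintro ⟨f, g⟩ h
  obtain ⟨u, rfl, rfl⟩ := (LinearPMap.mem_graph_iff _).1 h
  exact mem_generatorGraph_of_conjugateExpr hU hG fun n => rfl

/-- If the closure of the graph of `A` is the graph of the generator of a unitary group, then the
closure of `A` is that generator. -/
theorem graph_closure_eq_generatorGraph {E : Type*} [NormedAddCommGroup E] [InnerProductSpace ℂ E]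
    {U : ℝ → E ≃ₗᵢ[ℂ] E} {A : E →ₗ.[ℂ] E}
    (h : A.graph.topologicalClosure = generatorGraph U) : A.closure.graph = generatorGraph U := by
  -- The closed graph is contained in the graph of a generator, which is single-valued by uniqueness
  -- of derivatives.
  have hc : A.IsClosable := by
    refine ⟨(generatorGraph U).toLinearPMap, ?_⟩
    rw [Submodule.toLinearPMap_graph_eq, h]
    rintro ⟨f, g⟩ hp rfl
    have h1 := (mem_generatorGraph.1 hp).unique (by simpa using hasDerivAt_const (0 : ℝ) (0 : E))
    simpa using h1
  rw [← hc.graph_closure_eq_closure_graph, h]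

/-- The operator on rapidly decreasing functions lies between the finitely supported core and the
maximal operator, whose closures coincide. -/
theorem graph_conjugateOp {U : ℝ → Ell2 ≃ₗᵢ[ℂ] Ell2} (hU : IsUnitaryGroup U)
    (hG : generatorGraph U = finiteGraph.topologicalClosure) :
    conjugateOp.graph = generatorGraph U := by
  refine graph_closure_eq_generatorGraph (le_antisymm ?_ ?_)
  · exact Submodule.topologicalClosure_minimal _ (graph_conjugateOpCore_le hU hG)
      hU.isClosed_generatorGraph
  · rw [hG]
    exact Submodule.topologicalClosure_mono finiteGraph_le_graph

end Lattice

/-! ### Fourier coefficients of smooth periodic functions -/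

section Fourier

open MeasureTheory

theorem integrable_boxMeasure {g : (Fin 2 → ℝ) → ℂ} (hg : Continuous g) :
    Integrable g boxMeasure :=
  (memLp_of_continuous hg).integrable (by norm_num)

theorem integral_partialDeriv_eq_zero {h : (Fin 2 → ℝ) → ℂ} (hh : h ∈ smoothPeriodic)
    (j : Fin 2) : ∫ x, partialDeriv j h x ∂boxMeasure = 0 := by
  have hd : ∀ x, HasFDerivAt h (fderiv ℝ h x) x := fun x =>
    (hh.1.differentiable (by simp) x).hasFDerivAt
  -- The divergence theorem for the field with j-th component h and the other one zero; opposite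
  -- faces cancel by periodicity.
  have h1 := integral_divergence_of_hasFDerivAt_off_countable' (n := 1)
    (fun _ : Fin 2 => -Real.pi) (fun _ => Real.pi) (fun _ => by linarith [Real.pi_pos])
    (fun i x => (if i = j then (1 : ℝ) else 0) • h x)
    (fun i x => (if i = j then (1 : ℝ) else 0) • fderiv ℝ h x) ∅ Set.countable_empty
    (fun i => (hh.1.continuous.fun_const_smul _).continuousOn)
    (fun x _ i => (hd x).fun_const_smul _) ?_
  · have h2 : ∀ (i : Fin 2) (y : Fin 1 → ℝ),
        (if i = j then (1 : ℝ) else 0) • h (i.insertNth Real.pi y) =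
          (if i = j then (1 : ℝ) else 0) • h (i.insertNth (-Real.pi) y) := by
      intro i y
      have h3 : (i.insertNth Real.pi y : Fin 2 → ℝ) =
          (i.insertNth (-Real.pi) y : Fin 2 → ℝ) + Pi.single i (2 * Real.pi) := by
        ext k
        rcases eq_or_ne k i with rfl | hk
        · simp; ring
        · obtain ⟨k, rfl⟩ := Fin.exists_succAbove_eq hk
          simp
      rw [h3, hh.2]
    simp only [h2, sub_self, Finset.sum_const_zero] at h1
    rw [← h1]
    refine integral_congr_ae (Filter.Eventually.of_forall fun x => ?_)
    fin_cases j <;> simp [partialDeriv, Fin.sum_univ_two]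
  · have h3 : (fun x => ∑ i : Fin 2, ((if i = j then (1 : ℝ) else 0) • fderiv ℝ h x)
        (Pi.single i 1)) = partialDeriv j h := by
      ext x; fin_cases j <;> simp [partialDeriv, Fin.sum_univ_two]
    rw [h3]
    exact integrable_boxMeasure (contDiff_partialDeriv j hh.1).continuous

theorem mul_mem_smoothPeriodic {g h : (Fin 2 → ℝ) → ℂ} (hg : g ∈ smoothPeriodic)
    (hh : h ∈ smoothPeriodic) : (fun x => g x * h x) ∈ smoothPeriodic :=
  ⟨hg.1.mul hh.1, fun j x => by simp only [hg.2 j x, hh.2 j x]⟩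

theorem partialDeriv_mem_smoothPeriodic {g : (Fin 2 → ℝ) → ℂ} (hg : g ∈ smoothPeriodic)
    (j : Fin 2) : partialDeriv j g ∈ smoothPeriodic := by
  refine ⟨contDiff_partialDeriv j hg.1, fun i x => ?_⟩
  have h : (fun y => g (y + Pi.single i (2 * Real.pi))) = g := funext (hg.2 i)
  rw [partialDeriv, ← fderiv_comp_add_right, h, partialDeriv]

theorem partialDeriv_mul (j : Fin 2) {g h : (Fin 2 → ℝ) → ℂ} (hg : ContDiff ℝ ∞ g)
    (hh : ContDiff ℝ ∞ h) (x : Fin 2 → ℝ) :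
    partialDeriv j (fun y => g y * h y) x =
      partialDeriv j g x * h x + g x * partialDeriv j h x := by
  unfold partialDeriv
  rw [fderiv_fun_mul (hg.differentiable (by simp) x) (hh.differentiable (by simp) x)]
  simp only [add_apply, smul_apply, smul_eq_mul]
  ring

/-- The exponential `x ↦ exp (i ⟨n, x⟩)`. -/
def expChar (n : Fin 2 → ℤ) (x : Fin 2 → ℝ) : ℂ :=
  Complex.exp (Complex.I * ∑ j : Fin 2, (n j : ℂ) * (x j : ℂ))

theorem expChar_add (m n : Fin 2 → ℤ) (x : Fin 2 → ℝ) :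
    expChar (m + n) x = expChar m x * expChar n x := by
  rw [expChar, expChar, expChar, ← Complex.exp_add]
  simp only [Fin.sum_univ_two, Pi.add_apply, Int.cast_add]
  ring_nf

theorem character_eq (n : Fin 2 → ℤ) (x : Fin 2 → ℝ) :
    character n x = (1 / (2 * Real.pi) : ℂ) * expChar (-n) x := by
  simp [character, expChar, Fin.sum_univ_two]
  ring_nf

theorem conj_character (n : Fin 2 → ℤ) (x : Fin 2 → ℝ) :
    (starRingEnd ℂ) (character n x) = (1 / (2 * Real.pi) : ℂ) * expChar n x := by
  simp [character, expChar, Fin.sum_univ_two, ← Complex.exp_conj, map_ofNat (starRingEnd ℂ) 2]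

theorem hasFDerivAt_expChar (n : Fin 2 → ℤ) (x : Fin 2 → ℝ) :
    HasFDerivAt (expChar n) (expChar n x • (Complex.I • ∑ j : Fin 2,
      (n j : ℂ) •
        (Complex.ofRealCLM ∘L ContinuousLinearMap.proj (R := ℝ) (φ := fun _ => ℝ) j))) x := by
  have h1 : HasFDerivAt (fun x : Fin 2 → ℝ => Complex.I * ∑ j : Fin 2, (n j : ℂ) * (x j : ℂ))
      (Complex.I • ∑ j : Fin 2,
      (n j : ℂ) •
        (Complex.ofRealCLM ∘L ContinuousLinearMap.proj (R := ℝ) (φ := fun _ => ℝ) j)) x := by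
    refine HasFDerivAt.const_mul (HasFDerivAt.fun_sum fun j _ => HasFDerivAt.const_mul ?_ _) _
    exact (Complex.ofRealCLM ∘L
      ContinuousLinearMap.proj (R := ℝ) (φ := fun _ => ℝ) j).hasFDerivAt
  exact h1.cexp

theorem partialDeriv_expChar (n : Fin 2 → ℤ) (j : Fin 2) (x : Fin 2 → ℝ) :
    partialDeriv j (expChar n) x = Complex.I * n j * expChar n x := by
  rw [partialDeriv, (hasFDerivAt_expChar n x).fderiv]
  fin_cases j <;> simp [Fin.sum_univ_two] <;> ring

theorem expChar_mem_smoothPeriodic (n : Fin 2 → ℤ) : expChar n ∈ smoothPeriodic := by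
  constructor
  · unfold expChar
    refine Complex.contDiff_exp.comp (contDiff_const.mul (ContDiff.sum fun j _ =>
      contDiff_const.mul ?_))
    exact Complex.ofRealCLM.contDiff.comp (contDiff_apply ℝ ℝ j)
  · intro j x
    rw [expChar, expChar, Complex.exp_eq_exp_iff_exists_int]
    refine ⟨n j, ?_⟩
    fin_cases j <;> simp [Fin.sum_univ_two] <;> ring

/-! ### Fourier coefficients on the square -/

/-- The Fourier coefficient `⟨e_n, g⟩` of a function on the square. -/
def boxCoeff (g : (Fin 2 → ℝ) → ℂ) (n : Fin 2 → ℤ) : ℂ :=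
  ∫ x, (1 / (2 * Real.pi) : ℂ) * (expChar n x * g x) ∂boxMeasure

theorem inner_characterLp (f : L2Box) (n : Fin 2 → ℤ) :
    ⟪characterLp n, f⟫_ℂ = boxCoeff f n := by
  rw [L2.inner_def, boxCoeff]
  refine integral_congr_ae ?_
  filter_upwards [characterLp_coeFn n] with x hx
  rw [hx, RCLike.inner_apply, conj_character]
  ring

theorem fourierTransform_symm_apply (f : L2Box) (n : Fin 2 → ℤ) :
    fourierTransform.symm f n = boxCoeff f n := by
  rw [← inner_characterLp]
  have h := characterBasis.repr_apply_apply f n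
  simpa only [characterBasis, HilbertBasis.coe_mk] using! h

theorem boxCoeff_congr {g h : (Fin 2 → ℝ) → ℂ} (e : g =ᵐ[boxMeasure] h) :
    boxCoeff g = boxCoeff h := by
  ext n
  refine integral_congr_ae ?_
  filter_upwards [e] with x hx
  rw [hx]

theorem fourierTransform_symm_toLp {g : (Fin 2 → ℝ) → ℂ} (hg : MemLp g 2 boxMeasure)
    (n : Fin 2 → ℤ) : fourierTransform.symm (hg.toLp g) n = boxCoeff g n := by
  rw [fourierTransform_symm_apply, boxCoeff_congr hg.coeFn_toLp]

theorem integrable_boxCoeff {g : (Fin 2 → ℝ) → ℂ} (hg : Integrable g boxMeasure)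
    (n : Fin 2 → ℤ) :
    Integrable (fun x => (1 / (2 * Real.pi) : ℂ) * (expChar n x * g x)) boxMeasure := by
  refine Integrable.const_mul (hg.bdd_mul (c := 1)
    (expChar_mem_smoothPeriodic n).1.continuous.aestronglyMeasurable
    (Filter.Eventually.of_forall fun x => ?_)) _
  rw [expChar, Complex.norm_exp]
  simp [Fin.sum_univ_two]

theorem boxCoeff_add {g h : (Fin 2 → ℝ) → ℂ} (hg : Integrable g boxMeasure)
    (hh : Integrable h boxMeasure) (n : Fin 2 → ℤ) :
    boxCoeff (fun x => g x + h x) n = boxCoeff g n + boxCoeff h n := by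
  rw [boxCoeff, boxCoeff, boxCoeff,
    ← integral_add (integrable_boxCoeff hg n) (integrable_boxCoeff hh n)]
  simp only [mul_add]

theorem boxCoeff_const_mul (c : ℂ) (g : (Fin 2 → ℝ) → ℂ) (n : Fin 2 → ℤ) :
    boxCoeff (fun x => c * g x) n = c * boxCoeff g n := by
  rw [boxCoeff, boxCoeff, ← integral_const_mul]
  congr 1; ext x; ring

theorem boxCoeff_expChar_mul (v : Fin 2 → ℤ) (g : (Fin 2 → ℝ) → ℂ) (n : Fin 2 → ℤ) :
    boxCoeff (fun x => expChar v x * g x) n = boxCoeff g (n + v) := by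
  simp only [boxCoeff, expChar_add, mul_assoc]

/-- Integration by parts, with no boundary term by periodicity. The sign comes from the convention
exp(-i⟨n, x⟩) for the basis. -/
theorem boxCoeff_partialDeriv {g : (Fin 2 → ℝ) → ℂ} (hg : g ∈ smoothPeriodic) (j : Fin 2)
    (n : Fin 2 → ℤ) : boxCoeff (partialDeriv j g) n = -Complex.I * (n j * boxCoeff g n) := by
  have h1 := integral_partialDeriv_eq_zero
    (mul_mem_smoothPeriodic (expChar_mem_smoothPeriodic n) hg) j
  have he := (expChar_mem_smoothPeriodic n).1
  have hi : Integrable g boxMeasure := integrable_boxMeasure hg.1.continuous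
  have hi' : Integrable (partialDeriv j g) boxMeasure :=
    integrable_boxMeasure (contDiff_partialDeriv j hg.1).continuous
  have h2 : boxCoeff (fun x => Complex.I * n j * g x + partialDeriv j g x) n = 0 := by
    have h3 : boxCoeff (fun x => Complex.I * n j * g x + partialDeriv j g x) n =
        (1 / (2 * Real.pi) : ℂ) *
          ∫ x, partialDeriv j (fun y => expChar n y * g y) x ∂boxMeasure := by
      rw [boxCoeff, ← integral_const_mul]
      congr 1; ext x
      rw [partialDeriv_mul j he hg.1, partialDeriv_expChar]
      ring
    rw [h3, h1, mul_zero]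
  rw [boxCoeff_add (hi.const_mul _) hi', boxCoeff_const_mul] at h2
  linear_combination h2

end Fourier

/-! ### The conjugate operator on Fourier coefficients -/

section Fourier

open MeasureTheory

theorem expChar_step_sub (v : Fin 2 → ℤ) (x : Fin 2 → ℝ) :
    expChar v x - expChar (-v) x =
      2 * Complex.I * (Real.sin (∑ j : Fin 2, (v j : ℝ) * x j) : ℂ) := by
  rw [Complex.ofReal_sin, Complex.sin]
  simp only [expChar, Fin.sum_univ_two, Pi.neg_apply]
  push_cast
  have e1 : Complex.I * (-(v 0 : ℂ) * x 0 + -(v 1 : ℂ) * x 1) =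
    -((v 0 : ℂ) * x 0 + v 1 * x 1) * Complex.I := by ring
  have e2 : Complex.I * ((v 0 : ℂ) * x 0 + (v 1 : ℂ) * x 1) =
    ((v 0 : ℂ) * x 0 + v 1 * x 1) * Complex.I := by ring
  rw [e1, e2]
  linear_combination (Complex.exp (((v 0 : ℂ) * x 0 + v 1 * x 1) * Complex.I) -
    Complex.exp (-((v 0 : ℂ) * x 0 + v 1 * x 1) * Complex.I)) * Complex.I_sq

theorem expChar_step_add (v : Fin 2 → ℤ) (x : Fin 2 → ℝ) :
    expChar v x + expChar (-v) x = 2 * (Real.cos (∑ j : Fin 2, (v j : ℝ) * x j) : ℂ) := by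
  rw [Complex.ofReal_cos, Complex.cos]
  simp only [expChar, Fin.sum_univ_two, Pi.neg_apply]
  push_cast
  have e1 : Complex.I * (-(v 0 : ℂ) * x 0 + -(v 1 : ℂ) * x 1) =
    -((v 0 : ℂ) * x 0 + v 1 * x 1) * Complex.I := by ring
  have e2 : Complex.I * ((v 0 : ℂ) * x 0 + (v 1 : ℂ) * x 1) =
    ((v 0 : ℂ) * x 0 + v 1 * x 1) * Complex.I := by ring
  rw [e1, e2]
  ring

/-! ### The symbol and its gradient as trigonometric polynomials -/

theorem symbol_eq_expChar (x : Fin 2 → ℝ) :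
    (symbol x : ℂ) = (1 / 6) * ∑ i : Fin 3, (expChar (step i) x + expChar (-step i) x) := by
  simp only [expChar_step_add, symbol, Fin.sum_univ_three, Fin.sum_univ_two, step,
    Matrix.cons_val_zero, Matrix.cons_val_one, Matrix.cons_val]
  push_cast
  simp only [one_mul, zero_mul, add_zero, zero_add, neg_mul, ← sub_eq_add_neg]
  ring

theorem hasFDerivAt_symbol (x : Fin 2 → ℝ) : HasFDerivAt symbol
    ((1 / 3 : ℝ) • ((-Real.sin (x 0)) • ContinuousLinearMap.proj (R := ℝ) (φ := fun _ => ℝ) 0 +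
      (-Real.sin (x 1)) • ContinuousLinearMap.proj (R := ℝ) (φ := fun _ => ℝ) 1 +
      (-Real.sin (x 0 - x 1)) • (ContinuousLinearMap.proj (R := ℝ) (φ := fun _ => ℝ) 0 -
        ContinuousLinearMap.proj (R := ℝ) (φ := fun _ => ℝ) 1))) x := by
  have h0 : ∀ j : Fin 2, HasFDerivAt (fun x : Fin 2 → ℝ => x j)
      (ContinuousLinearMap.proj (R := ℝ) (φ := fun _ => ℝ) j) x := fun j =>
    (ContinuousLinearMap.proj (R := ℝ) (φ := fun _ => ℝ) j).hasFDerivAt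
  exact ((((h0 0).cos.add (h0 1).cos).add ((h0 0).sub (h0 1)).cos)).const_mul (1 / 3)

theorem gradSymbol_zero (x : Fin 2 → ℝ) :
    gradSymbol 0 x = -(1 / 3) * (Real.sin (x 0) + Real.sin (x 0 - x 1)) := by
  rw [gradSymbol, partialDeriv, (hasFDerivAt_symbol x).fderiv]
  simp
  ring

theorem gradSymbol_one (x : Fin 2 → ℝ) :
    gradSymbol 1 x = -(1 / 3) * (Real.sin (x 1) - Real.sin (x 0 - x 1)) := by
  rw [gradSymbol, partialDeriv, (hasFDerivAt_symbol x).fderiv]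
  simp
  ring

theorem sin_eq_expChar {v : Fin 2 → ℤ} {x : Fin 2 → ℝ} {θ : ℝ}
    (h : ∑ j : Fin 2, (v j : ℝ) * x j = θ) :
    (Real.sin θ : ℂ) = -(Complex.I / 2) * (expChar v x - expChar (-v) x) := by
  rw [expChar_step_sub, h]
  linear_combination (Real.sin θ : ℂ) * Complex.I_sq

theorem gradSymbol_eq_expChar (x : Fin 2 → ℝ) :
    (gradSymbol 0 x : ℂ) = (Complex.I / 6) * ((expChar ![1, 0] x - expChar ![-1, 0] x) +
      (expChar ![1, -1] x - expChar ![-1, 1] x)) ∧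
    (gradSymbol 1 x : ℂ) = (Complex.I / 6) * ((expChar ![0, 1] x - expChar ![0, -1] x) +
      (expChar ![-1, 1] x - expChar ![1, -1] x)) := by
  have n1 : (![-1, 0] : Fin 2 → ℤ) = -![1, 0] := by ext j; fin_cases j <;> simp
  have n2 : (![0, -1] : Fin 2 → ℤ) = -![0, 1] := by ext j; fin_cases j <;> simp
  have n3 : (![-1, 1] : Fin 2 → ℤ) = -![1, -1] := by ext j; fin_cases j <;> simp
  have h1 := sin_eq_expChar (v := ![1, 0]) (x := x) (θ := x 0) (by simp [Fin.sum_univ_two])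
  have h2 := sin_eq_expChar (v := ![0, 1]) (x := x) (θ := x 1) (by simp [Fin.sum_univ_two])
  have h3 := sin_eq_expChar (v := ![1, -1]) (x := x) (θ := x 0 - x 1)
    (by simp [Fin.sum_univ_two, sub_eq_add_neg])
  rw [gradSymbol_zero, gradSymbol_one, n1, n2, n3]
  push_cast [h1, h2, h3]
  constructor <;> ring

theorem gradSymbol_mem_smoothPeriodic (j : Fin 2) :
    (fun x => (gradSymbol j x : ℂ)) ∈ smoothPeriodic := by
  have hsub : ∀ m n, (fun x => expChar m x - expChar n x) ∈ smoothPeriodic := fun m n =>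
    smoothPeriodic.sub_mem (expChar_mem_smoothPeriodic m) (expChar_mem_smoothPeriodic n)
  fin_cases j
  · simp only [Fin.zero_eta, (gradSymbol_eq_expChar _).1]
    exact smoothPeriodic.smul_mem _ (smoothPeriodic.add_mem (hsub _ _) (hsub _ _))
  · simp only [Fin.mk_one, (gradSymbol_eq_expChar _).2]
    exact smoothPeriodic.smul_mem _ (smoothPeriodic.add_mem (hsub _ _) (hsub _ _))

theorem symbol_mem_smoothPeriodic : (fun x => (symbol x : ℂ)) ∈ smoothPeriodic := by
  simp only [symbol_eq_expChar, Fin.sum_univ_three]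
  have hadd : ∀ n, (fun x => expChar n x + expChar (-n) x) ∈ smoothPeriodic := fun n =>
    smoothPeriodic.add_mem (expChar_mem_smoothPeriodic n) (expChar_mem_smoothPeriodic (-n))
  exact smoothPeriodic.smul_mem _ (smoothPeriodic.add_mem
    (smoothPeriodic.add_mem (hadd _) (hadd _)) (hadd _))

theorem boxCoeff_expChar_comb (a b c d : Fin 2 → ℤ) (z : ℂ) {g : (Fin 2 → ℝ) → ℂ}
    (hg : Integrable g boxMeasure) (n : Fin 2 → ℤ) :
    boxCoeff (fun x => z * ((expChar a x - expChar b x) + (expChar c x - expChar d x)) * g x) n =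
      z * ((boxCoeff g (n + a) - boxCoeff g (n + b)) +
        (boxCoeff g (n + c) - boxCoeff g (n + d))) := by
  have hi : ∀ v, Integrable (fun x => expChar v x * g x) boxMeasure := fun v =>
    hg.bdd_mul (c := 1) (expChar_mem_smoothPeriodic v).1.continuous.aestronglyMeasurable
      (Filter.Eventually.of_forall fun x => by
        rw [expChar, Complex.norm_exp]
        simp [Fin.sum_univ_two])
  have e : (fun x => z * ((expChar a x - expChar b x) + (expChar c x - expChar d x)) * g x) =
      fun x => z * ((expChar a x * g x + (-1) * (expChar b x * g x)) +
        (expChar c x * g x + (-1) * (expChar d x * g x))) := by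
    ext x; ring
  rw [e, boxCoeff_const_mul,
    boxCoeff_add ((hi a).fun_add ((hi b).const_mul _)) ((hi c).fun_add ((hi d).const_mul _)),
    boxCoeff_add (hi a) ((hi b).const_mul _), boxCoeff_add (hi c) ((hi d).const_mul _),
    boxCoeff_const_mul, boxCoeff_const_mul]
  simp only [boxCoeff_expChar_mul]
  ring

theorem boxCoeff_gradSymbol_mul (j : Fin 2) {g : (Fin 2 → ℝ) → ℂ}
    (hg : Integrable g boxMeasure) (n : Fin 2 → ℤ) :
    boxCoeff (fun x => (gradSymbol j x : ℂ) * g x) n =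
      (Complex.I / 3) * difference j (boxCoeff g) n := by
  fin_cases j
  · simp only [Fin.zero_eta, (gradSymbol_eq_expChar _).1]
    rw [boxCoeff_expChar_comb _ _ _ _ _ hg]
    simp [difference, translate]
    ring
  · simp only [Fin.mk_one, (gradSymbol_eq_expChar _).2]
    rw [boxCoeff_expChar_comb _ _ _ _ _ hg]
    simp [difference, translate]
    ring

theorem boxCoeff_symbol_mul {g : (Fin 2 → ℝ) → ℂ} (hg : Integrable g boxMeasure)
    (n : Fin 2 → ℤ) : boxCoeff (fun x => (symbol x : ℂ) * g x) n =
      (1 / 6) * ∑ i : Fin 3, (boxCoeff g (n + step i) + boxCoeff g (n + -step i)) := by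
  have hi : ∀ v, Integrable (fun x => expChar v x * g x) boxMeasure := fun v =>
    hg.bdd_mul (c := 1) (expChar_mem_smoothPeriodic v).1.continuous.aestronglyMeasurable
      (Filter.Eventually.of_forall fun x => by
        rw [expChar, Complex.norm_exp]
        simp [Fin.sum_univ_two])
  have e : (fun x => (symbol x : ℂ) * g x) = fun x => (1 / 6) *
      (((expChar (step 0) x * g x + expChar (-step 0) x * g x) +
        (expChar (step 1) x * g x + expChar (-step 1) x * g x)) +
        (expChar (step 2) x * g x + expChar (-step 2) x * g x)) := by
    ext x
    rw [symbol_eq_expChar, Fin.sum_univ_three]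
    ring
  have hii : ∀ i, Integrable (fun x => expChar (step i) x * g x + expChar (-step i) x * g x)
    boxMeasure := fun i => (hi _).add (hi _)
  rw [e, boxCoeff_const_mul, boxCoeff_add ((hii 0).fun_add (hii 1)) (hii 2),
    boxCoeff_add (hii 0) (hii 1), boxCoeff_add (hi _) (hi _), boxCoeff_add (hi _) (hi _),
    boxCoeff_add (hi _) (hi _)]
  simp only [boxCoeff_expChar_mul, Fin.sum_univ_three]

/-- The dictionary: multiplication by ∂_jF becomes (i/3)P_j and ∂_j becomes -iQ_j, so (i/2)∂_jF ∂_j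
becomes (i/6)P_jQ_j, and the other order likewise. -/
theorem boxCoeff_conjugateFourierExpr {φ : (Fin 2 → ℝ) → ℂ} (hφ : φ ∈ smoothPeriodic)
    (n : Fin 2 → ℤ) : boxCoeff (conjugateFourierExpr φ) n = conjugateExpr (boxCoeff φ) n := by
  have hint : ∀ {g}, g ∈ smoothPeriodic → Integrable g boxMeasure := fun hg =>
    integrable_boxMeasure hg.1.continuous
  have h1 : ∀ j, (fun x => (gradSymbol j x : ℂ) * partialDeriv j φ x) ∈ smoothPeriodic := fun j =>
    mul_mem_smoothPeriodic (gradSymbol_mem_smoothPeriodic j) (partialDeriv_mem_smoothPeriodic hφ j)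
  have h2 : ∀ j, (fun y => (gradSymbol j y : ℂ) * φ y) ∈ smoothPeriodic := fun j =>
    mul_mem_smoothPeriodic (gradSymbol_mem_smoothPeriodic j) hφ
  have h3 : ∀ j, partialDeriv j (fun y => (gradSymbol j y : ℂ) * φ y) ∈ smoothPeriodic := fun j =>
    partialDeriv_mem_smoothPeriodic (h2 j) j
  have h4 : ∀ j, boxCoeff (fun x => (gradSymbol j x : ℂ) * partialDeriv j φ x +
      partialDeriv j (fun y => (gradSymbol j y : ℂ) * φ y) x) n =
      (1 / 3) * (difference j (position j (boxCoeff φ)) n +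
        position j (difference j (boxCoeff φ)) n) := by
    intro j
    have h5 : boxCoeff (partialDeriv j φ) = (-Complex.I) • position j (boxCoeff φ) :=
      funext fun m => boxCoeff_partialDeriv hφ j m
    rw [boxCoeff_add (hint (h1 j)) (hint (h3 j)),
      boxCoeff_gradSymbol_mul j (hint (partialDeriv_mem_smoothPeriodic hφ j)),
      boxCoeff_partialDeriv (h2 j), boxCoeff_gradSymbol_mul j (hint hφ), h5, map_smul]
    simp only [Pi.smul_apply, smul_eq_mul, position, LinearMap.coe_mk, AddHom.coe_mk]
    linear_combination (-(1 / 3) * (difference j (fun m => (m j : ℂ) * boxCoeff φ m) n +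
      n j * difference j (boxCoeff φ) n)) * Complex.I_sq
  have e : conjugateFourierExpr φ = fun x => (Complex.I / 2) * ((gradSymbol 0 x : ℂ) *
      partialDeriv 0 φ x + partialDeriv 0 (fun y => (gradSymbol 0 y : ℂ) * φ y) x +
      ((gradSymbol 1 x : ℂ) *
      partialDeriv 1 φ x + partialDeriv 1 (fun y => (gradSymbol 1 y : ℂ) * φ y) x)) := by
    ext x
    simp [conjugateFourierExpr, Fin.sum_univ_two]
  rw [e, boxCoeff_const_mul, boxCoeff_add ((hint (h1 0)).fun_add (hint (h3 0)))
    ((hint (h1 1)).fun_add (hint (h3 1))), h4, h4]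
  simp only [conjugateExpr, Fin.sum_univ_two, LinearMap.smul_apply, LinearMap.add_apply,
    LinearMap.comp_apply, Pi.smul_apply, Pi.add_apply, smul_eq_mul]
  ring

/-! ### The graph of the momentum-space operator on smooth periodic functions -/

theorem mem_graph_conjugateOpFourierCore {φ : (Fin 2 → ℝ) → ℂ} (hφ : φ ∈ smoothPeriodic) :
    (smoothPeriodicToLp ⟨φ, hφ⟩, conjugateFourierLp ⟨φ, hφ⟩) ∈ conjugateOpFourierCore.graph := by
  rw [LinearPMap.mem_graph_iff]
  refine ⟨⟨smoothPeriodicToLp ⟨φ, hφ⟩, LinearMap.mem_range_self _ _⟩, rfl, ?_⟩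
  change conjugateFourierLp ((LinearEquiv.ofInjective smoothPeriodicToLp
    smoothPeriodicToLp_injective).symm ⟨smoothPeriodicToLp ⟨φ, hφ⟩, _⟩) = _
  congr 1
  exact (LinearEquiv.ofInjective smoothPeriodicToLp
    smoothPeriodicToLp_injective).symm_apply_apply ⟨φ, hφ⟩

theorem exists_of_mem_graph_conjugateOpFourierCore {p : L2Box × L2Box}
    (hp : p ∈ conjugateOpFourierCore.graph) :
    ∃ φ : smoothPeriodic, p = (smoothPeriodicToLp φ, conjugateFourierLp φ) := by
  obtain ⟨f, g⟩ := p
  obtain ⟨y, rfl, rfl⟩ := (LinearPMap.mem_graph_iff _).1 hp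
  obtain ⟨_, ⟨φ, rfl⟩⟩ := y
  refine ⟨φ, Prod.ext rfl ?_⟩
  obtain ⟨y, h1, h2⟩ := (LinearPMap.mem_graph_iff _).1 (mem_graph_conjugateOpFourierCore φ.2)
  obtain rfl : y = ⟨smoothPeriodicToLp φ, LinearMap.mem_range_self _ _⟩ := Subtype.ext h1
  exact h2

end Fourier

/-! ### Multiplication operators on `L²([-π, π]²)` -/

section Multiplication

open MeasureTheory BoundedContinuousFunction

theorem memLp_mul (c : (Fin 2 → ℝ) →ᵇ ℂ) (f : L2Box) :
    MemLp (fun x => c x * f x) 2 boxMeasure :=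
  (Lp.memLp f).of_le_mul (c := ‖c‖)
    (c.continuous.aestronglyMeasurable.mul (Lp.aestronglyMeasurable f))
    (Filter.Eventually.of_forall fun x => by
      rw [norm_mul]
      exact mul_le_mul_of_nonneg_right (c.norm_coe_le_norm x) (norm_nonneg _))

/-- Multiplication by a bounded continuous function. -/
def mulOp (c : (Fin 2 → ℝ) →ᵇ ℂ) : L2Box →L[ℂ] L2Box :=
  LinearMap.mkContinuous
    { toFun := fun f => (memLp_mul c f).toLp _
      map_add' := fun f g => by
        rw [← MemLp.toLp_add]
        refine MemLp.toLp_congr _ _ ?_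
        filter_upwards [Lp.coeFn_add f g] with x hx
        rw [hx, Pi.add_apply, Pi.add_apply, mul_add]
      map_smul' := fun a f => by
        rw [RingHom.id_apply, ← MemLp.toLp_const_smul]
        refine MemLp.toLp_congr _ _ ?_
        filter_upwards [Lp.coeFn_smul a f] with x hx
        rw [hx, Pi.smul_apply, Pi.smul_apply, smul_eq_mul, smul_eq_mul, mul_left_comm] } ‖c‖
    fun f => Lp.norm_le_mul_norm_of_ae_le_mul (by
      filter_upwards [(memLp_mul c f).coeFn_toLp] with x hx
      simp only [LinearMap.coe_mk, AddHom.coe_mk]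
      rw [hx, norm_mul]
      exact mul_le_mul_of_nonneg_right (c.norm_coe_le_norm x) (norm_nonneg _))

theorem mulOp_coeFn (c : (Fin 2 → ℝ) →ᵇ ℂ) (f : L2Box) :
    mulOp c f =ᵐ[boxMeasure] fun x => c x * f x :=
  (memLp_mul c f).coeFn_toLp

theorem norm_mulOp_le (c : (Fin 2 → ℝ) →ᵇ ℂ) : ‖mulOp c‖ ≤ ‖c‖ :=
  LinearMap.mkContinuous_norm_le _ (norm_nonneg c) _

theorem mulOp_mul (c d : (Fin 2 → ℝ) →ᵇ ℂ) : mulOp (c * d) = mulOp c * mulOp d := by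
  ext1 f
  refine Lp.ext ?_
  filter_upwards [mulOp_coeFn (c * d) f, mulOp_coeFn c (mulOp d f), mulOp_coeFn d f]
    with x h1 h2 h3
  rw [mul_apply_eq_comp, h1, h2, h3, BoundedContinuousFunction.mul_apply, mul_assoc]

theorem mulOp_add (c d : (Fin 2 → ℝ) →ᵇ ℂ) : mulOp (c + d) = mulOp c + mulOp d := by
  ext1 f
  refine Lp.ext ?_
  filter_upwards [mulOp_coeFn (c + d) f, mulOp_coeFn c f, mulOp_coeFn d f,
    Lp.coeFn_add (mulOp c f) (mulOp d f)] with x h1 h2 h3 h4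
  rw [_root_.add_apply, h4, h1, Pi.add_apply, h2, h3, BoundedContinuousFunction.add_apply, add_mul]

theorem mulOp_algebraMap (z : ℂ) :
    mulOp (algebraMap ℂ ((Fin 2 → ℝ) →ᵇ ℂ) z) = algebraMap ℂ (L2Box →L[ℂ] L2Box) z := by
  ext1 f
  refine Lp.ext ?_
  filter_upwards [mulOp_coeFn (algebraMap ℂ ((Fin 2 → ℝ) →ᵇ ℂ) z) f, Lp.coeFn_smul z f]
    with x h1 h2
  rw [Algebra.algebraMap_eq_smul_one (A := L2Box →L[ℂ] L2Box), _root_.smul_apply,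
    one_apply_eq_self, h1, h2]
  simp

theorem mulOp_star (c : (Fin 2 → ℝ) →ᵇ ℂ) : mulOp (star c) = star (mulOp c) := by
  rw [ContinuousLinearMap.star_eq_adjoint, ContinuousLinearMap.eq_adjoint_iff]
  intro f g
  rw [L2.inner_def, L2.inner_def]
  refine integral_congr_ae ?_
  filter_upwards [mulOp_coeFn (star c) f, mulOp_coeFn c g] with x h1 h2
  rw [h1, h2, RCLike.inner_apply, RCLike.inner_apply, BoundedContinuousFunction.star_apply,
    map_mul, RCLike.star_def, RCLike.conj_conj]
  ring

/-- Multiplication by bounded continuous functions as a homomorphism of `C⋆`-algebras. -/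
def mulHom : ((Fin 2 → ℝ) →ᵇ ℂ) →⋆ₐ[ℂ] (L2Box →L[ℂ] L2Box) where
  toFun := mulOp
  map_one' := by simpa using mulOp_algebraMap 1
  map_mul' := mulOp_mul
  map_zero' := by simpa using mulOp_algebraMap 0
  map_add' := mulOp_add
  commutes' := mulOp_algebraMap
  map_star' := mulOp_star

theorem continuous_mulHom : Continuous mulHom :=
  AddMonoidHomClass.continuous_of_bound mulHom 1 fun c => by
    rw [one_mul]; exact norm_mulOp_le c

/-- Evaluation at a point as a homomorphism of `C⋆`-algebras. -/
def evalHom (x : Fin 2 → ℝ) : ((Fin 2 → ℝ) →ᵇ ℂ) →⋆ₐ[ℂ] ℂ where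
  toFun c := c x
  map_one' := rfl
  map_mul' _ _ := rfl
  map_zero' := rfl
  map_add' _ _ := rfl
  commutes' z := by simp
  map_star' _ := rfl

/-! ### Functional calculus and spectral subspaces of multiplication operators -/

/-- A bounded continuous real function as a complex one. -/
def realBounded (c : (Fin 2 → ℝ) → ℝ) (hc : Continuous c) (hb : ∃ C, ∀ x, |c x| ≤ C) :
    (Fin 2 → ℝ) →ᵇ ℂ :=
  BoundedContinuousFunction.ofNormedAddCommGroup (fun x => (c x : ℂ)) (by fun_prop) hb.choose
    fun x => by simpa using hb.choose_spec x

theorem realBounded_apply (c : (Fin 2 → ℝ) → ℝ) (hc : Continuous c) (hb : ∃ C, ∀ x, |c x| ≤ C)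
    (x : Fin 2 → ℝ) : realBounded c hc hb x = c x := rfl

theorem star_realBounded (c : (Fin 2 → ℝ) → ℝ) (hc : Continuous c) (hb : ∃ C, ∀ x, |c x| ≤ C) :
    star (realBounded c hc hb) = realBounded c hc hb := by
  ext x
  simp [realBounded_apply]

theorem exists_bound_comp {c : (Fin 2 → ℝ) → ℝ} (hb : ∃ C, ∀ x, |c x| ≤ C) (φ : C(ℝ, ℝ)) :
    ∃ C, ∀ x, |φ (c x)| ≤ C := by
  obtain ⟨C, hC⟩ := hb
  obtain ⟨D, hD⟩ := (isCompact_Icc (a := -C) (b := C)).bddAbove_image φ.continuous.abs.continuousOn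
  exact ⟨D, fun x => hD (Set.mem_image_of_mem _ (abs_le.1 (hC x)))⟩

/-- The functional calculus in the image of a representation of bounded continuous functions. -/
theorem cfc_representation {E : Type*} [NormedAddCommGroup E] [InnerProductSpace ℂ E]
    [CompleteSpace E] (π : ((Fin 2 → ℝ) →ᵇ ℂ) →⋆ₐ[ℂ] (E →L[ℂ] E)) (hπ : Continuous π)
    {c : (Fin 2 → ℝ) → ℝ} (hc : Continuous c) (hb : ∃ C, ∀ x, |c x| ≤ C) (φ : C(ℝ, ℝ)) :
    (cfc (φ : ℝ → ℝ) (π (realBounded c hc hb)) : E →L[ℂ] E) =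
      π (realBounded (fun x => φ (c x)) (φ.continuous.comp hc) (exists_bound_comp hb φ)) := by
  set b := realBounded c hc hb with hbdef
  have hsa : IsSelfAdjoint b := star_realBounded c hc hb
  have hφ : Continuous fun z : ℂ => (φ z.re : ℂ) := by fun_prop
  -- Inside the algebra of bounded continuous functions the calculus is composition, as one sees by
  -- evaluating at each point; π then carries it to operators. The real calculus is rewritten as a
  -- complex one through the real part.
  have h1 : cfc (fun z : ℂ => (φ z.re : ℂ)) b =
      realBounded (fun x => φ (c x)) (φ.continuous.comp hc) (exists_bound_comp hb φ) := by
    ext x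
    have hev : Continuous (evalHom x) := AddMonoidHomClass.continuous_of_bound (evalHom x) 1
      fun d => by rw [one_mul]; exact d.norm_coe_le_norm x
    have h2 := StarAlgHom.map_cfc (evalHom x) (fun z : ℂ => (φ z.re : ℂ)) b hφ.continuousOn hev
      hsa.isStarNormal inferInstance
    have h3 : cfc (fun z : ℂ => (φ z.re : ℂ)) (c x : ℂ) = (φ (c x) : ℂ) := by
      have := cfc_algebraMap (A := ℂ) (p := IsStarNormal) ((c x : ℂ)) (fun z : ℂ => (φ z.re : ℂ))
      simpa using this
    exact h2.trans h3
  have hsa' : IsSelfAdjoint (π b) := hsa.map π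
  rw [cfc_real_eq_complex _ hsa', ← h1]
  exact (StarAlgHom.map_cfc π (fun z : ℂ => (φ z.re : ℂ)) b hφ.continuousOn
    hπ hsa.isStarNormal hsa'.isStarNormal).symm

/-- The spectral subspace of a multiplication operator is annihilated by the functions that vanish
on the preimage of the set. -/
theorem spectralSubspace_representation_le {E : Type*} [NormedAddCommGroup E]
    [InnerProductSpace ℂ E] [CompleteSpace E]
    (π : ((Fin 2 → ℝ) →ᵇ ℂ) →⋆ₐ[ℂ] (E →L[ℂ] E)) (hπ : Continuous π)
    {c : (Fin 2 → ℝ) → ℝ} (hc : Continuous c) (hb : ∃ C, ∀ x, |c x| ≤ C) {I : Set ℝ}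
    (d : (Fin 2 → ℝ) →ᵇ ℂ) (hd : ∀ x, c x ∈ I → d x = 0) :
    spectralSubspace (π (realBounded c hc hb)) I ≤ (π d).ker := by
  refine Submodule.topologicalClosure_minimal _ (iSup_le fun φ => ?_)
    (ContinuousLinearMap.isClosed_ker _)
  rintro _ ⟨f, rfl⟩
  rw [cfc_representation π hπ, LinearMap.mem_ker]
  -- The factors vanish on complementary sets: d where c lies in I, φ(c) elsewhere.
  have h0 : d * realBounded (fun x => φ.1 (c x)) (φ.1.continuous.comp hc)
      (exists_bound_comp hb φ.1) = 0 := by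
    ext x
    rw [BoundedContinuousFunction.mul_apply, realBounded_apply]
    by_cases hx : c x ∈ I
    · simp [hd _ hx]
    · simp [φ.2 _ hx]
  have h1 := map_mul π d (realBounded (fun x => φ.1 (c x)) (φ.1.continuous.comp hc)
      (exists_bound_comp hb φ.1))
  rw [h0, map_zero] at h1
  exact (congrArg (fun T : E →L[ℂ] E => T f) h1).symm

/-- The operator is S*S, with S multiplication by the square root of c. -/
theorem isPositive_mulOp {c : (Fin 2 → ℝ) → ℝ} (hc : Continuous c)
    (hb : ∃ C, ∀ x, |c x| ≤ C) (h0 : ∀ x, 0 ≤ c x) : (mulOp (realBounded c hc hb)).IsPositive := by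
  let r : C(ℝ, ℝ) := ⟨Real.sqrt, Real.continuous_sqrt⟩
  set s := realBounded (fun x => r (c x)) (r.continuous.comp hc) (exists_bound_comp hb r) with hs
  have h1 : realBounded c hc hb = star s * s := by
    rw [hs, star_realBounded]
    ext x
    rw [BoundedContinuousFunction.mul_apply, realBounded_apply, realBounded_apply,
      ← Complex.ofReal_mul]
    exact congrArg _ (Real.mul_self_sqrt (h0 x)).symm
  rw [h1, mulOp_mul, mulOp_star, ContinuousLinearMap.star_eq_adjoint]
  exact ContinuousLinearMap.isPositive_adjoint_comp_self _

end Multiplication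

section Momentum

open MeasureTheory

/-! ### The commutator on a core -/

/-- A commutator identity on a core of the generator extends to the whole domain. -/
theorem extendsCommutator_of_core {E : Type*} [NormedAddCommGroup E] [InnerProductSpace ℂ E]
    [CompleteSpace E] {U : ℝ → E ≃ₗᵢ[ℂ] E} (hU : IsUnitaryGroup U) {A : E →ₗ.[ℂ] E}
    (hA : A.graph = generatorGraph U) {Γ : Submodule ℂ (E × E)}
    (hΓ : Γ.topologicalClosure = generatorGraph U) {H B : E →L[ℂ] E} (hH : IsSelfAdjoint H)
    (h : ∀ q ∈ Γ, (H q.1, H q.2 + Complex.I • B q.1) ∈ generatorGraph U) :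
    ExtendsCommutator H A B := by
  have hcl : IsClosed (generatorGraph U : Set (E × E)) := hU.isClosed_generatorGraph
  -- The relation AH = HA + iB on the core passes to the closure because q ↦ (H q.1, H q.2 + iB q.1)
  -- is continuous. In particular `H` preserves the domain, and symmetry of the generator yields the
  -- form identity.
  have h1 : ∀ q ∈ generatorGraph U, (H q.1, H q.2 + Complex.I • B q.1) ∈ generatorGraph U := by
    intro q hq
    rw [← hΓ] at hq
    have hc : Continuous fun q : E × E => (H q.1, H q.2 + Complex.I • B q.1) := by fun_prop
    have := map_mem_closure hc hq h
    rwa [hcl.closure_eq] at this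
  rw [extendsCommutator_iff, hA]
  intro p hp q hq
  have h2 := hU.inner_eq_inner hp (h1 q hq)
  have h3 : ⟪H p.1, q.2⟫_ℂ = ⟪p.1, H q.2⟫_ℂ := hH.isSymmetric p.1 q.2
  rw [inner_add_right, inner_smul_right] at h2
  rw [h3]
  have hI := Complex.I_mul_I
  linear_combination Complex.I * h2 + ⟪p.1, B q.1⟫_ℂ * hI

/-! ### The Laplacian in momentum space -/

theorem continuous_symbol : Continuous symbol := contDiff_symbol.continuous

theorem exists_bound_symbol : ∃ C, ∀ x, |symbol x| ≤ C := by
  refine ⟨1, fun x => ?_⟩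
  have h0 := Real.abs_cos_le_one (x 0)
  have h1 := Real.abs_cos_le_one (x 1)
  have h2 := Real.abs_cos_le_one (x 0 - x 1)
  rw [abs_le] at *
  unfold symbol
  constructor <;> linarith [h0.1, h0.2, h1.1, h1.2, h2.1, h2.2]

theorem continuous_gradSymbolSq : Continuous gradSymbolSq :=
  continuous_finsetSum _ fun j _ => ((contDiff_partialDeriv j contDiff_symbol).continuous).pow 2

theorem exists_bound_gradSymbolSq : ∃ C, ∀ x, |gradSymbolSq x| ≤ C := by
  refine ⟨2, fun x => ?_⟩
  have hs := fun t : ℝ => abs_le.1 (Real.abs_sin_le_one t)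
  have h0 : gradSymbol 0 x ^ 2 ≤ 1 := by
    rw [gradSymbol_zero, sq_le_one_iff_abs_le_one, abs_le]
    constructor <;> linarith [(hs (x 0)).1, (hs (x 0)).2, (hs (x 0 - x 1)).1, (hs (x 0 - x 1)).2]
  have h1 : gradSymbol 1 x ^ 2 ≤ 1 := by
    rw [gradSymbol_one, sq_le_one_iff_abs_le_one, abs_le]
    constructor <;> linarith [(hs (x 1)).1, (hs (x 1)).2, (hs (x 0 - x 1)).1, (hs (x 0 - x 1)).2]
  rw [gradSymbolSq, Fin.sum_univ_two, abs_of_nonneg (by positivity)]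
  linarith

/-- Multiplication by the symbol of the Laplacian. -/
abbrev symbolOp : L2Box →L[ℂ] L2Box :=
  mulOp (realBounded symbol continuous_symbol exists_bound_symbol)

/-- Multiplication by `‖∇F‖²`. -/
abbrev gradSymbolSqOp : L2Box →L[ℂ] L2Box :=
  mulOp (realBounded gradSymbolSq continuous_gradSymbolSq exists_bound_gradSymbolSq)

theorem laplacianFourier_eq_conj :
    laplacianFourier = fourierTransform.conjStarAlgEquiv laplacian := rfl

theorem inverseFourierConj_eq_conj (K : L2Box →L[ℂ] L2Box) :
    inverseFourierConj K = fourierTransform.symm.conjStarAlgEquiv K := rfl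

/-- Equality of Fourier coefficients: multiplication by each exponential in F shifts the index by a
step of the lattice. -/
theorem laplacianFourier_eq_symbolOp : laplacianFourier = symbolOp := by
  ext1 f
  apply fourierTransform.symm.injective
  refine lp.ext (funext fun n => ?_)
  rw [fourierTransform_symm_apply, fourierTransform_symm_apply, boxCoeff_congr (mulOp_coeFn _ f)]
  have h1 := boxCoeff_symbol_mul ((Lp.memLp f).integrable one_le_two) n
  refine Eq.trans ?_ h1.symm
  rw [← fourierTransform_symm_apply]
  change fourierTransform.symm (fourierTransform (laplacian (fourierTransform.symm f))) n = _
  rw [LinearIsometryEquiv.symm_apply_apply, laplacian_apply]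
  simp only [fourierTransform_symm_apply]

/-! ### The conjugate operator in momentum space -/

theorem character_mem_smoothPeriodic (n : Fin 2 → ℤ) : character n ∈ smoothPeriodic := by
  have h := Submodule.smul_mem smoothPeriodic (1 / (2 * Real.pi) : ℂ)
    (expChar_mem_smoothPeriodic (-n))
  convert h using 1
  ext x
  exact character_eq n x

theorem exists_finset_of_mem_finiteGraph {f g : Ell2} (h : (f, g) ∈ finiteGraph) :
    ∃ s : Finset (Fin 2 → ℤ), ∀ n ∉ s, f n = 0 := by
  obtain ⟨K, hK⟩ := h
  have hf := cutoff_eq_self_iff.1 (hK K le_rfl).1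
  have hfin : (Set.Icc (fun _ : Fin 2 => -((2 * K + 4 : ℕ) : ℤ))
    (fun _ => ((2 * K + 4 : ℕ) : ℤ))).Finite := Set.finite_Icc _ _
  refine ⟨hfin.toFinset, fun n hn => hf n ?_⟩
  by_contra! hle
  refine hn (hfin.mem_toFinset.2 ?_)
  have h1 : n 0 ^ 2 + n 1 ^ 2 ≤ ((2 * K + 4 : ℕ) : ℤ) := by
    have h2 : ((n 0 : ℝ)) ^ 2 + (n 1 : ℝ) ^ 2 ≤ 2 * K + 4 := hle
    exact_mod_cast h2
  have h3 : ∀ j, n j ^ 2 ≤ ((2 * K + 4 : ℕ) : ℤ) := by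
    rw [Fin.forall_fin_two]
    constructor <;> nlinarith [sq_nonneg (n 0), sq_nonneg (n 1)]
  exact ⟨fun j => by have := h3 j; nlinarith [Int.le_self_sq (-(n j))],
    fun j => by have := h3 j; nlinarith [Int.le_self_sq (n j)]⟩

theorem exists_smoothPeriodic_of_mem_finiteGraph {f g : Ell2} (h : (f, g) ∈ finiteGraph) :
    ∃ φ : smoothPeriodic, smoothPeriodicToLp φ = fourierTransform f := by
  obtain ⟨s, hs⟩ := exists_finset_of_mem_finiteGraph h
  have h1 : fourierTransform f = ∑ n ∈ s, f n • characterLp n :=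
    (hasSum_fourierTransform f).unique
      (hasSum_sum_of_ne_finset_zero fun n hn => by rw [hs n hn, zero_smul])
  refine ⟨∑ n ∈ s, f n • ⟨character n, character_mem_smoothPeriodic n⟩, ?_⟩
  rw [h1, map_sum]
  exact Finset.sum_congr rfl fun n _ => map_smul _ _ _

theorem fourierTransform_symm_conjugateFourierLp (φ : smoothPeriodic) (n : Fin 2 → ℤ) :
    fourierTransform.symm (conjugateFourierLp φ) n =
      conjugateExpr (fourierTransform.symm (smoothPeriodicToLp φ)) n := by
  have h1 : (fourierTransform.symm (smoothPeriodicToLp φ) : (Fin 2 → ℤ) → ℂ) =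
      boxCoeff (φ : (Fin 2 → ℝ) → ℂ) :=
    funext fun n => fourierTransform_symm_toLp (memLp_of_continuous φ.2.1.continuous) n
  rw [h1, ← boxCoeff_conjugateFourierExpr φ.2]
  exact fourierTransform_symm_toLp
    (memLp_of_continuous (contDiff_conjugateFourierExpr φ.2.1).continuous) n

/-- Fourier coefficients of smooth periodic functions satisfy the formal lattice expression, so
maximality of the generator gives one inclusion without any decay estimate. Conversely, the finitely
supported core is sent to trigonometric polynomials, which are smooth and periodic. -/
theorem topologicalClosure_graph_conjugateOpFourierCore {U : ℝ → Ell2 ≃ₗᵢ[ℂ] Ell2}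
    (hU : IsUnitaryGroup U) (hG : generatorGraph U = finiteGraph.topologicalClosure) :
    conjugateOpFourierCore.graph.topologicalClosure =
      generatorGraph (conjGroup fourierTransform U) := by
  have hU' := isUnitaryGroup_conjGroup fourierTransform hU
  refine le_antisymm (Submodule.topologicalClosure_minimal _ (fun p hp => ?_)
    hU'.isClosed_generatorGraph) fun p hp => ?_
  · obtain ⟨φ, rfl⟩ := exists_of_mem_graph_conjugateOpFourierCore hp
    rw [← fourierTransform.apply_symm_apply (smoothPeriodicToLp φ),
      ← fourierTransform.apply_symm_apply (conjugateFourierLp φ), mem_generatorGraph_conjGroup]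
    exact mem_generatorGraph_of_conjugateExpr hU hG fun n =>
      fourierTransform_symm_conjugateFourierLp φ n
  · obtain ⟨p1, p2⟩ := p
    rw [← fourierTransform.apply_symm_apply p1, ← fourierTransform.apply_symm_apply p2,
      mem_generatorGraph_conjGroup, hG] at hp
    have hc : Continuous fun q : Ell2 × Ell2 => (fourierTransform q.1, fourierTransform q.2) :=
      (fourierTransform.continuous.comp continuous_fst).prodMk
        (fourierTransform.continuous.comp continuous_snd)
    have h1 := map_mem_closure hc hp (t := (conjugateOpFourierCore.graph : Set (L2Box × L2Box))) ?_
    · rwa [fourierTransform.apply_symm_apply, fourierTransform.apply_symm_apply] at h1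
    rintro ⟨f, g⟩ hfg
    obtain ⟨φ, hφ⟩ := exists_smoothPeriodic_of_mem_finiteGraph hfg
    have h2 : fourierTransform g = conjugateFourierLp φ := by
      apply fourierTransform.symm.injective
      refine lp.ext (funext fun n => ?_)
      rw [fourierTransform_symm_conjugateFourierLp, hφ, LinearIsometryEquiv.symm_apply_apply,
        LinearIsometryEquiv.symm_apply_apply, conjugateExpr_of_mem_finiteGraph hfg]
    change (fourierTransform f, fourierTransform g) ∈ conjugateOpFourierCore.graph
    rw [h2, ← hφ]
    exact mem_graph_conjugateOpFourierCore φ.2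

/-! ### The commutator in momentum space -/

theorem partialDeriv_ofReal_symbol (j : Fin 2) (x : Fin 2 → ℝ) :
    partialDeriv j (fun y => (symbol y : ℂ)) x = gradSymbol j x := by
  have h := (contDiff_symbol.differentiable (by simp) x).hasFDerivAt
  have h1 := Complex.ofRealCLM.hasFDerivAt.comp x h
  exact congrArg (fun T : (Fin 2 → ℝ) →L[ℝ] ℂ => T (Pi.single j 1)) h1.fderiv

/-- By the Leibniz rule each of the two orderings contributes (∂_jF)²ψ, and the factor i/2 turns the
two into one i‖∇F‖²ψ. -/
theorem conjugateFourierExpr_symbol_mul {ψ : (Fin 2 → ℝ) → ℂ} (hψ : ψ ∈ smoothPeriodic)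
    (x : Fin 2 → ℝ) :
    conjugateFourierExpr (fun y => (symbol y : ℂ) * ψ y) x =
      symbol x * conjugateFourierExpr ψ x + Complex.I * (gradSymbolSq x * ψ x) := by
  have hS : ContDiff ℝ ∞ fun y => (symbol y : ℂ) := symbol_mem_smoothPeriodic.1
  have h1 : ∀ j, partialDeriv j (fun y => (symbol y : ℂ) * ψ y) x =
      gradSymbol j x * ψ x + symbol x * partialDeriv j ψ x := fun j => by
    rw [partialDeriv_mul j hS hψ.1, partialDeriv_ofReal_symbol]
  have h2 : ∀ j, partialDeriv j (fun y => (gradSymbol j y : ℂ) * ((symbol y : ℂ) * ψ y)) x =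
      gradSymbol j x * (gradSymbol j x * ψ x) +
        symbol x * partialDeriv j (fun y => (gradSymbol j y : ℂ) * ψ y) x := fun j => by
    have e : (fun y => (gradSymbol j y : ℂ) * ((symbol y : ℂ) * ψ y)) =
        fun y => (symbol y : ℂ) * ((gradSymbol j y : ℂ) * ψ y) := by
      ext y; ring
    rw [e, partialDeriv_mul j hS ((contDiff_gradSymbol j).mul hψ.1), partialDeriv_ofReal_symbol]
  simp only [conjugateFourierExpr, h1, h2, gradSymbolSq, Fin.sum_univ_two]
  push_cast
  ring

/-- Multiplication by F preserves the smooth periodic functions; this is the form of the commutator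
relation required by `extendsCommutator_of_core`. -/
theorem symbolOp_mem_graph {q : L2Box × L2Box} (hq : q ∈ conjugateOpFourierCore.graph) :
    (symbolOp q.1, symbolOp q.2 + Complex.I • gradSymbolSqOp q.1) ∈
      conjugateOpFourierCore.graph := by
  obtain ⟨φ, rfl⟩ := exists_of_mem_graph_conjugateOpFourierCore hq
  have hm := mul_mem_smoothPeriodic symbol_mem_smoothPeriodic φ.2
  have hφ := (memLp_of_continuous φ.2.1.continuous).coeFn_toLp
  have hφ' := (memLp_of_continuous (contDiff_conjugateFourierExpr φ.2.1).continuous).coeFn_toLp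
  have e1 : symbolOp (smoothPeriodicToLp φ) = smoothPeriodicToLp ⟨_, hm⟩ := by
    refine Lp.ext ?_
    filter_upwards [mulOp_coeFn (realBounded symbol continuous_symbol exists_bound_symbol)
      (smoothPeriodicToLp φ), (memLp_of_continuous hm.1.continuous).coeFn_toLp, hφ]
      with x h1 h2 h3
    refine h1.trans (Eq.trans ?_ h2.symm)
    exact congrArg _ h3
  have e2 : symbolOp (conjugateFourierLp φ) + Complex.I • gradSymbolSqOp (smoothPeriodicToLp φ) =
      conjugateFourierLp ⟨_, hm⟩ := by
    refine Lp.ext ?_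
    filter_upwards [mulOp_coeFn (realBounded symbol continuous_symbol exists_bound_symbol)
      (conjugateFourierLp φ),
      mulOp_coeFn (realBounded gradSymbolSq continuous_gradSymbolSq exists_bound_gradSymbolSq)
        (smoothPeriodicToLp φ),
      (memLp_of_continuous (contDiff_conjugateFourierExpr hm.1).continuous).coeFn_toLp, hφ, hφ',
      Lp.coeFn_add (symbolOp (conjugateFourierLp φ))
        (Complex.I • gradSymbolSqOp (smoothPeriodicToLp φ)),
      Lp.coeFn_smul Complex.I (gradSymbolSqOp (smoothPeriodicToLp φ))]
      with x h1 h2 h3 h4 h5 h6 h7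
    refine Eq.trans ?_ h3.symm
    rw [conjugateFourierExpr_symbol_mul φ.2, h6, Pi.add_apply, h7, Pi.smul_apply, h1, h2,
      smul_eq_mul, realBounded_apply, realBounded_apply]
    exact congrArg₂ (fun u v : ℂ => (symbol x : ℂ) * u + Complex.I * (gradSymbolSq x * v)) h5 h4
  rw [e1, e2]
  exact mem_graph_conjugateOpFourierCore hm

/-! ### Critical values and the Mourre estimate -/

/-- Adding the two equations gives sin x₁ = -sin x₂, after which sin x₂ (1 + cos x₁ + cos x₂) = 0.
If the sines vanish, both cosines are ±1 and F is 1 or -1/3. Otherwise equality of the squared sines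
forces both cosines to be -1/2, and F is -1/2. -/
theorem symbol_of_gradSymbolSq_eq_zero {x : Fin 2 → ℝ} (h : gradSymbolSq x = 0) :
    symbol x ∈ ({1, -1 / 2, -1 / 3} : Set ℝ) := by
  rw [gradSymbolSq, Fin.sum_univ_two] at h
  have h0 : gradSymbol 0 x = 0 := by
    nlinarith [sq_nonneg (gradSymbol 0 x), sq_nonneg (gradSymbol 1 x)]
  have h1 : gradSymbol 1 x = 0 := by
    nlinarith [sq_nonneg (gradSymbol 0 x), sq_nonneg (gradSymbol 1 x)]
  rw [gradSymbol_zero, Real.sin_sub] at h0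
  rw [gradSymbol_one, Real.sin_sub] at h1
  rw [symbol, Real.cos_sub]
  have p0 := Real.sin_sq_add_cos_sq (x 0)
  have p1 := Real.sin_sq_add_cos_sq (x 1)
  generalize Real.sin (x 0) = s at *
  generalize Real.cos (x 0) = c at *
  generalize Real.sin (x 1) = S at *
  generalize Real.cos (x 1) = C at *
  obtain rfl : s = -S := by linarith
  have h2 : S * (1 + c + C) = 0 := by linarith
  simp only [Set.mem_insert_iff, Set.mem_singleton_iff]
  rcases mul_eq_zero.1 h2 with rfl | h3
  · have hc : (c - 1) * (c + 1) = 0 := by linarith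
    have hC : (C - 1) * (C + 1) = 0 := by linarith
    rcases mul_eq_zero.1 hc with hc | hc <;> rcases mul_eq_zero.1 hC with hC | hC
    · obtain rfl : c = 1 := by linarith
      obtain rfl : C = 1 := by linarith
      norm_num
    · obtain rfl : c = 1 := by linarith
      obtain rfl : C = -1 := by linarith
      norm_num
    · obtain rfl : c = -1 := by linarith
      obtain rfl : C = 1 := by linarith
      norm_num
    · obtain rfl : c = -1 := by linarith
      obtain rfl : C = -1 := by linarith
      norm_num
  · obtain rfl : C = -1 - c := by linarith
    obtain rfl : c = -1 / 2 := by linarith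
    right; left
    linarith

theorem gradSymbolSq_nonneg (x : Fin 2 → ℝ) : 0 ≤ gradSymbolSq x :=
  Finset.sum_nonneg fun _ _ => sq_nonneg _

/-- A continuous function vanishing exactly on the closure of a set. -/
theorem exists_continuous_zero_iff (I : Set ℝ) : ∃ d : C(ℝ, ℝ), ∀ y, d y = 0 ↔ y ∈ closure I := by
  rcases I.eq_empty_or_nonempty with rfl | hI
  · exact ⟨1, fun y => by simp⟩
  · exact ⟨⟨fun y => Metric.infDist y I, Metric.continuous_infDist_pt I⟩,
      fun y => (Metric.mem_closure_iff_infDist_zero hI).symm⟩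

/-- Away from the critical values the gradient of the symbol is bounded from below. -/
theorem exists_pos_le_gradSymbolSq {d : C(ℝ, ℝ)} {I : Set ℝ}
    (hd : ∀ y, d y = 0 ↔ y ∈ closure I)
    (hI : closure I ⊆ Set.Icc (-1 / 2 : ℝ) 1 \ {1, -1 / 2, -1 / 3}) :
    ∃ c : ℝ, 0 < c ∧ ∀ x ∈ Set.Icc (fun _ : Fin 2 => -Real.pi) (fun _ => Real.pi),
      d (symbol x) = 0 → c ≤ gradSymbolSq x := by
  set S := Set.Icc (fun _ : Fin 2 => -Real.pi) (fun _ => Real.pi) ∩ {x | d (symbol x) = 0} with hS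
  have hcomp : IsCompact S := isCompact_Icc.inter_right
    (isClosed_eq (d.continuous.comp continuous_symbol) continuous_const)
  rcases S.eq_empty_or_nonempty with hempty | hne
  -- No point of the square is concerned, so any positive constant serves.
  · refine ⟨1, one_pos, fun x hx h0 => ?_⟩
    have : x ∈ S := ⟨hx, h0⟩
    simp [hempty] at this
  · obtain ⟨z, hz, hmin⟩ := hcomp.exists_isMinOn hne continuous_gradSymbolSq.continuousOn
    refine ⟨gradSymbolSq z, (gradSymbolSq_nonneg z).lt_of_ne' fun h0 => ?_,
      fun x hx h0 => hmin ⟨hx, h0⟩⟩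
    exact (hI ((hd _).1 hz.2)).2 (symbol_of_gradSymbolSq_eq_zero h0)

/-- The strict Mourre estimate away from the critical values. -/
theorem exists_mourre_gradSymbolSqOp {I : Set ℝ}
    (hI : closure I ⊆ Set.Icc (-1 / 2 : ℝ) 1 \ {1, -1 / 2, -1 / 3}) :
    ∃ c : ℝ, 0 < c ∧ (c : ℂ) • spectralProjection symbolOp I ≤
      spectralProjection symbolOp I ∘L gradSymbolSqOp ∘L spectralProjection symbolOp I := by
  obtain ⟨d, hd⟩ := exists_continuous_zero_iff I
  obtain ⟨c, hc, hcS⟩ := exists_pos_le_gradSymbolSq hd hI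
  refine ⟨c, hc, ?_⟩
  set P := spectralProjection symbolOp I with hP
  obtain ⟨C, hC⟩ := exists_bound_gradSymbolSq
  -- The positive part gives a positive operator on the whole space; it agrees with ‖∇F‖² - c on the
  -- functions in the range of P.
  have hr : Continuous fun x => max (gradSymbolSq x - c) 0 :=
    (continuous_gradSymbolSq.sub continuous_const).max continuous_const
  have hrb : ∃ C, ∀ x, |max (gradSymbolSq x - c) 0| ≤ C :=
    ⟨C, fun x => by
      rw [abs_of_nonneg (le_max_right _ _)]
      exact max_le (by linarith [(abs_le.1 (hC x)).2]) ((abs_nonneg _).trans (hC x))⟩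
  have hpos := (isPositive_mulOp hr hrb fun x => le_max_right _ _).conj_starProjection
    (spectralSubspace symbolOp I)
  rw [ContinuousLinearMap.le_def]
  convert hpos using 1
  change P ∘L gradSymbolSqOp ∘L P - (c : ℂ) • P = P ∘L mulOp (realBounded _ hr hrb) ∘L P
  ext1 f
  have hPf : P f ∈ spectralSubspace symbolOp I := Submodule.starProjection_apply_mem _ f
  have hPP : P (P f) = P f := Submodule.starProjection_eq_self_iff.2 hPf
  -- Since d vanishes exactly on the closure of I, this says that P f is zero almost everywhere
  -- where F lies outside that closure.
  have hker : mulOp (realBounded (fun x => d (symbol x)) (d.continuous.comp continuous_symbol)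
      (exists_bound_comp exists_bound_symbol d)) (P f) = 0 :=
    spectralSubspace_representation_le mulHom continuous_mulHom continuous_symbol
      exists_bound_symbol _ (fun x hx => by
        rw [realBounded_apply, (hd _).2 (subset_closure hx), Complex.ofReal_zero]) hPf
  have key : mulOp (realBounded _ hr hrb) (P f) = gradSymbolSqOp (P f) - (c : ℂ) • P f := by
    refine Lp.ext ?_
    have hk := mulOp_coeFn (realBounded (fun x => d (symbol x))
      (d.continuous.comp continuous_symbol) (exists_bound_comp exists_bound_symbol d)) (P f)
    rw [hker] at hk
    filter_upwards [mulOp_coeFn (realBounded _ hr hrb) (P f),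
      mulOp_coeFn (realBounded gradSymbolSq continuous_gradSymbolSq exists_bound_gradSymbolSq)
        (P f), Lp.coeFn_sub (gradSymbolSqOp (P f)) ((c : ℂ) • P f), Lp.coeFn_smul (c : ℂ) (P f),
      hk, Lp.coeFn_zero ℂ 2 boxMeasure, ae_restrict_mem measurableSet_Icc]
      with x h1 h2 h3 h4 h5 h6 h7
    rw [h1, h3, Pi.sub_apply, h2, h4, Pi.smul_apply, realBounded_apply, realBounded_apply,
      smul_eq_mul, ← sub_mul]
    rw [h6, Pi.zero_apply, realBounded_apply, eq_comm, mul_eq_zero, Complex.ofReal_eq_zero] at h5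
    rcases h5 with h5 | h5
    · rw [max_eq_left (by linarith [hcS x h7 h5]), Complex.ofReal_sub]
    · rw [h5, mul_zero, mul_zero]
  change P (gradSymbolSqOp (P f)) - (c : ℂ) • P f = P (mulOp (realBounded _ hr hrb) (P f))
  rw [key, map_sub, map_smul, hPP]

end Momentum

end TriangularLattice

end

/-! ### The proposition -/

theorem proposition3p7 :
    -- regularity, in momentum space and in position space
    IsC1 laplacianFourier conjugateOpFourier ∧
    IsC1 laplacian conjugateOp ∧
    -- the commutators exist as bounded operators, and `[Δ_𝓕, iÂ]_∘ = ‖∇F‖²(Q)`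
    ExtendsCommutator laplacianFourier conjugateOpFourier
      (commutatorExt laplacianFourier conjugateOpFourier) ∧
    ExtendsCommutator laplacian conjugateOp (commutatorExt laplacian conjugateOp) ∧
    (∀ f : L2Box, (commutatorExt laplacianFourier conjugateOpFourier f : (Fin 2 → ℝ) → ℂ)
      =ᵐ[boxMeasure] fun x => (gradSymbolSq x : ℂ) * f x) ∧
    -- the Mourre estimate, in its two equivalent forms
    ∀ a b : ℝ,
      closure (Set.Ioo a b) ⊆ Set.Icc (-1 / 2 : ℝ) 1 \ {1, -1 / 2, -1 / 3} →
      (∀ (c : ℝ) (K : L2Box →L[ℂ] L2Box),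
        MourreInequality laplacianFourier conjugateOpFourier (Set.Ioo a b) c K ↔
          MourreInequality laplacian conjugateOp (Set.Ioo a b) c (inverseFourierConj K)) ∧
      ∃ c : ℝ, 0 < c ∧ ∃ K : L2Box →L[ℂ] L2Box, IsCompactOperator K ∧
        MourreInequality laplacianFourier conjugateOpFourier (Set.Ioo a b) c K ∧
        MourreInequality laplacian conjugateOp (Set.Ioo a b) c (inverseFourierConj K) := by
  obtain ⟨U, hU, hG⟩ := exists_conjugateGroup
  have hU' := isUnitaryGroup_conjGroup fourierTransform hU
  have hA : conjugateOp.graph = generatorGraph U := graph_conjugateOp hU hG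
  have hΓ' := topologicalClosure_graph_conjugateOpFourierCore hU hG
  have hA' : conjugateOpFourier.graph = generatorGraph (conjGroup fourierTransform U) :=
    graph_closure_eq_generatorGraph hΓ'
  have hAA : ∀ f g, (fourierTransform f, fourierTransform g) ∈ conjugateOpFourier.graph ↔
      (f, g) ∈ conjugateOp.graph := fun f g => by
    rw [hA, hA', mem_generatorGraph_conjGroup]
  have hH : IsSelfAdjoint laplacian := isSelfAdjoint_laplacian
  have hH' : IsSelfAdjoint laplacianFourier := hH.map fourierTransform.conjStarAlgEquiv
  have hd : Dense (conjugateOp.domain : Set Ell2) := by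
    refine dense_domain ?_ dense_finiteGraph
    rw [hA, hG]
    exact Submodule.le_topologicalClosure _
  have hdom : (conjugateOpFourier.domain : Set L2Box) =
      fourierTransform '' (conjugateOp.domain : Set Ell2) := by
    ext x
    obtain ⟨f, rfl⟩ := fourierTransform.surjective x
    rw [fourierTransform.injective.mem_set_image, SetLike.mem_coe, SetLike.mem_coe,
      LinearPMap.mem_domain_iff, LinearPMap.mem_domain_iff, fourierTransform.surjective.exists]
    exact exists_congr fun g => hAA f g
  have hd' : Dense (conjugateOpFourier.domain : Set L2Box) := by
    rw [hdom]
    exact fourierTransform.surjective.denseRange.dense_image fourierTransform.continuous hd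
  have hB' : ExtendsCommutator laplacianFourier conjugateOpFourier gradSymbolSqOp :=
    extendsCommutator_of_core hU' hA' hΓ' hH' fun q hq => by
      rw [laplacianFourier_eq_symbolOp, ← hΓ']
      exact Submodule.le_topologicalClosure _ (symbolOp_mem_graph hq)
  have hBF : fourierTransform.conjStarAlgEquiv (inverseFourierConj gradSymbolSqOp) =
      gradSymbolSqOp := by
    rw [inverseFourierConj_eq_conj, ← LinearIsometryEquiv.symm_conjStarAlgEquiv,
      StarAlgEquiv.apply_symm_apply]
  -- The commutator is computed in momentum space only and pulled back to the lattice.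
  have hB : ExtendsCommutator laplacian conjugateOp (inverseFourierConj gradSymbolSqOp) := by
    rw [← extendsCommutator_conj fourierTransform hAA, hBF]
    exact hB'
  have hC' := commutatorExt_eq hd' hB'
  have hC := commutatorExt_eq hd hB
  have hequiv : ∀ (I : Set ℝ) (c : ℝ) (K : L2Box →L[ℂ] L2Box),
      MourreInequality laplacianFourier conjugateOpFourier I c K ↔
        MourreInequality laplacian conjugateOp I c (inverseFourierConj K) := fun I c K => by
    rw [inverseFourierConj_eq_conj]
    refine mourreInequality_conj fourierTransform hH ?_ I c K
    rw [← laplacianFourier_eq_conj, hC', hC, hBF]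
  refine ⟨isC1_of_extendsCommutator hU' hA' hd' hH' hB',
    isC1_of_extendsCommutator hU hA hd hH hB, by rwa [hC'], by rwa [hC], fun f => ?_,
    fun a b hab => ⟨hequiv _, ?_⟩⟩
  · rw [hC']
    exact mulOp_coeFn _ f
  · obtain ⟨c, hc, hle⟩ := exists_mourre_gradSymbolSqOp hab
    have hM : MourreInequality laplacianFourier conjugateOpFourier (Set.Ioo a b) c 0 := by
      rw [MourreInequality, hC', laplacianFourier_eq_symbolOp, add_zero]
      exact hle
    -- The estimate is strict: the compact remainder is zero.
    exact ⟨c, hc, 0, isCompactOperator_zero, hM, (hequiv _ c 0).1 hM⟩
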